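/- Setting. Let $M$ be a compact connected smooth Riemannian manifold with distance $d_1$ and $\operatorname{diam}(M)=1$, let $(K,d_2)$ be a non-empty compact metric space, and let $\Sigma=M\times K$ carry the metric $d_1+d_2$. Fix $0<\zeta\le 1$. For a real function $h$ on a metric space $(X,d)$ put $H_\zeta(h)=\sup_{x\ne y}|h(x)-h(y)|/d(x,y)^\zeta$ and $|h|_\zeta=H_\zeta(h)+\sup|h|$; $h$ is $\zeta$-Hölder if $H_\zeta(h)<\infty$. Let $f:M\to M$ be a local diffeomorphism of degree $\deg f=\#f^{-1}(x)$, and let $m_1$ be an $f$-invariant Borel probability on $M$ that admits a Jacobian $J>0$, i.e. $m_1(f(E))=\int_E J\,dm_1$ for every Borel set $E$ on which $f$ is injective; put $\rho=1/J$. Suppose there is a continuous $L:M\to\mathbb R$ such that every $x\in M$ has a neighbourhood $U_x$ on which $f$ is injective, with $d_1(u,v)\le L(x)\,d_1(f(u),f(v))$ for $u,v\in U_x$, and that there are an open set $\mathcal A\subset M$, constants $\sigma>1$, $1\le L\le 2$, $\varepsilon_\rho>0$ and an integer $q<\deg f$ such that (f1) $L(x)\le L$ for $x\in\mathcal A$ and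 $L(x)<\sigma^{-1}$ for $x\notin\mathcal A$; (f2) $M$ has a finite covering by open sets on each of which $f$ is injective, $q$ of which cover $\mathcal A$; (f3) $\sup\log\rho-\inf\log\rho<\varepsilon_\rho$ and $H_\zeta(\rho)<\varepsilon_\rho\inf\rho$; and $$e^{\varepsilon_\rho}\cdot\frac{(\deg f-q)\,\sigma^{-\zeta}+q\,L^\zeta\,[1+(L-1)^\zeta]}{\deg f}<1 .$$ Let $G:\Sigma\to K$ be measurable and such that, for some $0<\alpha<1$ and for $m_1$-a.e. $x\in M$, (G1) $d_2(G(x,z_1),G(x,z_2))\le\alpha\, d_2(z_1,z_2)$ for all $z_1,z_2\in K$. Let $F(x,z)=(f(x),G(x,z))$ and $F_*\mu=\mu\circ F^{-1}$. Spaces. Let $\pi_x:\Sigma\to M$ be the projection. For finite measures $\mu,\nu$ on $K$ let $W_1^\zeta(\mu,\nu)=\sup\{|\int g\,d\mu-\int g\,d\nu| : H_\zeta(g)\le 1,\ \sup|g|\le 1\}$. If $\mu$ is a finite positive measure on $\Sigma$ with $\pi_{x*}\mu\ll m_1$, and $(\mu_\gamma)_{\gamma\in M}$ is its disintegration into probabilities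 on the fibres $\{\gamma\}\times K\cong K$, let $\mu|_\gamma=\frac{d\pi_{x*}\mu}{dm_1}(\gamma)\,\mu_\gamma$. For a signed Borel measure $\mu=\mu^+-\mu^-$ (Jordan decomposition) on $\Sigma$ with $\pi_{x*}\mu^\pm\ll m_1$, let $\phi_x=\frac{d\pi_{x*}\mu^+}{dm_1}-\frac{d\pi_{x*}\mu^-}{dm_1}$ and $\|\mu\|_\infty=\operatorname{ess\,sup}_{\gamma}W_1^\zeta(\mu^+|_\gamma,\mu^-|_\gamma)$ with respect to $m_1$. The space $S^\infty$ consists of those $\mu$ for which $\|\mu\|_\infty<\infty$ and $\phi_x$ coincides $m_1$-a.e. with a $\zeta$-Hölder function; its norm is $\|\mu\|_{S^\infty}=|\phi_x|_\zeta+\|\mu\|_\infty$, where $|\phi_x|_\zeta$ is the infimum of $|h|_\zeta$ over the functions $h$ equal to $\phi_x$ $m_1$-a.e. Theorem C. (i) There is a unique $F$-invariant probability $\mu_0\in S^\infty$. (ii) There are linear maps $P,N:S^\infty\to S^\infty$ and constants $0<\xi<1$, $K>0$ such that $F_*=P+N$ on $S^\infty$, $P^2=P$, $\dim P(S^\infty)=1$,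 $PN=NP=0$, and $$\|N^n\mu\|_{S^\infty}\le\|\mu\|_{S^\infty}\,\xi^n K\qquad\text{for all }\mu\in S^\infty,\ n\ge 1. \tag{$*$}$$ (iii) For all $P,N,\xi,K$ as in (ii), every $\zeta$-Hölder function $g:\Sigma\to\mathbb R$, every $\mu_0$-integrable $f_0:\Sigma\to\mathbb R$ with $f_0\mu_0\in S^\infty$, where $(f_0\mu_0)(E)=\int_E f_0\,d\mu_0$, and every $n\ge 1$, $$\left|\int (g\circ F^n)\,f_0\,d\mu_0-\int g\,d\mu_0\int f_0\,d\mu_0\right|\le\|f_0\mu_0\|_{S^\infty}\,K\,|g|_\zeta\,\xi^n .$$ -/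

import Mathlib

open MeasureTheory Manifold Bundle
open scoped ContDiff ENNReal NNReal

set_option linter.unusedSectionVars false

noncomputable section

namespace SkewGap

section Norms

variable {X M K : Type*}

/-- The Hölder norm `|h|_ζ = H_ζ(h) + |h|_∞` of a real function on a metric space, as an extended
nonnegative number; `eHolderNorm ζ h` is the best `ζ`-Hölder constant `H_ζ(h)`. -/
def fullHolderNorm [MetricSpace X] (ζ : ℝ≥0) (h : X → ℝ) : ℝ≥0∞ :=
  eHolderNorm ζ h + ⨆ x, ‖h x‖ₑ

/-- The Hölder norm of a class of functions modulo `m₁`-null sets: the infimum of `|h|_ζ` over the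
representatives `h` of the class. It is finite exactly when there is a bounded `ζ`-Hölder
representative; if `m₁` has full support that representative is unique. -/
def aeHolderNorm [MetricSpace M] [MeasurableSpace M] (m₁ : Measure M) (ζ : ℝ≥0) (φ : M → ℝ) :
    ℝ≥0∞ :=
  ⨅ (h : M → ℝ) (_ : φ =ᵐ[m₁] h), fullHolderNorm ζ h

/-- The Wasserstein–Kantorovich-like distance `W_1^ζ` between two finite measures. -/
def wassDist [MetricSpace K] [MeasurableSpace K] (ζ : ℝ≥0) (μ ν : Measure K) : ℝ≥0∞ :=
  ⨆ (g : K → ℝ) (_ : HolderWith 1 ζ g) (_ : ∀ y, |g y| ≤ 1), ‖∫ y, g y ∂μ - ∫ y, g y ∂ν‖ₑ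

/-- The restriction `μ|_γ = φ_x(γ) μ_γ` of a positive finite measure `μ` on `M × K` to the fibre
over `γ`, seen as a measure on `K`: here `φ_x` is the density of the marginal of `μ` on `M` with
respect to `m₁` and `(μ_γ)` is the disintegration of `μ` into probabilities along the fibres. -/
def fiberRestriction [MeasurableSpace M] [MeasurableSpace K] [StandardBorelSpace K] [Nonempty K]
    (m₁ : Measure M) (μ : Measure (M × K)) [IsFiniteMeasure μ] (γ : M) : Measure K :=
  μ.fst.rnDeriv m₁ γ • μ.condKernel γ

/-- The marginal density `φ_x = dπ_{x*}μ⁺/dm₁ - dπ_{x*}μ⁻/dm₁` of a signed measure. -/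
def marginalDensity [MeasurableSpace M] [MeasurableSpace K] (m₁ : Measure M)
    (μ : SignedMeasure (M × K)) (γ : M) : ℝ :=
  (μ.toJordanDecomposition.posPart.fst.rnDeriv m₁ γ).toReal
    - (μ.toJordanDecomposition.negPart.fst.rnDeriv m₁ γ).toReal

/-- The weak norm `‖μ‖_∞ = ess sup_γ W_1^ζ(μ⁺|_γ, μ⁻|_γ)`. -/
def linftyNorm [MeasurableSpace M] [MetricSpace K] [MeasurableSpace K] [StandardBorelSpace K]
    [Nonempty K] (m₁ : Measure M) (ζ : ℝ≥0) (μ : SignedMeasure (M × K)) : ℝ≥0∞ :=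
  essSup (fun γ => wassDist ζ
    (fiberRestriction m₁ μ.toJordanDecomposition.posPart γ)
    (fiberRestriction m₁ μ.toJordanDecomposition.negPart γ)) m₁

/-- The strong norm `‖μ‖_{S^∞} = |φ_x|_ζ + ‖μ‖_∞`, possibly infinite. -/
def sinftyENorm [MetricSpace M] [MeasurableSpace M] [MetricSpace K] [MeasurableSpace K]
    [StandardBorelSpace K] [Nonempty K] (m₁ : Measure M) (ζ : ℝ≥0)
    (μ : SignedMeasure (M × K)) : ℝ≥0∞ :=
  aeHolderNorm m₁ ζ (marginalDensity m₁ μ) + linftyNorm m₁ ζ μ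

/-- The class `AB`: the marginals of `μ⁺` and `μ⁻` on `M` are absolutely continuous. -/
def MarginalsAC [MeasurableSpace M] [MeasurableSpace K] (m₁ : Measure M)
    (μ : SignedMeasure (M × K)) : Prop :=
  μ.toJordanDecomposition.posPart.fst ≪ m₁ ∧ μ.toJordanDecomposition.negPart.fst ≪ m₁

end Norms

section Closure

variable {X M K : Type*}

theorem fullHolderNorm_add_le [MetricSpace X] (ζ : ℝ≥0) (h k : X → ℝ) :
    fullHolderNorm ζ (h + k) ≤ fullHolderNorm ζ h + fullHolderNorm ζ k := by
  unfold fullHolderNorm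
  have h1 : (⨆ x, ‖(h + k) x‖ₑ) ≤ (⨆ x, ‖h x‖ₑ) + ⨆ x, ‖k x‖ₑ :=
    iSup_le fun x => (enorm_add_le _ _).trans
      (add_le_add (le_iSup (fun x => ‖h x‖ₑ) x) (le_iSup (fun x => ‖k x‖ₑ) x))
  calc _ ≤ (eHolderNorm ζ h + eHolderNorm ζ k) + ((⨆ x, ‖h x‖ₑ) + ⨆ x, ‖k x‖ₑ) :=
        add_le_add eHolderNorm_add_le h1
    _ = _ := by ring

theorem fullHolderNorm_smul [MetricSpace X] (ζ : ℝ≥0) (c : ℝ) (h : X → ℝ) :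
    fullHolderNorm ζ (c • h) = ‖c‖ₑ * fullHolderNorm ζ h := by
  unfold fullHolderNorm
  rw [eHolderNorm_smul, mul_add, ENNReal.mul_iSup]
  simp [enorm_eq_nnnorm]

theorem aeHolderNorm_add_le [MetricSpace M] [MeasurableSpace M] (m₁ : Measure M) (ζ : ℝ≥0)
    {φ ψ χ : M → ℝ} (e : χ =ᵐ[m₁] φ + ψ) :
    aeHolderNorm m₁ ζ χ ≤ aeHolderNorm m₁ ζ φ + aeHolderNorm m₁ ζ ψ := by
  unfold aeHolderNorm
  simp only [ENNReal.iInf_add, ENNReal.add_iInf]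
  refine le_iInf fun k => le_iInf fun hk => le_iInf fun h => le_iInf fun hh => ?_
  exact (iInf₂_le (h + k) (e.trans (hh.add hk))).trans (fullHolderNorm_add_le ζ h k)

theorem aeHolderNorm_smul_lt_top [MetricSpace M] [MeasurableSpace M] (m₁ : Measure M) (ζ : ℝ≥0)
    (c : ℝ) {φ χ : M → ℝ} (e : χ =ᵐ[m₁] c • φ) (hφ : aeHolderNorm m₁ ζ φ < ⊤) :
    aeHolderNorm m₁ ζ χ < ⊤ := by
  unfold aeHolderNorm at *
  simp only [iInf_lt_iff] at hφ
  obtain ⟨h, hh, hlt⟩ := hφ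
  refine (iInf₂_le (c • h) (e.trans (hh.const_smul c))).trans_lt ?_
  rw [fullHolderNorm_smul]
  exact ENNReal.mul_lt_top (by simp) hlt

variable [MeasurableSpace M] [MeasurableSpace K] [StandardBorelSpace K] [Nonempty K]

theorem measurable_fiberRestriction (m₁ : Measure M) (μ : Measure (M × K)) [IsFiniteMeasure μ]
    {A : Set K} (hA : MeasurableSet A) : Measurable fun γ => fiberRestriction m₁ μ γ A := by
  simp only [fiberRestriction, Measure.smul_apply, smul_eq_mul]
  exact (Measure.measurable_rnDeriv _ _).mul (ProbabilityTheory.Kernel.measurable_coe _ hA)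

theorem setLIntegral_fiberRestriction (m₁ : Measure M) [IsFiniteMeasure m₁] (μ : Measure (M × K))
    [IsFiniteMeasure μ] (hμ : μ.fst ≪ m₁) {B : Set M} (hB : MeasurableSet B) {A : Set K}
    (hA : MeasurableSet A) :
    ∫⁻ γ in B, fiberRestriction m₁ μ γ A ∂m₁ = μ (B ×ˢ A) := by
  simp only [fiberRestriction, Measure.smul_apply, smul_eq_mul]
  rw [setLIntegral_rnDeriv_mul hμ (ProbabilityTheory.Kernel.measurable_coe _ hA).aemeasurable hB,
    ← Measure.compProd_apply_prod hB hA, μ.disintegrate μ.condKernel]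

theorem ae_isFiniteMeasure_fiberRestriction (m₁ : Measure M) [IsFiniteMeasure m₁]
    (μ : Measure (M × K)) [IsFiniteMeasure μ] :
    ∀ᵐ γ ∂m₁, IsFiniteMeasure (fiberRestriction m₁ μ γ) := by
  filter_upwards [Measure.rnDeriv_lt_top μ.fst m₁] with γ hγ
  exact ⟨by simpa [fiberRestriction] using hγ⟩

/-- Two measurable families of measures with the same integrals are almost everywhere equal. -/
theorem ae_eq_of_families (m₁ : Measure M) [IsFiniteMeasure m₁] {κ η : M → Measure K}
    (mκ : ∀ A, MeasurableSet A → Measurable fun γ => κ γ A)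
    (mη : ∀ A, MeasurableSet A → Measurable fun γ => η γ A)
    (fκ : ∀ᵐ γ ∂m₁, IsFiniteMeasure (κ γ))
    (h : ∀ B A, MeasurableSet B → MeasurableSet A →
      ∫⁻ γ in B, κ γ A ∂m₁ = ∫⁻ γ in B, η γ A ∂m₁) : ∀ᵐ γ ∂m₁, κ γ = η γ := by
  have key : ∀ A, MeasurableSet A → ∀ᵐ γ ∂m₁, κ γ A = η γ A := fun A hA =>
    ae_eq_of_forall_setLIntegral_eq_of_sigmaFinite (mκ A hA) (mη A hA)
      fun B hB _ => h B A hB hA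
  set C : Set (Set K) := generateSetAlgebra (MeasurableSpace.countableGeneratingSet K) with hC
  have hCc : C.Countable :=
    countable_generateSetAlgebra MeasurableSpace.countable_countableGeneratingSet
  have hgen : ‹MeasurableSpace K› = MeasurableSpace.generateFrom C := by
    rw [hC, generateFrom_generateSetAlgebra_eq,
      MeasurableSpace.generateFrom_countableGeneratingSet]
  have hCm : ∀ A ∈ C, MeasurableSet A := fun A hA => by
    rw [hgen]; exact MeasurableSpace.measurableSet_generateFrom hA
  have hpi : IsPiSystem C := fun s hs t ht _ =>
    isSetAlgebra_generateSetAlgebra.inter_mem hs ht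
  have h1 : ∀ᵐ γ ∂m₁, ∀ A ∈ C, κ γ A = η γ A :=
    (ae_ball_iff hCc).2 fun A hA => key A (hCm A hA)
  filter_upwards [h1, key Set.univ MeasurableSet.univ, fκ] with γ h1 h2 h3
  exact ext_of_generate_finite C hgen hpi h1 h2

theorem fiberRestriction_add (m₁ : Measure M) [IsFiniteMeasure m₁] (μ ν : Measure (M × K))
    [IsFiniteMeasure μ] [IsFiniteMeasure ν] (hμ : μ.fst ≪ m₁) (hν : ν.fst ≪ m₁) :
    ∀ᵐ γ ∂m₁, fiberRestriction m₁ (μ + ν) γ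
      = fiberRestriction m₁ μ γ + fiberRestriction m₁ ν γ := by
  refine ae_eq_of_families m₁ (fun A hA => measurable_fiberRestriction m₁ _ hA)
    (fun A hA => (measurable_fiberRestriction m₁ μ hA).add (measurable_fiberRestriction m₁ ν hA))
    (ae_isFiniteMeasure_fiberRestriction m₁ _) fun B A hB hA => ?_
  simp only [Measure.add_apply]
  rw [lintegral_add_left (measurable_fiberRestriction m₁ μ hA),
    setLIntegral_fiberRestriction m₁ μ hμ hB hA, setLIntegral_fiberRestriction m₁ ν hν hB hA,
    setLIntegral_fiberRestriction m₁ _ _ hB hA, Measure.add_apply]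
  rw [Measure.fst_add]
  exact hμ.add_left hν

theorem fiberRestriction_smul (m₁ : Measure M) [IsFiniteMeasure m₁] (c : ℝ≥0)
    (μ : Measure (M × K)) [IsFiniteMeasure μ] (hμ : μ.fst ≪ m₁) :
    ∀ᵐ γ ∂m₁, fiberRestriction m₁ (c • μ) γ = c • fiberRestriction m₁ μ γ := by
  have e : (c • μ).fst = c • μ.fst := by
    simp only [Measure.fst, Measure.map_smul]
  refine ae_eq_of_families m₁ (fun A hA => measurable_fiberRestriction m₁ _ hA)
    (fun A hA => (measurable_fiberRestriction m₁ μ hA).const_smul c)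
    (ae_isFiniteMeasure_fiberRestriction m₁ _) fun B A hB hA => ?_
  simp only [Measure.smul_apply]
  rw [setLIntegral_fiberRestriction m₁ _ _ hB hA]
  · change c • μ (B ×ˢ A) = ∫⁻ γ in B, (c : ℝ≥0∞) * fiberRestriction m₁ μ γ A ∂m₁
    rw [lintegral_const_mul _ (measurable_fiberRestriction m₁ μ hA),
      setLIntegral_fiberRestriction m₁ μ hμ hB hA]
    rfl
  · rw [e]
    exact hμ.smul_left c

/-- Absolute continuity of the marginals, in terms of the signed measure alone. -/
theorem marginalsAC_iff (m₁ : Measure M) (μ : SignedMeasure (M × K)) :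
    MarginalsAC m₁ μ ↔ ∀ B, MeasurableSet B → m₁ B = 0 →
      ∀ E, MeasurableSet E → E ⊆ Prod.fst ⁻¹' B → μ E = 0 := by
  constructor
  · rintro ⟨hp, hn⟩ B hB hB0 E hE hEB
    have h1 := hp hB0
    have h2 := hn hB0
    rw [Measure.fst_apply hB] at h1 h2
    rw [SignedMeasure.apply_eq_posPart_real_sub_negPart_real μ hE, measureReal_def,
      measureReal_def, measure_mono_null hEB h1, measure_mono_null hEB h2]
    simp
  · intro h
    obtain ⟨i, hi, hi2, hi3, hp, hn⟩ := μ.toJordanDecomposition_spec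
    refine ⟨Measure.AbsolutelyContinuous.mk fun B hB hB0 => ?_,
      Measure.AbsolutelyContinuous.mk fun B hB hB0 => ?_⟩
    · rw [Measure.fst_apply hB, hp, SignedMeasure.toMeasureOfZeroLE_apply _ hi2 hi (measurable_fst hB)]
      have := h B hB hB0 (i ∩ Prod.fst ⁻¹' B) (hi.inter (measurable_fst hB)) Set.inter_subset_right
      simp [this]
    · rw [Measure.fst_apply hB, hn, SignedMeasure.toMeasureOfLEZero_apply _ hi3 hi.compl
        (measurable_fst hB)]
      have := h B hB hB0 (iᶜ ∩ Prod.fst ⁻¹' B) (hi.compl.inter (measurable_fst hB))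
        Set.inter_subset_right
      simp [this]

theorem marginalsAC_add (m₁ : Measure M) {μ ν : SignedMeasure (M × K)} (hμ : MarginalsAC m₁ μ)
    (hν : MarginalsAC m₁ ν) : MarginalsAC m₁ (μ + ν) := by
  rw [marginalsAC_iff] at *
  intro B hB hB0 E hE hEB
  simp [hμ B hB hB0 E hE hEB, hν B hB hB0 E hE hEB]

theorem marginalsAC_smul (m₁ : Measure M) (c : ℝ) {μ : SignedMeasure (M × K)}
    (hμ : MarginalsAC m₁ μ) : MarginalsAC m₁ (c • μ) := by
  rw [marginalsAC_iff] at *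
  intro B hB hB0 E hE hEB
  simp [hμ B hB hB0 E hE hEB]

/-- The Jordan decompositions of `μ`, `ν` and `μ + ν` are related by an identity between positive
measures. -/
theorem jordan_add (μ ν : SignedMeasure (M × K)) :
    (μ + ν).toJordanDecomposition.posPart
        + (μ.toJordanDecomposition.negPart + ν.toJordanDecomposition.negPart)
      = (μ + ν).toJordanDecomposition.negPart
        + (μ.toJordanDecomposition.posPart + ν.toJordanDecomposition.posPart) := by
  ext E hE
  have h := SignedMeasure.apply_eq_posPart_real_sub_negPart_real (μ + ν) hE
  have h1 := SignedMeasure.apply_eq_posPart_real_sub_negPart_real μ hE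
  have h2 := SignedMeasure.apply_eq_posPart_real_sub_negPart_real ν hE
  rw [← ENNReal.toReal_eq_toReal_iff' (measure_ne_top _ _) (measure_ne_top _ _)]
  change Measure.real _ E = Measure.real _ E
  rw [measureReal_add_apply, measureReal_add_apply, measureReal_add_apply, measureReal_add_apply]
  rw [add_apply] at h
  linarith

theorem fiberRestriction_jordan_add (m₁ : Measure M) [IsFiniteMeasure m₁]
    {μ ν : SignedMeasure (M × K)} (hμ : MarginalsAC m₁ μ) (hν : MarginalsAC m₁ ν) :
    ∀ᵐ γ ∂m₁, fiberRestriction m₁ (μ + ν).toJordanDecomposition.posPart γ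
        + (fiberRestriction m₁ μ.toJordanDecomposition.negPart γ
          + fiberRestriction m₁ ν.toJordanDecomposition.negPart γ)
      = fiberRestriction m₁ (μ + ν).toJordanDecomposition.negPart γ
        + (fiberRestriction m₁ μ.toJordanDecomposition.posPart γ
          + fiberRestriction m₁ ν.toJordanDecomposition.posPart γ) := by
  have hs := marginalsAC_add m₁ hμ hν
  have a1 : (μ.toJordanDecomposition.negPart + ν.toJordanDecomposition.negPart).fst ≪ m₁ := by
    rw [Measure.fst_add]; exact hμ.2.add_left hν.2
  have a2 : (μ.toJordanDecomposition.posPart + ν.toJordanDecomposition.posPart).fst ≪ m₁ := by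
    rw [Measure.fst_add]; exact hμ.1.add_left hν.1
  filter_upwards [fiberRestriction_add m₁ _ _ hμ.1 hν.1, fiberRestriction_add m₁ _ _ hμ.2 hν.2,
    fiberRestriction_add m₁ _ _ hs.1 a1, fiberRestriction_add m₁ _ _ hs.2 a2] with γ h1 h2 h3 h4
  rw [← h1, ← h2, ← h3, ← h4]
  congr 1
  simp only [jordan_add]

theorem marginalDensity_add (m₁ : Measure M) [IsFiniteMeasure m₁]
    {μ ν : SignedMeasure (M × K)} (hμ : MarginalsAC m₁ μ) (hν : MarginalsAC m₁ ν) :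
    marginalDensity m₁ (μ + ν) =ᵐ[m₁] marginalDensity m₁ μ + marginalDensity m₁ ν := by
  filter_upwards [fiberRestriction_jordan_add m₁ hμ hν,
    Measure.rnDeriv_lt_top (μ + ν).toJordanDecomposition.posPart.fst m₁,
    Measure.rnDeriv_lt_top (μ + ν).toJordanDecomposition.negPart.fst m₁,
    Measure.rnDeriv_lt_top μ.toJordanDecomposition.posPart.fst m₁,
    Measure.rnDeriv_lt_top μ.toJordanDecomposition.negPart.fst m₁,
    Measure.rnDeriv_lt_top ν.toJordanDecomposition.posPart.fst m₁,
    Measure.rnDeriv_lt_top ν.toJordanDecomposition.negPart.fst m₁] with γ h h1 h2 h3 h4 h5 h6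
  have e := congrArg (fun m : Measure K => (m Set.univ).toReal) h
  simp only [fiberRestriction, Measure.add_apply, Measure.smul_apply, smul_eq_mul,
    measure_univ, mul_one] at e
  rw [ENNReal.toReal_add h1.ne (ENNReal.add_lt_top.2 ⟨h4, h6⟩).ne,
    ENNReal.toReal_add h2.ne (ENNReal.add_lt_top.2 ⟨h3, h5⟩).ne,
    ENNReal.toReal_add h4.ne h6.ne, ENNReal.toReal_add h3.ne h5.ne] at e
  simp only [marginalDensity, Pi.add_apply]
  linarith

theorem marginalDensity_neg (m₁ : Measure M) (μ : SignedMeasure (M × K)) :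
    marginalDensity m₁ (-μ) = (-1 : ℝ) • marginalDensity m₁ μ := by
  funext γ
  simp [marginalDensity, SignedMeasure.toJordanDecomposition_neg]

theorem marginalDensity_nnsmul (m₁ : Measure M) [IsFiniteMeasure m₁] (c : ℝ≥0)
    (μ : SignedMeasure (M × K)) :
    marginalDensity m₁ (c • μ) =ᵐ[m₁] (c : ℝ) • marginalDensity m₁ μ := by
  have e : ∀ ν : Measure (M × K), (c • ν).fst = c • ν.fst := fun ν => by
    simp only [Measure.fst, Measure.map_smul]
  filter_upwards [Measure.rnDeriv_smul_left_of_ne_top μ.toJordanDecomposition.posPart.fst m₁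
      (ENNReal.coe_ne_top (r := c)),
    Measure.rnDeriv_smul_left_of_ne_top μ.toJordanDecomposition.negPart.fst m₁
      (ENNReal.coe_ne_top (r := c))] with γ h1 h2
  simp only [marginalDensity, SignedMeasure.toJordanDecomposition_smul,
    JordanDecomposition.smul_posPart, JordanDecomposition.smul_negPart, e, Pi.smul_apply]
  have h1' : (c • μ.toJordanDecomposition.posPart.fst).rnDeriv m₁ γ
      = (c : ℝ≥0∞) * μ.toJordanDecomposition.posPart.fst.rnDeriv m₁ γ := h1
  have h2' : (c • μ.toJordanDecomposition.negPart.fst).rnDeriv m₁ γ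
      = (c : ℝ≥0∞) * μ.toJordanDecomposition.negPart.fst.rnDeriv m₁ γ := h2
  rw [h1', h2']
  simp [mul_sub]

end Closure

section Wasserstein

variable {M K : Type*} [MetricSpace K] [CompactSpace K] [MeasurableSpace K] [BorelSpace K]

theorem integrable_of_holder {ζ : ℝ≥0} (hζ : 0 < ζ) {C : ℝ≥0} {g : K → ℝ}
    (hg : HolderWith C ζ g) (μ : Measure K) [IsFiniteMeasure μ] : Integrable g μ :=
  (hg.continuous hζ).integrable_of_hasCompactSupport (HasCompactSupport.of_compactSpace g)

theorem wassDist_le_add {ζ : ℝ≥0} (hζ : 0 < ζ) {a b p p' n n' : Measure K} [IsFiniteMeasure a]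
    [IsFiniteMeasure b] [IsFiniteMeasure p] [IsFiniteMeasure p'] [IsFiniteMeasure n]
    [IsFiniteMeasure n'] (h : a + (n + n') = b + (p + p')) :
    wassDist ζ a b ≤ wassDist ζ p n + wassDist ζ p' n' := by
  refine iSup_le fun g => iSup_le fun hg => iSup_le fun hb => ?_
  have I : ∀ (m : Measure K) [IsFiniteMeasure m], Integrable g m := fun m _ =>
    integrable_of_holder hζ hg m
  have e : ∫ y, g y ∂a + (∫ y, g y ∂n + ∫ y, g y ∂n')
      = ∫ y, g y ∂b + (∫ y, g y ∂p + ∫ y, g y ∂p') := by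
    rw [← integral_add_measure (I _) (I _), ← integral_add_measure (I _) (I _), h,
      integral_add_measure (I _) (I _), integral_add_measure (I _) (I _)]
  have e2 : ∫ y, g y ∂a - ∫ y, g y ∂b
      = (∫ y, g y ∂p - ∫ y, g y ∂n) + (∫ y, g y ∂p' - ∫ y, g y ∂n') := by linarith
  rw [e2]
  refine (enorm_add_le _ _).trans (add_le_add ?_ ?_)
  · exact le_iSup_of_le g (le_iSup_of_le hg (le_iSup_of_le hb le_rfl))
  · exact le_iSup_of_le g (le_iSup_of_le hg (le_iSup_of_le hb le_rfl))

theorem wassDist_comm (ζ : ℝ≥0) (a b : Measure K) : wassDist ζ a b = wassDist ζ b a := by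
  unfold wassDist
  simp only [← edist_eq_enorm_sub]
  simp only [edist_comm]

theorem wassDist_smul_le (ζ : ℝ≥0) (c : ℝ≥0) (a b : Measure K) :
    wassDist ζ (c • a) (c • b) ≤ c * wassDist ζ a b := by
  refine iSup_le fun g => iSup_le fun hg => iSup_le fun hb => ?_
  rw [integral_smul_nnreal_measure, integral_smul_nnreal_measure, ← smul_sub]
  have : ‖c • (∫ y, g y ∂a - ∫ y, g y ∂b)‖ₑ = c * ‖∫ y, g y ∂a - ∫ y, g y ∂b‖ₑ := by
    rw [NNReal.smul_def, smul_eq_mul, enorm_mul]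
    simp
  rw [this]
  gcongr
  exact le_iSup_of_le g (le_iSup_of_le hg (le_iSup_of_le hb le_rfl))

variable [Nonempty K] [MeasurableSpace M]

theorem linftyNorm_add_le (m₁ : Measure M) [IsFiniteMeasure m₁] {ζ : ℝ≥0} (hζ : 0 < ζ)
    {μ ν : SignedMeasure (M × K)} (hμ : MarginalsAC m₁ μ) (hν : MarginalsAC m₁ ν) :
    linftyNorm m₁ ζ (μ + ν) ≤ linftyNorm m₁ ζ μ + linftyNorm m₁ ζ ν := by
  refine (essSup_mono_ae ?_).trans (ENNReal.essSup_add_le _ _)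
  filter_upwards [fiberRestriction_jordan_add m₁ hμ hν,
    ae_isFiniteMeasure_fiberRestriction m₁ (μ + ν).toJordanDecomposition.posPart,
    ae_isFiniteMeasure_fiberRestriction m₁ (μ + ν).toJordanDecomposition.negPart,
    ae_isFiniteMeasure_fiberRestriction m₁ μ.toJordanDecomposition.posPart,
    ae_isFiniteMeasure_fiberRestriction m₁ μ.toJordanDecomposition.negPart,
    ae_isFiniteMeasure_fiberRestriction m₁ ν.toJordanDecomposition.posPart,
    ae_isFiniteMeasure_fiberRestriction m₁ ν.toJordanDecomposition.negPart]
    with γ h h1 h2 h3 h4 h5 h6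
  exact wassDist_le_add hζ h

theorem linftyNorm_neg (m₁ : Measure M) (ζ : ℝ≥0) (μ : SignedMeasure (M × K)) :
    linftyNorm m₁ ζ (-μ) = linftyNorm m₁ ζ μ := by
  unfold linftyNorm
  simp only [SignedMeasure.toJordanDecomposition_neg, JordanDecomposition.neg_posPart,
    JordanDecomposition.neg_negPart]
  congr 1
  funext γ
  exact wassDist_comm ζ _ _

theorem linftyNorm_nnsmul_le (m₁ : Measure M) [IsFiniteMeasure m₁] (ζ c : ℝ≥0)
    {μ : SignedMeasure (M × K)} (hμ : MarginalsAC m₁ μ) :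
    linftyNorm m₁ ζ (c • μ) ≤ c * linftyNorm m₁ ζ μ := by
  unfold linftyNorm
  rw [← ENNReal.essSup_const_mul]
  refine essSup_mono_ae ?_
  filter_upwards [fiberRestriction_smul m₁ c _ hμ.1, fiberRestriction_smul m₁ c _ hμ.2]
    with γ h1 h2
  simp only [SignedMeasure.toJordanDecomposition_smul, JordanDecomposition.smul_posPart,
    JordanDecomposition.smul_negPart]
  rw [h1, h2]
  exact wassDist_smul_le ζ c _ _

variable [MetricSpace M]

/-- The space `S^∞` of signed measures on `M × K` whose marginals are absolutely continuous with
respect to `m₁`, whose weak norm is finite and whose marginal density is `ζ`-Hölder. -/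
def SInfty (m₁ : Measure M) [IsFiniteMeasure m₁] (ζ : ℝ≥0) (hζ : 0 < ζ) :
    Submodule ℝ (SignedMeasure (M × K)) where
  carrier := {μ | MarginalsAC m₁ μ ∧ sinftyENorm m₁ ζ μ < ⊤}
  zero_mem' := by
    have hz : MarginalsAC m₁ (0 : SignedMeasure (M × K)) := by
      rw [marginalsAC_iff]; intros; rfl
    have h0 : (0 : SignedMeasure (M × K)) = (0 : ℝ≥0) • 0 := by simp
    refine ⟨hz, ENNReal.add_lt_top.2 ⟨?_, ?_⟩⟩
    · refine (iInf₂_le (0 : M → ℝ) ?_).trans_lt ?_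
      · have := marginalDensity_nnsmul m₁ 0 (0 : SignedMeasure (M × K))
        rw [← h0] at this
        simpa using this
      · simp [fullHolderNorm]
    · rw [h0]
      exact (linftyNorm_nnsmul_le m₁ ζ 0 hz).trans_lt (by simp)
  add_mem' := by
    rintro μ ν ⟨hμ, hμ'⟩ ⟨hν, hν'⟩
    rw [sinftyENorm, ENNReal.add_lt_top] at hμ' hν'
    refine ⟨marginalsAC_add m₁ hμ hν, ENNReal.add_lt_top.2 ⟨?_, ?_⟩⟩
    · exact (aeHolderNorm_add_le m₁ ζ (marginalDensity_add m₁ hμ hν)).trans_lt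
        (ENNReal.add_lt_top.2 ⟨hμ'.1, hν'.1⟩)
    · exact (linftyNorm_add_le m₁ hζ hμ hν).trans_lt (ENNReal.add_lt_top.2 ⟨hμ'.2, hν'.2⟩)
  smul_mem' := by
    rintro c μ ⟨hμ, hμ'⟩
    rw [sinftyENorm, ENNReal.add_lt_top] at hμ'
    have key : ∀ r : ℝ≥0, aeHolderNorm m₁ ζ (marginalDensity m₁ (r • μ)) < ⊤ ∧
        linftyNorm m₁ ζ (r • μ) < ⊤ := fun r =>
      ⟨aeHolderNorm_smul_lt_top m₁ ζ r (marginalDensity_nnsmul m₁ r μ) hμ'.1,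
        (linftyNorm_nnsmul_le m₁ ζ r hμ).trans_lt (ENNReal.mul_lt_top (by simp) hμ'.2)⟩
    refine ⟨marginalsAC_smul m₁ c hμ, ?_⟩
    rcases le_total 0 c with hc | hc
    · lift c to ℝ≥0 using hc
      exact ENNReal.add_lt_top.2 (key c)
    · have e : c • μ = -((-c).toNNReal • μ) := by
        have h1 : ((-c).toNNReal • μ : SignedMeasure (M × K))
            = (((-c).toNNReal : ℝ≥0) : ℝ) • μ := rfl
        rw [h1, Real.coe_toNNReal _ (by linarith)]
        ext E _
        simp
      rw [e]
      refine ENNReal.add_lt_top.2 ⟨?_, ?_⟩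
      · rw [marginalDensity_neg]
        exact aeHolderNorm_smul_lt_top m₁ ζ (-1) Filter.EventuallyEq.rfl (key _).1
      · rw [linftyNorm_neg]
        exact (key _).2

/-- The norm of `S^∞`. -/
def sinftyNorm (m₁ : Measure M) (ζ : ℝ≥0) (μ : SignedMeasure (M × K)) : ℝ :=
  (sinftyENorm m₁ ζ μ).toReal

end Wasserstein

section Dynamics

variable {M K : Type*}

/-- The skew product `F(x, z) = (f(x), G(x, z))`. -/
def skewProduct (f : M → M) (G : M × K → K) (p : M × K) : M × K := (f p.1, G p)

/-- The degree of `f`: the number of preimages of a point (the same for all points when `f` is a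
local homeomorphism of a compact connected space). -/
def mapDegree (f : M → M) : ℕ := ⨆ x : M, (f ⁻¹' {x}).ncard

/-- `J > 0` is the Jacobian of `f` with respect to `m₁`. -/
structure IsJacobian [MeasurableSpace M] (m₁ : Measure M) (f : M → M) (J : M → ℝ) : Prop where
  measurable : Measurable J
  pos : ∀ x, 0 < J x
  measure_image : ∀ E, MeasurableSet E → Set.InjOn f E →
    m₁ (f '' E) = ∫⁻ x in E, ENNReal.ofReal (J x) ∂m₁

/-- The weight `ρ = 1 / |det f'|`, where `J = |det f'|` is the Jacobian of `f`. -/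
def weight (J : M → ℝ) (x : M) : ℝ := 1 / J x

/-- The hypotheses on the base map `f` and on its invariant probability `m₁` with Jacobian `J`.
`Λ` bounds the Lipschitz constants of the local inverse branches of `f`, `A` is the region where
`f` may fail to expand, and `q` is the number of domains of injectivity needed to cover `A`. -/
structure BaseHypotheses {d : ℕ} [MetricSpace M] [ChartedSpace (EuclideanSpace ℝ (Fin d)) M]
    [MeasurableSpace M] (ζ : ℝ≥0) (f : M → M) (m₁ : Measure M) (J Λ : M → ℝ) (A : Set M)
    (σ L ε : ℝ) (q : ℕ) : Prop where
  localDiffeo : IsLocalDiffeomorph (𝓡 d) (𝓡 d) 1 f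
  invariant : MeasurePreserving f m₁ m₁
  jacobian : IsJacobian m₁ f J
  continuous_bound : Continuous Λ
  inverse_branch : ∀ x, ∃ U ∈ nhds x, Set.InjOn f U ∧
    ∀ u ∈ U, ∀ v ∈ U, dist u v ≤ Λ x * dist (f u) (f v)
  isOpen_region : IsOpen A
  one_lt_sigma : 1 < σ
  one_le_L : 1 ≤ L
  L_le_two : L ≤ 2
  bound_on_region : ∀ x ∈ A, Λ x ≤ L
  bound_off_region : ∀ x ∉ A, Λ x < σ⁻¹
  covering : ∃ 𝒰 : Finset (Set M), (∀ U ∈ 𝒰, IsOpen U ∧ Set.InjOn f U) ∧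
    (⋃ U ∈ 𝒰, U) = Set.univ ∧ ∃ 𝒱 ⊆ 𝒰, 𝒱.card = q ∧ A ⊆ ⋃ V ∈ 𝒱, V
  q_lt_degree : q < mapDegree f
  eps_pos : 0 < ε
  osc_log_weight : (⨆ x, Real.log (weight J x)) - (⨅ x, Real.log (weight J x)) < ε
  holder_weight : eHolderNorm ζ (weight J) < ENNReal.ofReal (ε * ⨅ x, weight J x)
  smallness : Real.exp ε *
    ((((mapDegree f : ℝ) - q) * σ ^ (-(ζ : ℝ)) + q * L ^ (ζ : ℝ) * (1 + (L - 1) ^ (ζ : ℝ)))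
      / mapDegree f) < 1

/-- `G` contracts `m₁`-almost every fibre `{x} × K` with rate `α`. -/
def ContractsFibers [MeasurableSpace M] [MetricSpace K] (m₁ : Measure M) (G : M × K → K)
    (α : ℝ) : Prop :=
  ∀ᵐ x ∂m₁, ∀ z₁ z₂ : K, dist (G (x, z₁)) (G (x, z₂)) ≤ α * dist z₁ z₂

/-- A function on `M × K`, regarded as a function on the product with the metric `d₁ + d₂`. -/
def onSumMetric (g : M × K → ℝ) (p : WithLp 1 (M × K)) : ℝ := g (WithLp.ofLp p)

variable [MetricSpace M] [MeasurableSpace M] [MetricSpace K] [CompactSpace K] [Nonempty K]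
  [MeasurableSpace K] [BorelSpace K]

/-- `μ` is an `F`-invariant probability that belongs to `S^∞`. -/
def IsInvariantInSInfty (F : M × K → M × K) (m₁ : Measure M) [IsFiniteMeasure m₁] (ζ : ℝ≥0)
    (hζ : 0 < ζ) (μ : ProbabilityMeasure (M × K)) : Prop :=
  (μ : Measure (M × K)).map F = μ ∧ (μ : Measure (M × K)).toSignedMeasure ∈ SInfty m₁ ζ hζ

/-- The spectral gap of the transfer operator `F_*` on `S^∞`: `F_* = P + N` with `P` a projection
of rank one, `PN = NP = 0`, and `‖N^n μ‖ ≤ ‖μ‖ ξ^n C`. -/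
structure IsSpectralGap (F : M × K → M × K) (m₁ : Measure M) [IsFiniteMeasure m₁] (ζ : ℝ≥0)
    (hζ : 0 < ζ) (P N : Module.End ℝ (SInfty (K := K) m₁ ζ hζ)) (ξ C : ℝ) : Prop where
  decomposition : ∀ μ : SInfty (K := K) m₁ ζ hζ,
    (μ : SignedMeasure (M × K)).map F = (P μ : SignedMeasure (M × K)) + N μ
  projection : P * P = P
  rank_one : Module.finrank ℝ (LinearMap.range P) = 1
  xi_pos : 0 < ξ
  xi_lt_one : ξ < 1
  const_pos : 0 < C
  bound : ∀ n : ℕ, 1 ≤ n → ∀ μ : SInfty (K := K) m₁ ζ hζ,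
    sinftyNorm m₁ ζ ((N ^ n) μ : SignedMeasure (M × K))
      ≤ sinftyNorm m₁ ζ (μ : SignedMeasure (M × K)) * ξ ^ n * C
  proj_mul : P * N = 0
  mul_proj : N * P = 0

end Dynamics

end SkewGap

end

open SkewGap

/-! Everything follows from one estimate, `FlatteningDual.exists_decay`: on the measures of total
mass zero in `S^∞` the iterates of `F_*` decay exponentially. A measure is controlled through its
marginal density and through its action on functions along the fibres.

The marginal density evolves under the transfer operator dual to composition with `f`, whose weights
`ρ` are normalized along fibres. Branches outside `A` contract distances. At most `q` branches meet
`A`, and there a segment stretched by `L ≤ 2` is cut into two pieces. This gives a Lasota–Yorke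
inequality (`LocHolder.transfer`) whose rate is less than one by the smallness hypothesis and whose
error term involves only the oscillation. The oscillation shrinks because any two points have close
`k`-th preimages (`exists_close_preimages`, from the same inequality with uniform weights, which has
no error term) and each preimage carries a definite share of the weight (`OscLE.contract`). A
weighted sum of Hölder constant and oscillation is therefore contracted (`exists_contraction_step`).
When the mass is zero the density has mean zero, so its supremum is bounded by its oscillation and
decays too.

For the fibres, the weak norm is rewritten by duality: it is the best `C` with `|∫ Φ dμ| ≤ C m₁(B)`
for all test functions `Φ` supported over `B` and Hölder along fibres (`weakBound_of_linftyNorm_le`,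
`linftyNorm_le_of_weakBound`). After subtracting its value at a reference point of each fibre, `Φ ∘
F` is `α^ζ` times another test function, and the subtracted part depends on the base point only, so
it sees only the marginal density (`WeakBound.map`). The weak norm thus contracts up to a term that
already decays.

For existence, push `m₁ × δ` forward: successive differences have mass zero and tend to zero, so a
weak limit point should be invariant. Since `G` is only measurable, passing to the limit needs test
functions that are merely measurable in `x`; this works because all marginals equal `m₁`
(`tendsto_integral_of_fst_eq`). For uniqueness, the difference of two invariant probabilities is a
fixed point of mass zero. The gap is then `P μ = μ(Σ) μ₀`, `N = F_* - P`. In (iii) the gap is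
arbitrary, so `IsSpectralGap.proj_eq` first shows that its `P` must be this one; the correlation is
then the integral of `g` against `N^n (f₀ μ₀)`. -/

noncomputable section

namespace SkewGap

/-! ### Transfer operators with normalized weights and the Lasota–Yorke inequality. -/

section Transfer

variable {M : Type*} [MetricSpace M]

/-- `h` is `ζ`-Hölder with constant `C` at scales smaller than `δ`. -/
def LocHolder (ζ C δ : ℝ) (h : M → ℝ) : Prop :=
  ∀ x y, dist x y < δ → |h x - h y| ≤ C * dist x y ^ ζ

/-- The oscillation of `h` is at most `s`. -/
def OscLE {X : Type*} (s : ℝ) (h : X → ℝ) : Prop := ∀ x y, h x - h y ≤ s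

/-- Any two points are joined by a segment, as far as distances are concerned. -/
def HasIntermediatePoints (M : Type*) [MetricSpace M] : Prop :=
  ∀ (x y : M) (t : ℝ), 0 ≤ t → t ≤ 1 →
    ∃ z, dist x z ≤ t * dist x y ∧ dist z y ≤ (1 - t) * dist x y

theorem LocHolder.mono {ζ C C' δ : ℝ} {h : M → ℝ} (H : LocHolder ζ C δ h) (hC : C ≤ C') :
    LocHolder ζ C' δ h := fun x y hxy =>
  (H x y hxy).trans (mul_le_mul_of_nonneg_right hC (Real.rpow_nonneg dist_nonneg _))

theorem OscLE.mono {X : Type*} {s s' : ℝ} {h : X → ℝ} (H : OscLE s h) (hs : s ≤ s') :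
    OscLE s' h := fun x y => (H x y).trans hs

theorem OscLE.abs_le {X : Type*} {s : ℝ} {h : X → ℝ} (H : OscLE s h) (x y : X) :
    |h x - h y| ≤ s :=
  abs_sub_le_iff.2 ⟨H x y, H y x⟩

/-- In a space with intermediate points the scale can be doubled. -/
theorem LocHolder.double (hM : HasIntermediatePoints M) {ζ C δ : ℝ} (hζ : 0 ≤ ζ) (hC : 0 ≤ C)
    {h : M → ℝ} (H : LocHolder ζ C δ h) : LocHolder ζ (2 * C) (2 * δ) h := by
  intro x y hxy
  obtain ⟨z, h1, h2⟩ := hM x y (1 / 2) (by norm_num) (by norm_num)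
  have hd : (0 : ℝ) ≤ dist x y := dist_nonneg
  have e1 := H x z (by linarith)
  have e2 := H z y (by linarith)
  have r1 : dist x z ^ ζ ≤ dist x y ^ ζ := Real.rpow_le_rpow dist_nonneg (by linarith) hζ
  have r2 : dist z y ^ ζ ≤ dist x y ^ ζ := Real.rpow_le_rpow dist_nonneg (by linarith) hζ
  have := abs_sub_le (h x) (h z) (h y)
  nlinarith [mul_le_mul_of_nonneg_left r1 hC, mul_le_mul_of_nonneg_left r2 hC]

theorem LocHolder.double_pow (hM : HasIntermediatePoints M) {ζ C δ : ℝ} (hζ : 0 ≤ ζ) (hC : 0 ≤ C)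
    {h : M → ℝ} (H : LocHolder ζ C δ h) (k : ℕ) : LocHolder ζ (2 ^ k * C) (2 ^ k * δ) h := by
  induction k with
  | zero => simpa using H
  | succ k ih =>
    have := ih.double hM hζ (by positivity)
    rwa [pow_succ', mul_assoc, mul_assoc]

/-- In a bounded space with intermediate points, a local Hölder bound is a global one. -/
theorem exists_holder_of_locHolder (hM : HasIntermediatePoints M)
    (hdiam : ∀ x y : M, dist x y ≤ 1) {ζ δ : ℝ} (hζ : 0 ≤ ζ) (hδ : 0 < δ) :
    ∃ Q : ℝ, 1 ≤ Q ∧ ∀ (C : ℝ) (h : M → ℝ), 0 ≤ C → LocHolder ζ C δ h →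
      ∀ x y, |h x - h y| ≤ Q * C * dist x y ^ ζ := by
  obtain ⟨k, hk⟩ := pow_unbounded_of_one_lt (1 / δ) (one_lt_two (α := ℝ))
  -- Each doubling of the scale doubles the constant, and `k` doublings carry `δ` past the diameter.
  refine ⟨2 ^ k, one_le_pow₀ one_le_two, fun C h hC H x y => ?_⟩
  refine H.double_pow hM hζ hC k x y ((hdiam x y).trans_lt ?_)
  rwa [div_lt_iff₀ hδ] at hk

/-- The inverse branches of a map `f` with fibres `fib`, at scale `δ`: nearby fibres are matched so
that matched points are at most `L` times as far from each other as the base points, and at most `τ`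
times if the first one is outside the region `A`, which holds at most `q` of the `D` points. -/
structure Branches (f : M → M) (fib : M → Finset M) (A : Set M) (D q : ℕ) (L τ δ : ℝ) : Prop where
  mem_fib : ∀ x y, y ∈ fib x ↔ f y = x
  card_fib : ∀ x, (fib x).card = D
  card_region : ∀ x, ∀ t ⊆ fib x, (∀ y ∈ t, y ∈ A) → t.card ≤ q
  q_le : q ≤ D
  D_pos : 0 < D
  one_le_L : 1 ≤ L
  L_le_two : L ≤ 2
  tau_pos : 0 < τ
  tau_le_one : τ ≤ 1
  delta_pos : 0 < δ
  pairing : ∀ x x', dist x x' < δ → ∃ e : M → M, Set.BijOn e (fib x) (fib x') ∧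
    ∀ y ∈ fib x, dist y (e y) ≤ L * dist x x' ∧ (y ∉ A → dist y (e y) ≤ τ * dist x x')

/-- The contraction rate of the branches. -/
def branchRate (D q : ℕ) (L τ ζ : ℝ) : ℝ :=
  ((D : ℝ) - q) * τ ^ ζ + q * (L ^ ζ * (1 + (L - 1) ^ ζ))

/-- Normalized positive weights on the branches, Hölder along matched points. -/
structure BranchWeight (fib : M → Finset M) (L δ ζ : ℝ) (p : M → ℝ) (c β B : ℝ) : Prop where
  beta_pos : 0 < β
  beta_le : ∀ y, β ≤ p y
  le_c : ∀ y, p y ≤ c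
  sum_one : ∀ x, ∑ y ∈ fib x, p y = 1
  B_nonneg : 0 ≤ B
  variation : ∀ x x', dist x x' < δ → ∀ y ∈ fib x, ∀ y' ∈ fib x', dist y y' ≤ L * dist x x' →
    |p y - p y'| ≤ B * dist x x' ^ ζ

/-- The transfer operator with weight `p`. -/
def transfer (fib : M → Finset M) (p : M → ℝ) (h : M → ℝ) (x : M) : ℝ := ∑ y ∈ fib x, p y * h y

variable {f : M → M} {fib : M → Finset M} {A : Set M} {D q : ℕ} {L τ δ ζ : ℝ}
  {p : M → ℝ} {c β B : ℝ}

theorem BranchWeight.nonneg (hp : BranchWeight fib L δ ζ p c β B) (y : M) : 0 ≤ p y :=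
  hp.beta_pos.le.trans (hp.beta_le y)

theorem transfer_le (hp : BranchWeight fib L δ ζ p c β B) {h : M → ℝ} {S : ℝ}
    (hS : ∀ y, h y ≤ S) (x : M) : transfer fib p h x ≤ S := by
  calc transfer fib p h x ≤ ∑ y ∈ fib x, p y * S :=
        Finset.sum_le_sum fun y _ => mul_le_mul_of_nonneg_left (hS y) (hp.nonneg y)
    _ = S := by rw [← Finset.sum_mul, hp.sum_one, one_mul]

theorem le_transfer (hp : BranchWeight fib L δ ζ p c β B) {h : M → ℝ} {S : ℝ}
    (hS : ∀ y, S ≤ h y) (x : M) : S ≤ transfer fib p h x := by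
  calc S = ∑ y ∈ fib x, p y * S := by rw [← Finset.sum_mul, hp.sum_one, one_mul]
    _ ≤ transfer fib p h x :=
        Finset.sum_le_sum fun y _ => mul_le_mul_of_nonneg_left (hS y) (hp.nonneg y)

theorem transfer_sub_const (hp : BranchWeight fib L δ ζ p c β B) (h : M → ℝ) (a : ℝ) :
    transfer fib p (fun y => h y - a) = fun x => transfer fib p h x - a := by
  funext x
  simp only [transfer, mul_sub, Finset.sum_sub_distrib]
  rw [← Finset.sum_mul, hp.sum_one, one_mul]

theorem transfer_const_sub (hp : BranchWeight fib L δ ζ p c β B) (h : M → ℝ) (a : ℝ) :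
    transfer fib p (fun y => a - h y) = fun x => a - transfer fib p h x := by
  funext x
  simp only [transfer, mul_sub, Finset.sum_sub_distrib]
  rw [← Finset.sum_mul, hp.sum_one, one_mul]

theorem transfer_iterate_sub_const (hp : BranchWeight fib L δ ζ p c β B) (h : M → ℝ) (a : ℝ)
    (n : ℕ) : (transfer fib p)^[n] (fun y => h y - a) = fun x => (transfer fib p)^[n] h x - a := by
  induction n with
  | zero => rfl
  | succ n ih => rw [Function.iterate_succ_apply', ih, transfer_sub_const hp,
      Function.iterate_succ_apply']

theorem transfer_iterate_const_sub (hp : BranchWeight fib L δ ζ p c β B) (h : M → ℝ) (a : ℝ)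
    (n : ℕ) : (transfer fib p)^[n] (fun y => a - h y) = fun x => a - (transfer fib p)^[n] h x := by
  induction n with
  | zero => rfl
  | succ n ih => rw [Function.iterate_succ_apply', ih, transfer_const_sub hp,
      Function.iterate_succ_apply']

/-- Each value of the transfer is an average of values of `h` with weights of total one, so it stays
between the bounds of `h`. -/
theorem OscLE.transfer (hp : BranchWeight fib L δ ζ p c β B) {h : M → ℝ} {s : ℝ}
    (hs : OscLE s h) : OscLE s (transfer fib p h) := by
  intro x x'
  have h1 : ∀ y', SkewGap.transfer fib p h x ≤ s + h y' := fun y' =>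
    transfer_le hp (fun y => by linarith [hs y y']) x
  have h2 := le_transfer hp (S := SkewGap.transfer fib p h x - s) (fun y' => sub_le_iff_le_add'.2 (h1 y')) x'
  linarith

theorem OscLE.transfer_iterate (hp : BranchWeight fib L δ ζ p c β B) {h : M → ℝ} {s : ℝ}
    (hs : OscLE s h) (n : ℕ) : OscLE s ((SkewGap.transfer fib p)^[n] h) := by
  induction n with
  | zero => exact hs
  | succ n ih => rw [Function.iterate_succ_apply']; exact ih.transfer hp

/-- The variation of a Hölder function between two points that a branch may push apart. -/
theorem LocHolder.abs_sub_le_of_dist_le (hM : HasIntermediatePoints M) {C : ℝ} (hC : 0 ≤ C)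
    (hζ : 0 ≤ ζ) (hL1 : 1 ≤ L) (hL2 : L ≤ 2) {h : M → ℝ} (H : LocHolder ζ C δ h) {t : ℝ}
    (ht0 : 0 ≤ t) (ht : t < δ) {y y' : M} (hy : dist y y' ≤ L * t) :
    |h y - h y'| ≤ C * (L ^ ζ * (1 + (L - 1) ^ ζ)) * t ^ ζ := by
  have hL0 : 0 < L := by linarith
  -- The point at fraction `1 / L` leaves pieces of length at most `t` and `(L - 1) t`. Because `L ≤
  -- 2`, both are below the scale `δ`, although the whole segment may not be.
  obtain ⟨z, h1, h2⟩ := hM y y' (1 / L) (by positivity) (by rw [div_le_one hL0]; exact hL1)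
  have i1 : dist y z ≤ t := h1.trans (by
    rw [one_div, inv_mul_le_iff₀ hL0]; exact hy)
  have i2 : dist z y' ≤ (L - 1) * t := h2.trans (by
    have : (1 - 1 / L) * dist y y' ≤ (1 - 1 / L) * (L * t) :=
      mul_le_mul_of_nonneg_left hy (by rw [sub_nonneg, div_le_one hL0]; exact hL1)
    refine this.trans_eq ?_
    field_simp)
  have i2' : dist z y' < δ := lt_of_le_of_lt i2 (by nlinarith)
  have e1 := H y z (i1.trans_lt ht)
  have e2 := H z y' i2'
  have r1 : dist y z ^ ζ ≤ t ^ ζ := Real.rpow_le_rpow dist_nonneg i1 hζ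
  have r2 : dist z y' ^ ζ ≤ (L - 1) ^ ζ * t ^ ζ := by
    rw [← Real.mul_rpow (by linarith) ht0]
    exact Real.rpow_le_rpow dist_nonneg i2 hζ
  have key : |h y - h y'| ≤ C * ((1 + (L - 1) ^ ζ) * t ^ ζ) := by
    have := abs_sub_le (h y) (h z) (h y')
    nlinarith [mul_le_mul_of_nonneg_left r1 hC, mul_le_mul_of_nonneg_left r2 hC]
  -- The bound obtained so far lacks the factor `L ^ ζ`; it is weakened to the form that appears in
  -- the smallness hypothesis.
  have hLz : 1 ≤ L ^ ζ := Real.one_le_rpow hL1 hζ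
  have hn : 0 ≤ C * ((1 + (L - 1) ^ ζ) * t ^ ζ) := (abs_nonneg _).trans key
  calc |h y - h y'| ≤ 1 * (C * ((1 + (L - 1) ^ ζ) * t ^ ζ)) := by rw [one_mul]; exact key
    _ ≤ L ^ ζ * (C * ((1 + (L - 1) ^ ζ) * t ^ ζ)) := mul_le_mul_of_nonneg_right hLz hn
    _ = _ := by ring

/-- The Lasota–Yorke inequality for the transfer operator. -/
theorem LocHolder.transfer (hM : HasIntermediatePoints M) (hb : Branches f fib A D q L τ δ)
    (hp : BranchWeight fib L δ ζ p c β B) (hζ : 0 ≤ ζ) {C s : ℝ} (hC : 0 ≤ C)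
    {h : M → ℝ} (H : LocHolder ζ C δ h) (hs : OscLE s h) :
    LocHolder ζ (c * branchRate D q L τ ζ * C + D * B * s) δ (transfer fib p h) := by
  classical
  intro x x' hxx
  obtain ⟨e, he, hd⟩ := hb.pairing x x' hxx
  set t := dist x x' with ht
  have ht0 : 0 ≤ t := dist_nonneg
  have htz : 0 ≤ t ^ ζ := Real.rpow_nonneg ht0 _
  have sum_e : ∀ u : M → ℝ, ∑ y ∈ fib x', u y = ∑ y ∈ fib x, u (e y) := fun u =>
    (Finset.sum_nbij e (fun y hy => he.mapsTo hy) he.injOn he.surjOn fun y _ => rfl).symm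
  set a := τ ^ ζ with ha
  set b := L ^ ζ * (1 + (L - 1) ^ ζ) with hbdef
  have hab : a ≤ b := by
    have h1 : a ≤ 1 := Real.rpow_le_one hb.tau_pos.le hb.tau_le_one hζ
    have h2 : 1 ≤ L ^ ζ := Real.one_le_rpow hb.one_le_L hζ
    have h3 : 0 ≤ (L - 1) ^ ζ := Real.rpow_nonneg (by linarith [hb.one_le_L]) _
    nlinarith
  have hc0 : 0 ≤ c := (hp.nonneg x).trans (hp.le_c x)
  have term : ∀ y ∈ fib x, |p y * (h y - h (e y))| ≤ c * C * t ^ ζ * (if y ∈ A then b else a) := by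
    intro y hy
    have key : |h y - h (e y)| ≤ C * (if y ∈ A then b else a) * t ^ ζ := by
      split_ifs with hyA
      · exact H.abs_sub_le_of_dist_le hM hC hζ hb.one_le_L hb.L_le_two ht0 hxx (hd y hy).1
      · have h1 := (hd y hy).2 hyA
        have h2 : dist y (e y) < δ := h1.trans_lt (lt_of_le_of_lt
          (mul_le_of_le_one_left ht0 hb.tau_le_one) hxx)
        refine (H _ _ h2).trans ?_
        rw [mul_assoc]
        refine mul_le_mul_of_nonneg_left ?_ hC
        rw [ha, ← Real.mul_rpow hb.tau_pos.le ht0]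
        exact Real.rpow_le_rpow dist_nonneg h1 hζ
    rw [abs_mul, abs_of_nonneg (hp.nonneg y)]
    calc p y * |h y - h (e y)|
        ≤ c * |h y - h (e y)| := mul_le_mul_of_nonneg_right (hp.le_c y) (abs_nonneg _)
      _ ≤ c * (C * (if y ∈ A then b else a) * t ^ ζ) := mul_le_mul_of_nonneg_left key hc0
      _ = _ := by ring
  -- As `a ≤ b`, the worst case is that the full number `q` of preimages lies in `A`.
  have count : ∑ y ∈ fib x, (if y ∈ A then b else a) ≤ branchRate D q L τ ζ := by
    have h0 : ∀ y ∈ fib x, (if y ∈ A then b else a) = a + (if y ∈ A then b - a else 0) := by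
      intro y _; split_ifs <;> ring
    rw [Finset.sum_congr rfl h0, Finset.sum_add_distrib, Finset.sum_const, ← Finset.sum_filter,
      Finset.sum_const, hb.card_fib, nsmul_eq_mul, nsmul_eq_mul, branchRate]
    have hk : (((fib x).filter (· ∈ A)).card : ℝ) ≤ q := by
      exact_mod_cast hb.card_region x _ (Finset.filter_subset _ _)
        fun y hy => (Finset.mem_filter.1 hy).2
    nlinarith [mul_le_mul_of_nonneg_right hk (sub_nonneg.2 hab)]
  have first : |∑ y ∈ fib x, p y * (h y - h (e y))| ≤ c * branchRate D q L τ ζ * C * t ^ ζ := by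
    refine (Finset.abs_sum_le_sum_abs _ _).trans ((Finset.sum_le_sum term).trans ?_)
    rw [← Finset.mul_sum]
    refine (mul_le_mul_of_nonneg_left count (by positivity)).trans_eq (by ring)
  -- The weights sum to one on both fibres, so their differences sum to zero and `h` may be
  -- recentred at `h x`. Hence the error term costs the oscillation of `h` and not its supremum.
  have second : |∑ y ∈ fib x, (p y - p (e y)) * (h (e y) - h x)| ≤ D * B * s * t ^ ζ := by
    have hs0 : 0 ≤ s := by simpa using hs x x
    refine (Finset.abs_sum_le_sum_abs _ _).trans ?_
    have : ∀ y ∈ fib x, |(p y - p (e y)) * (h (e y) - h x)| ≤ B * t ^ ζ * s := by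
      intro y hy
      rw [abs_mul]
      exact mul_le_mul (hp.variation x x' hxx y hy (e y) (he.mapsTo hy) (hd y hy).1)
        (hs.abs_le _ _) (abs_nonneg _) (mul_nonneg hp.B_nonneg htz)
    refine (Finset.sum_le_sum this).trans_eq ?_
    rw [Finset.sum_const, hb.card_fib, nsmul_eq_mul]
    ring
  have hsum : ∑ y ∈ fib x, p (e y) = 1 := by rw [← sum_e]; exact hp.sum_one x'
  have split : SkewGap.transfer fib p h x - SkewGap.transfer fib p h x'
      = ∑ y ∈ fib x, p y * (h y - h (e y)) + ∑ y ∈ fib x, (p y - p (e y)) * (h (e y) - h x) := by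
    have h1 : ∑ y ∈ fib x, (p y - p (e y)) * (h (e y) - h x)
        = ∑ y ∈ fib x, p y * h (e y) - ∑ y ∈ fib x, p (e y) * h (e y) := by
      have : ∀ y ∈ fib x, (p y - p (e y)) * (h (e y) - h x)
          = p y * h (e y) - p (e y) * h (e y) - (p y * h x - p (e y) * h x) := by
        intro y _; ring
      rw [Finset.sum_congr rfl this, Finset.sum_sub_distrib, Finset.sum_sub_distrib,
        Finset.sum_sub_distrib, ← Finset.sum_mul, ← Finset.sum_mul, hp.sum_one, hsum]
      ring
    rw [h1]
    simp only [SkewGap.transfer, mul_sub, Finset.sum_sub_distrib]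
    rw [sum_e]
    ring
  rw [split]
  refine (abs_add_le _ _).trans ((add_le_add first second).trans_eq (by ring))

theorem transfer_nonneg (hp : BranchWeight fib L δ ζ p c β B) {u : M → ℝ} (hu : ∀ y, 0 ≤ u y)
    (n : ℕ) (x : M) : 0 ≤ (transfer fib p)^[n] u x := by
  induction n generalizing x with
  | zero => exact hu x
  | succ n ih => rw [Function.iterate_succ_apply']; exact le_transfer hp ih x

/-- A nonnegative function is felt by its iterated transfer along any backward orbit. -/
theorem pow_mul_le_transfer_iterate (hb : Branches f fib A D q L τ δ)
    (hp : BranchWeight fib L δ ζ p c β B) {u : M → ℝ} (hu : ∀ y, 0 ≤ u y) (n : ℕ) (x y : M)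
    (hy : f^[n] y = x) : β ^ n * u y ≤ (transfer fib p)^[n] u x := by
  induction n generalizing x with
  | zero => simp only [Function.iterate_zero, id] at hy; simp [hy]
  | succ n ih =>
    rw [Function.iterate_succ_apply'] at hy ⊢
    have h1 := ih (f^[n] y) rfl
    have hmem : f^[n] y ∈ fib x := (hb.mem_fib _ _).2 hy
    have hpow : 0 ≤ β ^ n * u y := mul_nonneg (pow_nonneg hp.beta_pos.le _) (hu y)
    calc β ^ (n + 1) * u y = β * (β ^ n * u y) := by ring
      _ ≤ p (f^[n] y) * (transfer fib p)^[n] u (f^[n] y) :=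
          mul_le_mul (hp.beta_le _) h1 hpow (hp.nonneg _)
      _ ≤ _ := Finset.single_le_sum
          (f := fun z => p z * (transfer fib p)^[n] u z)
          (fun z _ => mul_nonneg (hp.nonneg z) (transfer_nonneg hp hu n z)) hmem

/-- An average with positive weights cannot be smaller than all the values averaged; a suitable
preimage is chosen at each level. -/
theorem exists_preimage_le_transfer (hb : Branches f fib A D q L τ δ)
    (hp : BranchWeight fib L δ ζ p c β B) (u : M → ℝ) (n : ℕ) (x : M) :
    ∃ y, f^[n] y = x ∧ u y ≤ (transfer fib p)^[n] u x := by
  induction n generalizing x with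
  | zero => exact ⟨x, rfl, le_rfl⟩
  | succ n ih =>
    have : ∃ z ∈ fib x, (transfer fib p)^[n] u z ≤ (transfer fib p)^[n + 1] u x := by
      by_contra! hcon
      have hne : (fib x).Nonempty := by
        rw [← Finset.card_pos, hb.card_fib]; exact hb.D_pos
      rw [Function.iterate_succ_apply'] at hcon
      have : ∑ y ∈ fib x, p y * transfer fib p ((transfer fib p)^[n] u) x
          < ∑ y ∈ fib x, p y * (transfer fib p)^[n] u y :=
        Finset.sum_lt_sum_of_nonempty hne fun y hy =>
          mul_lt_mul_of_pos_left (hcon y hy) (hp.beta_pos.trans_le (hp.beta_le y))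
      rw [← Finset.sum_mul, hp.sum_one, one_mul] at this
      exact lt_irrefl _ this
    obtain ⟨z, hz, hz'⟩ := this
    obtain ⟨y, hy, hy'⟩ := ih z
    exact ⟨y, by rw [Function.iterate_succ_apply', hy]; exact (hb.mem_fib _ _).1 hz, hy'.trans hz'⟩

theorem transfer_iterate_eq_zero (hb : Branches f fib A D q L τ δ) {u : M → ℝ} (n : ℕ) (x : M)
    (hu : ∀ y, f^[n] y = x → u y = 0) : (transfer fib p)^[n] u x = 0 := by
  induction n generalizing x with
  | zero => exact hu x rfl
  | succ n ih =>
    rw [Function.iterate_succ_apply']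
    refine Finset.sum_eq_zero fun z hz => ?_
    rw [ih z fun y hy => hu y ?_, mul_zero]
    rw [Function.iterate_succ_apply', hy]
    exact (hb.mem_fib _ _).1 hz

/-- The iterated Lasota–Yorke inequality. -/
theorem LocHolder.transfer_iterate (hM : HasIntermediatePoints M) (hb : Branches f fib A D q L τ δ)
    (hp : BranchWeight fib L δ ζ p c β B) (hζ : 0 ≤ ζ) {θ : ℝ}
    (hθ : c * branchRate D q L τ ζ ≤ θ) (hθ0 : 0 ≤ θ) (hθ1 : θ < 1) {C s : ℝ} (hC : 0 ≤ C)
    {h : M → ℝ} (H : LocHolder ζ C δ h) (hs0 : 0 ≤ s) (hs : OscLE s h) (n : ℕ) :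
    LocHolder ζ (θ ^ n * C + D * B / (1 - θ) * s) δ ((SkewGap.transfer fib p)^[n] h) := by
  have h1 : 0 < 1 - θ := by linarith
  have hB := hp.B_nonneg
  induction n with
  | zero =>
    refine LocHolder.mono (C := C) H ?_
    have : 0 ≤ D * B / (1 - θ) * s := by positivity
    simpa using this
  | succ n ih =>
    rw [Function.iterate_succ_apply']
    have hC' : 0 ≤ θ ^ n * C + D * B / (1 - θ) * s := by positivity
    refine (ih.transfer hM hb hp hζ hC' (hs.transfer_iterate hp n)).mono ?_
    -- The error constant `E = D B / (1 - θ)` is the fixed point of `E ↦ θ E + D B`, that is, the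
    -- sum of the geometric series of errors.
    refine (add_le_add (mul_le_mul_of_nonneg_right hθ hC') le_rfl).trans_eq ?_
    field_simp
    ring

end Transfer

end SkewGap

end

noncomputable section

namespace SkewGap

/-! ### Exponential decay of Hölder constant and oscillation. -/

section Decay

variable {M : Type*} [MetricSpace M] {f : M → M} {fib : M → Finset M} {A : Set M} {D q : ℕ}
  {L τ δ ζ : ℝ} {p : M → ℝ} {c β B : ℝ}

theorem branchRate_nonneg (hb : Branches f fib A D q L τ δ) : 0 ≤ branchRate D q L τ ζ := by
  have h1 : (q : ℝ) ≤ D := by exact_mod_cast hb.q_le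
  have h2 : 0 ≤ τ ^ ζ := Real.rpow_nonneg hb.tau_pos.le _
  have h3 : 0 ≤ L ^ ζ := Real.rpow_nonneg (by linarith [hb.one_le_L]) _
  have h4 : 0 ≤ (L - 1) ^ ζ := Real.rpow_nonneg (by linarith [hb.one_le_L]) _
  have h5 : 0 ≤ (D : ℝ) - q := by linarith
  unfold branchRate
  positivity

/-- Constant weights do not vary, so `B = 0` and the Lasota–Yorke inequality loses its error term.
This operator serves only to probe the geometry of the preimages. -/
theorem branchWeight_uniform (hb : Branches f fib A D q L τ δ) :
    BranchWeight fib L δ ζ (fun _ => 1 / (D : ℝ)) (1 / D) (1 / D) 0 where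
  beta_pos := by have := hb.D_pos; positivity
  beta_le _ := le_rfl
  le_c _ := le_rfl
  sum_one x := by
    have : (D : ℝ) ≠ 0 := by exact_mod_cast hb.D_pos.ne'
    rw [Finset.sum_const, hb.card_fib, nsmul_eq_mul]
    field_simp
  B_nonneg := le_rfl
  variation := by intros; simp

/-- For `ζ ≤ 1` the power is subadditive, so the `ζ`-th power of a distance function is `ζ`-Hölder
with constant one. -/
theorem rpow_sub_rpow_le {a b t : ℝ} (hb : 0 ≤ b) (ht : 0 ≤ t) (hζ : 0 < ζ) (hζ1 : ζ ≤ 1)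
    (ha : 0 ≤ a) (h : a ≤ b + t) : a ^ ζ - b ^ ζ ≤ t ^ ζ := by
  have h1 : a ^ ζ ≤ (b + t) ^ ζ := Real.rpow_le_rpow ha h hζ.le
  have h2 := Real.rpow_add_le_add_rpow hb ht hζ.le hζ1
  linarith

/-- Any two points have iterated preimages that are close to each other. -/
theorem exists_close_preimages (hM : HasIntermediatePoints M) (hdiam : ∀ x y : M, dist x y ≤ 1)
    (hb : Branches f fib A D q L τ δ) (hζ : 0 < ζ) (hζ1 : ζ ≤ 1)
    (hθ : 1 / (D : ℝ) * branchRate D q L τ ζ < 1) {r : ℝ} (hr : 0 < r) :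
    ∃ k, ∀ x x', ∃ y y', f^[k] y = x ∧ f^[k] y' = x' ∧ dist y y' < r := by
  obtain ⟨Q, hQ1, hQ⟩ := exists_holder_of_locHolder hM hdiam hζ.le hb.delta_pos
  have hu := branchWeight_uniform (ζ := ζ) hb
  set θ := 1 / (D : ℝ) * branchRate D q L τ ζ with hθdef
  have hθ0 : 0 ≤ θ := mul_nonneg (by positivity) (branchRate_nonneg hb)
  have hrz : 0 < r ^ ζ := Real.rpow_pos_of_pos hr _
  obtain ⟨k, hk⟩ := exists_pow_lt_of_lt_one (div_pos hrz (by linarith : 0 < Q)) hθ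
  refine ⟨k, fun x x' => ?_⟩
  set Y : Set M := {y | f^[k] y = x'} with hY
  have hYne : Y.Nonempty := by
    obtain ⟨y, hy, -⟩ := exists_preimage_le_transfer hb hu (fun _ => 0) k x'
    exact ⟨y, hy⟩
  -- This function vanishes on the `k`-th preimages of `x'`, so its `k`-th transfer vanishes at
  -- `x'`. That transfer has Hölder constant at most `Q θ ^ k`, so it is small at `x` as well.
  set h : M → ℝ := fun z => Metric.infDist z Y ^ ζ with hh
  have hH : LocHolder ζ 1 δ h := by
    intro a b _
    rw [one_mul, abs_sub_le_iff]
    constructor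
    · exact rpow_sub_rpow_le Metric.infDist_nonneg dist_nonneg hζ hζ1 Metric.infDist_nonneg
        Metric.infDist_le_infDist_add_dist
    · rw [dist_comm]
      exact rpow_sub_rpow_le Metric.infDist_nonneg dist_nonneg hζ hζ1 Metric.infDist_nonneg
        Metric.infDist_le_infDist_add_dist
  have hO : OscLE 1 h := by
    intro a b
    obtain ⟨y, hy⟩ := hYne
    have h1 : h a ≤ 1 := Real.rpow_le_one Metric.infDist_nonneg
      ((Metric.infDist_le_dist_of_mem hy).trans (hdiam _ _)) hζ.le
    have h2 : 0 ≤ h b := Real.rpow_nonneg Metric.infDist_nonneg _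
    linarith
  have hT := hH.transfer_iterate hM hb hu hζ.le le_rfl hθ0 hθ zero_le_one zero_le_one hO k
  have hC0 : 0 ≤ θ ^ k * 1 + D * 0 / (1 - θ) * 1 := by
    rw [mul_zero, zero_div, zero_mul, add_zero, mul_one]
    exact pow_nonneg hθ0 k
  have hG := hQ _ _ hC0 hT x x'
  have hz : (transfer fib (fun _ => 1 / (D : ℝ)))^[k] h x' = 0 :=
    transfer_iterate_eq_zero hb k x' fun y hy => by
      have : Metric.infDist y Y = 0 := Metric.infDist_zero_of_mem hy
      simp only [hh, this]
      exact Real.zero_rpow hζ.ne'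
  -- Some `k`-th preimage of `x` does no worse than the average, hence lies near the set `Y`.
  obtain ⟨y, hy, hy'⟩ := exists_preimage_le_transfer hb hu h k x
  have hlt : h y < r ^ ζ := by
    have hd : dist x x' ^ ζ ≤ 1 := Real.rpow_le_one dist_nonneg (hdiam _ _) hζ.le
    have hk' : Q * θ ^ k < r ^ ζ := by rwa [lt_div_iff₀ (by linarith), mul_comm] at hk
    rw [hz, sub_zero] at hG
    have h3 := (le_abs_self _).trans hG
    have h4 : 0 ≤ Q * θ ^ k := mul_nonneg (by linarith) (pow_nonneg hθ0 k)
    have h5 : Q * (θ ^ k * 1 + D * 0 / (1 - θ) * 1) * dist x x' ^ ζ ≤ Q * θ ^ k := by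
      have : Q * (θ ^ k * 1 + D * 0 / (1 - θ) * 1) = Q * θ ^ k := by simp
      rw [this]
      exact mul_le_of_le_one_right h4 hd
    linarith
  have hlt' : Metric.infDist y Y < r := by
    by_contra! hcon
    exact absurd (Real.rpow_le_rpow hr.le hcon hζ.le) (not_le.2 hlt)
  obtain ⟨y', hy1, hy2⟩ := (Metric.infDist_lt_iff hYne).1 hlt'
  exact ⟨y, y', hy, hy1, hy2⟩

/-- If any two points have `k`-th preimages on which `g` is `ε`-close, then `k` steps of the
transfer operator reduce the oscillation of `g`. -/
theorem OscLE.contract (hb : Branches f fib A D q L τ δ) (hp : BranchWeight fib L δ ζ p c β B)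
    {g : M → ℝ} {s ε : ℝ} (hs : OscLE s g) (k : ℕ)
    (hk : ∀ x x', ∃ y y', f^[k] y = x ∧ f^[k] y' = x' ∧ |g y - g y'| ≤ ε) :
    OscLE ((1 - β ^ k) * s + β ^ k * ε) ((SkewGap.transfer fib p)^[k] g) := by
  intro x x'
  obtain ⟨y, y', hy, hy', hε⟩ := hk x x'
  have hne : (Set.range g).Nonempty := ⟨_, ⟨x, rfl⟩⟩
  have hbdd : BddAbove (Set.range g) := ⟨g x + s, by rintro _ ⟨z, rfl⟩; linarith [hs z x]⟩
  set S := sSup (Set.range g) with hS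
  have hle : ∀ z, g z ≤ S := fun z => le_csSup hbdd ⟨z, rfl⟩
  have hge : ∀ z, S - s ≤ g z := fun z => by
    have : S ≤ g z + s := csSup_le hne (by rintro _ ⟨w, rfl⟩; linarith [hs w z])
    linarith
  -- The gap below the supremum at `y` keeps a share `β ^ k` at `x`, and the gap above `S - s` at
  -- `y'` keeps the same share at `x'`. Adding the two, `s` is reduced by at least `β ^ k (s - (g y
  -- - g y'))`.
  have h1 := pow_mul_le_transfer_iterate hb hp (u := fun z => S - g z)
    (fun z => sub_nonneg.2 (hle z)) k x y hy
  have h2 := pow_mul_le_transfer_iterate hb hp (u := fun z => g z - (S - s))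
    (fun z => sub_nonneg.2 (hge z)) k x' y' hy'
  rw [transfer_iterate_const_sub hp] at h1
  rw [transfer_iterate_sub_const hp] at h2
  have hβ : 0 ≤ β ^ k := pow_nonneg hp.beta_pos.le k
  have h3 : β ^ k * (g y - g y') ≤ β ^ k * ε :=
    mul_le_mul_of_nonneg_left ((le_abs_self _).trans hε) hβ
  nlinarith

/-- A fixed number of steps of the transfer operator contracts a suitable combination of the
local Hölder constant and the oscillation. -/
theorem exists_contraction_step (hM : HasIntermediatePoints M) (hdiam : ∀ x y : M, dist x y ≤ 1)
    (hb : Branches f fib A D q L τ δ) (hp : BranchWeight fib L δ ζ p c β B) (hζ : 0 < ζ)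
    (hζ1 : ζ ≤ 1) (hu : 1 / (D : ℝ) * branchRate D q L τ ζ < 1)
    (hθ1 : c * branchRate D q L τ ζ < 1) :
    ∃ (m : ℕ) (κ W : ℝ), 0 < m ∧ 0 < κ ∧ κ < 1 ∧ 1 ≤ W ∧ ∀ (C s : ℝ) (h : M → ℝ), 0 ≤ C → 0 ≤ s →
      LocHolder ζ C δ h → OscLE s h → ∃ C' s', 0 ≤ C' ∧ 0 ≤ s' ∧
        LocHolder ζ C' δ ((transfer fib p)^[m] h) ∧ OscLE s' ((transfer fib p)^[m] h) ∧
        C' + W * s' ≤ κ * (C + W * s) := by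
  set θ := max 0 (c * branchRate D q L τ ζ) with hθdef
  have hθ0 : 0 ≤ θ := le_max_left _ _
  have hθle : c * branchRate D q L τ ζ ≤ θ := le_max_right _ _
  have hθ1' : θ < 1 := max_lt one_pos hθ1
  have h1θ : 0 < 1 - θ := by linarith
  have hB := hp.B_nonneg
  set B' := D * B / (1 - θ) with hB'
  have hB'0 : 0 ≤ B' := by positivity
  -- On preimages `r`-close to each other, the part of the Hölder bound that comes from the
  -- oscillation contributes at most `s / 2`. The other two minima keep `r` within the local scale
  -- and `r ^ ζ ≤ 1`.
  set r := min (min δ 1) ((1 / (2 * (B' + 1))) ^ (1 / ζ)) with hr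
  have hr0 : 0 < r := lt_min (lt_min hb.delta_pos one_pos) (by positivity)
  have hrB : B' * r ^ ζ ≤ 1 / 2 := by
    have h1 : r ^ ζ ≤ 1 / (2 * (B' + 1)) := by
      have h2 : r ^ ζ ≤ ((1 / (2 * (B' + 1))) ^ (1 / ζ)) ^ ζ :=
        Real.rpow_le_rpow hr0.le (min_le_right _ _) hζ.le
      rwa [← Real.rpow_mul (by positivity), one_div_mul_cancel hζ.ne', Real.rpow_one] at h2
    calc B' * r ^ ζ ≤ B' * (1 / (2 * (B' + 1))) := mul_le_mul_of_nonneg_left h1 hB'0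
      _ ≤ 1 / 2 := by
        rw [mul_one_div, div_le_div_iff₀ (by positivity) (by norm_num)]
        linarith
  obtain ⟨k, hk⟩ := exists_close_preimages hM hdiam hb hζ hζ1 hu hr0
  rcases isEmpty_or_nonempty M with hempty | ⟨⟨x0⟩⟩
  · refine ⟨1, 1 / 2, 1, one_pos, by norm_num, by norm_num, le_rfl, fun C s h hC hs _ _ =>
      ⟨0, 0, le_rfl, le_rfl, fun x => isEmptyElim x, fun x => isEmptyElim x, by linarith⟩⟩
  have hβ1 : β ≤ 1 := by
    obtain ⟨y, hy⟩ : (fib x0).Nonempty := by rw [← Finset.card_pos, hb.card_fib]; exact hb.D_pos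
    have := Finset.single_le_sum (f := p) (fun z _ => hp.nonneg z) hy
    rw [hp.sum_one] at this
    exact (hp.beta_le y).trans this
  set a := β ^ k with ha
  have ha0 : 0 < a := pow_pos hp.beta_pos k
  have ha1 : a ≤ 1 := pow_le_one₀ hp.beta_pos.le hβ1
  -- The oscillation drops by `a s / 2`, up to a multiple of `C`. Weighted by `W`, half of this drop
  -- already pays for the error `B' s` added to the Hölder constant.
  set W := (2 * B' + 1) / (a / 2) with hW
  have hW1 : 1 ≤ W := by rw [hW, le_div_iff₀ (by positivity)]; linarith
  have hWa : W * (a / 2) = 2 * B' + 1 := by rw [hW]; field_simp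
  obtain ⟨n, hn⟩ := exists_pow_lt_of_lt_one
    (show 0 < 1 / (2 * (1 + W)) by positivity) hθ1'
  have hn' : θ ^ n * (1 + W) ≤ 1 / 2 := by
    rw [lt_div_iff₀ (by positivity)] at hn; linarith
  have hθn : 0 ≤ θ ^ n := pow_nonneg hθ0 n
  -- First `n + 1` steps make the share of `C` in the Hölder constant small, even after
  -- multiplication by `1 + W`; then `k` steps contract the oscillation. Using `n + 1` keeps the
  -- number of steps positive even if `k = n = 0`.
  refine ⟨k + (n + 1), max (1 / 2) (1 - a / 4), W, by omega, by positivity,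
    max_lt (by norm_num) (by linarith), hW1, fun C s h hC hs H hO => ?_⟩
  have H1 := H.transfer_iterate hM hb hp hζ.le hθle hθ0 hθ1' hC hs hO (n + 1)
  have O1 := hO.transfer_iterate hp (n + 1)
  have hC1 : 0 ≤ θ ^ (n + 1) * C + B' * s := by positivity
  have H2' := H.transfer_iterate hM hb hp hζ.le hθle hθ0 hθ1' hC hs hO (k + (n + 1))
  have O2 := O1.contract hb hp (ε := θ ^ (n + 1) * C * r ^ ζ + s / 2) k fun x x' => by
    obtain ⟨y, y', hy, hy', hd⟩ := hk x x'
    refine ⟨y, y', hy, hy', (H1 y y' (hd.trans_le ((min_le_left _ _).trans (min_le_left _ _)))).trans ?_⟩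
    have h1 : dist y y' ^ ζ ≤ r ^ ζ := Real.rpow_le_rpow dist_nonneg hd.le hζ.le
    refine (mul_le_mul_of_nonneg_left h1 hC1).trans ?_
    nlinarith
  rw [← Function.iterate_add_apply] at O2
  have hθk : θ ^ (k + (n + 1)) ≤ θ ^ n := pow_le_pow_of_le_one hθ0 hθ1'.le (by omega)
  have hθk' : θ ^ (n + 1) ≤ θ ^ n := pow_le_pow_of_le_one hθ0 hθ1'.le (by omega)
  have hrz : r ^ ζ ≤ 1 :=
    Real.rpow_le_one hr0.le ((min_le_left _ _).trans (min_le_right _ _)) hζ.le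
  have hrz0 : 0 ≤ r ^ ζ := Real.rpow_nonneg hr0.le _
  have h1a : 0 ≤ 1 - a := by linarith
  refine ⟨_, (1 - a) * s + a * (θ ^ (n + 1) * C * r ^ ζ + s / 2), by positivity,
    by positivity, H2', O2, ?_⟩
  have e1 : θ ^ (k + (n + 1)) * C ≤ θ ^ n * C := mul_le_mul_of_nonneg_right hθk hC
  have e2 : a * (θ ^ (n + 1) * C * r ^ ζ) ≤ θ ^ n * C := by
    calc a * (θ ^ (n + 1) * C * r ^ ζ) ≤ 1 * (θ ^ (n + 1) * C * 1) := by gcongr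
      _ ≤ θ ^ n * C := by rw [one_mul, mul_one]; exact mul_le_mul_of_nonneg_right hθk' hC
  have hW0 : 0 ≤ W := by linarith
  have e3 : W * (a * (θ ^ (n + 1) * C * r ^ ζ)) ≤ W * (θ ^ n * C) :=
    mul_le_mul_of_nonneg_left e2 hW0
  have e4 : θ ^ n * (1 + W) * C ≤ 1 / 2 * C := mul_le_mul_of_nonneg_right hn' hC
  have e5 : B' * s ≤ W * (a / 4) * s := mul_le_mul_of_nonneg_right (by linarith) hs
  have e6 : 1 / 2 * C ≤ max (1 / 2) (1 - a / 4) * C :=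
    mul_le_mul_of_nonneg_right (le_max_left _ _) hC
  have e7 : (1 - a / 4) * (W * s) ≤ max (1 / 2) (1 - a / 4) * (W * s) :=
    mul_le_mul_of_nonneg_right (le_max_right _ _) (by positivity)
  nlinarith [e1, e3, e4, e5, e6, e7]

/-- Exponential decay of the local Hölder constant and of the oscillation under the transfer
operator. -/
theorem exists_transfer_decay (hM : HasIntermediatePoints M) (hdiam : ∀ x y : M, dist x y ≤ 1)
    (hb : Branches f fib A D q L τ δ) (hp : BranchWeight fib L δ ζ p c β B) (hζ : 0 < ζ)
    (hζ1 : ζ ≤ 1) (hu : 1 / (D : ℝ) * branchRate D q L τ ζ < 1)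
    (hθ1 : c * branchRate D q L τ ζ < 1) :
    ∃ κ V : ℝ, 0 < κ ∧ κ < 1 ∧ 0 < V ∧ ∀ (C : ℝ) (h : M → ℝ), 0 ≤ C →
      (∀ x y, |h x - h y| ≤ C * dist x y ^ ζ) → OscLE C h → ∀ n : ℕ,
      (∀ x y, |(transfer fib p)^[n] h x - (transfer fib p)^[n] h y|
        ≤ V * κ ^ n * C * dist x y ^ ζ) ∧ OscLE (V * κ ^ n * C) ((transfer fib p)^[n] h) := by
  obtain ⟨m, κ, W, hm, hκ0, hκ1, hW, hstep⟩ :=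
    exists_contraction_step hM hdiam hb hp hζ hζ1 hu hθ1
  obtain ⟨Q, hQ1, hQ⟩ := exists_holder_of_locHolder hM hdiam hζ.le hb.delta_pos
  set θ := max 0 (c * branchRate D q L τ ζ) with hθdef
  have hθ0 : 0 ≤ θ := le_max_left _ _
  have hθle : c * branchRate D q L τ ζ ≤ θ := le_max_right _ _
  have hθ1' : θ < 1 := max_lt one_pos hθ1
  have h1θ : 0 < 1 - θ := by linarith
  have hB := hp.B_nonneg
  set B' := D * B / (1 - θ) with hB'
  have hB'0 : 0 ≤ B' := by positivity
  have iter : ∀ (j : ℕ) (C s : ℝ) (h : M → ℝ), 0 ≤ C → 0 ≤ s → LocHolder ζ C δ h → OscLE s h →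
      ∃ C' s', 0 ≤ C' ∧ 0 ≤ s' ∧ LocHolder ζ C' δ ((transfer fib p)^[m * j] h) ∧
        OscLE s' ((transfer fib p)^[m * j] h) ∧ C' + W * s' ≤ κ ^ j * (C + W * s) := by
    intro j
    induction j with
    | zero => exact fun C s h hC hs H O => ⟨C, s, hC, hs, H, O, by simp⟩
    | succ j ih =>
      intro C s h hC hs H O
      obtain ⟨C1, s1, hC1, hs1, H1, O1, e1⟩ := ih C s h hC hs H O
      obtain ⟨C2, s2, hC2, hs2, H2, O2, e2⟩ := hstep C1 s1 _ hC1 hs1 H1 O1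
      rw [← Function.iterate_add_apply, show m + m * j = m * (j + 1) by ring] at H2 O2
      refine ⟨C2, s2, hC2, hs2, H2, O2, e2.trans ?_⟩
      rw [pow_succ', mul_assoc]
      exact mul_le_mul_of_nonneg_left e1 hκ0.le
  -- The `m`-th root turns the rate per block into a rate per step; the incomplete last block costs
  -- at most `κ⁻¹`.
  set κ' := κ ^ (1 / (m : ℝ)) with hκ'
  have hm0 : (0 : ℝ) < m := by exact_mod_cast hm
  have hκ'0 : 0 < κ' := Real.rpow_pos_of_pos hκ0 _
  have hκ'1 : κ' < 1 := Real.rpow_lt_one hκ0.le hκ1 (by positivity)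
  have hκ'm : κ' ^ m = κ := by
    rw [hκ', ← Real.rpow_natCast, ← Real.rpow_mul hκ0.le, one_div_mul_cancel hm0.ne',
      Real.rpow_one]
  have hpow : ∀ n, κ ^ (n / m) ≤ κ⁻¹ * κ' ^ n := by
    intro n
    have h1 : κ' ^ (n % m) * κ ^ (n / m) = κ' ^ n := by
      rw [← hκ'm, ← pow_mul, ← pow_add, Nat.mod_add_div]
    have h2 : κ ≤ κ' ^ (n % m) := by
      rw [← hκ'm]
      exact pow_le_pow_of_le_one hκ'0.le hκ'1.le (Nat.mod_lt _ hm).le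
    rw [le_inv_mul_iff₀ hκ0, ← h1]
    exact mul_le_mul_of_nonneg_right h2 (pow_nonneg hκ0.le _)
  -- `Q` passes from local to global Hölder bounds, `1 + B'` covers the `n % m` remaining steps, and
  -- `1 + W` is the initial value of the weighted sum relative to `C`.
  set U := Q * (1 + B') * ((1 + W) * κ⁻¹) with hU
  have hU0 : 0 < U := by positivity
  refine ⟨κ', U, hκ'0, hκ'1, hU0, fun C h hC hH hO n => ?_⟩
  obtain ⟨C1, s1, hC1, hs1, H1, O1, e1⟩ :=
    iter (n / m) C C h hC hC (fun x y _ => hH x y) hO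
  have e1' : C1 + s1 ≤ (1 + W) * κ⁻¹ * κ' ^ n * C := by
    calc C1 + s1 ≤ C1 + W * s1 := by nlinarith
      _ ≤ κ ^ (n / m) * (C + W * C) := e1
      _ ≤ κ⁻¹ * κ' ^ n * (C + W * C) := mul_le_mul_of_nonneg_right (hpow n) (by positivity)
      _ = _ := by ring
  have H2 := H1.transfer_iterate hM hb hp hζ.le hθle hθ0 hθ1' hC1 hs1 O1 (n % m)
  have O2 := O1.transfer_iterate hp (n % m)
  rw [← Function.iterate_add_apply, Nat.mod_add_div] at H2 O2
  have hθn : θ ^ (n % m) ≤ 1 := pow_le_one₀ hθ0 hθ1'.le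
  have hC2 : 0 ≤ θ ^ (n % m) * C1 + B' * s1 := by positivity
  have e2 : θ ^ (n % m) * C1 + B' * s1 ≤ (1 + B') * (C1 + s1) := by
    have := mul_le_mul_of_nonneg_right hθn hC1
    nlinarith [mul_nonneg hB'0 hC1]
  have e3 : Q * (θ ^ (n % m) * C1 + B' * s1) ≤ U * κ' ^ n * C := by
    calc Q * (θ ^ (n % m) * C1 + B' * s1) ≤ Q * ((1 + B') * ((1 + W) * κ⁻¹ * κ' ^ n * C)) := by
          gcongr
          exact e2.trans (mul_le_mul_of_nonneg_left e1' (by positivity))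
      _ = _ := by rw [hU]; ring
  refine ⟨fun x y => (hQ _ _ hC2 H2 x y).trans
    (mul_le_mul_of_nonneg_right e3 (Real.rpow_nonneg dist_nonneg _)), O2.mono ?_⟩
  calc s1 ≤ 1 * 1 * (C1 + s1) := by linarith
    _ ≤ Q * (1 + B') * ((1 + W) * κ⁻¹ * κ' ^ n * C) := by
        gcongr
        linarith
    _ = _ := by rw [hU]; ring

end Decay

end SkewGap

end

noncomputable section

namespace SkewGap

/-! ### Riemannian segments, inverse branches, and normalization of the weight. -/

section Geometry

/-- A compact Riemannian manifold has intermediate points. -/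
theorem hasIntermediatePoints_of_riemannian {d : ℕ} {M : Type*} [MetricSpace M] [CompactSpace M]
    [ConnectedSpace M]
    [ChartedSpace (EuclideanSpace ℝ (Fin d)) M] [IsManifold (𝓡 d) ∞ M]
    [RiemannianBundle (fun x : M => TangentSpace (𝓡 d) x)]
    [IsContMDiffRiemannianBundle (𝓡 d) ∞ (EuclideanSpace ℝ (Fin d))
      (fun x : M => TangentSpace (𝓡 d) x)]
    [IsRiemannianManifold (𝓡 d) M] : HasIntermediatePoints M := by
  intro x y t ht0 ht1
  have hd : 0 ≤ dist x y := dist_nonneg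
  have approx : ∀ η : ℝ, 0 < η → ∃ z, dist x z ≤ t * dist x y ∧
      dist z y ≤ (1 - t) * dist x y + η := by
    intro η hη
    -- On a curve of nearly minimal length, take a point whose distance from `x` is exactly `t *
    -- dist x y`. Its distance to `y` is at most the rest of the length.
    have hlt : Manifold.riemannianEDist (𝓡 d) x y < ENNReal.ofReal (dist x y + η) := by
      rw [← IsRiemannianManifold.out (I := 𝓡 d) x y, edist_dist]
      exact (ENNReal.ofReal_lt_ofReal_iff (by linarith)).2 (by linarith)
    obtain ⟨γ, h0, h1, hγ, hlen⟩ := Manifold.exists_lt_of_riemannianEDist_lt hlt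
    have hcont : ContinuousOn (fun s => dist x (γ s)) (Set.Icc 0 1) :=
      (continuous_const.dist continuous_id).comp_continuousOn hγ.continuousOn
    have hmem : t * dist x y ∈ Set.Icc (dist x (γ 0)) (dist x (γ 1)) := by
      rw [h0, h1, dist_self]
      exact ⟨by positivity, mul_le_of_le_one_left hd ht1⟩
    obtain ⟨s, hs, hs'⟩ := intermediate_value_Icc zero_le_one hcont hmem
    refine ⟨γ s, hs'.le, ?_⟩
    have e1 : edist x (γ s) ≤ Manifold.pathELength (𝓡 d) γ 0 s := by
      rw [IsRiemannianManifold.out (I := 𝓡 d) x (γ s)]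
      exact Manifold.riemannianEDist_le_pathELength (hγ.mono (Set.Icc_subset_Icc_right hs.2)) h0
        rfl hs.1
    have e2 : edist (γ s) y ≤ Manifold.pathELength (𝓡 d) γ s 1 := by
      rw [IsRiemannianManifold.out (I := 𝓡 d) (γ s) y]
      exact Manifold.riemannianEDist_le_pathELength (hγ.mono (Set.Icc_subset_Icc_left hs.1)) rfl
        h1 hs.2
    have e3 := (add_le_add e1 e2).trans_lt
      ((Manifold.pathELength_add (I := 𝓡 d) (γ := γ) hs.1 hs.2).trans_lt hlen)
    rw [edist_dist, edist_dist, ← ENNReal.ofReal_add dist_nonneg dist_nonneg,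
      ENNReal.ofReal_lt_ofReal_iff (by linarith)] at e3
    have : dist x (γ s) = t * dist x y := hs'
    linarith
  -- Compactness removes `η`: the point of this ball closest to `y` is at least as good as every
  -- approximate one.
  have hcpt : IsCompact {z | dist x z ≤ t * dist x y} :=
    (isClosed_le (Continuous.dist continuous_const continuous_id) continuous_const).isCompact
  obtain ⟨z0, hz0, -⟩ := approx 1 one_pos
  obtain ⟨z, hz, hmin⟩ := hcpt.exists_isMinOn ⟨z0, hz0⟩
    (f := fun z => dist z y) (Continuous.dist continuous_id continuous_const).continuousOn
  refine ⟨z, hz, le_of_forall_pos_le_add fun η hη => ?_⟩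
  obtain ⟨w, hw, hw'⟩ := approx η hη
  exact (hmin hw).trans hw'

variable {M : Type*} [MetricSpace M] [CompactSpace M]

/-- An open continuous map of a compact space is uniformly open. -/
theorem exists_uniform_open {f : M → M} (hc : Continuous f) (ho : IsOpenMap f) {r : ℝ}
    (hr : 0 < r) : ∃ δ > 0, ∀ y, Metric.ball (f y) δ ⊆ f '' Metric.ball y r := by
  have loc : ∀ y0 : M, ∃ U ∈ nhds y0, ∃ δ > 0, ∀ y ∈ U,
      Metric.ball (f y) δ ⊆ f '' Metric.ball y r := by
    intro y0
    have hopen : f '' Metric.ball y0 (r / 2) ∈ nhds (f y0) :=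
      (ho _ Metric.isOpen_ball).mem_nhds ⟨y0, Metric.mem_ball_self (by linarith), rfl⟩
    obtain ⟨δ, hδ, hsub⟩ := Metric.mem_nhds_iff.1 hopen
    refine ⟨Metric.ball y0 (r / 2) ∩ f ⁻¹' Metric.ball (f y0) (δ / 2), Filter.inter_mem
      (Metric.ball_mem_nhds _ (by linarith))
      (hc.continuousAt.preimage_mem_nhds (Metric.ball_mem_nhds _ (by linarith))),
      δ / 2, by linarith, fun y hy => ?_⟩
    intro w hw
    have h1 : w ∈ Metric.ball (f y0) δ := by
      have h2 : dist (f y) (f y0) < δ / 2 := hy.2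
      have h3 : dist w (f y) < δ / 2 := hw
      exact (dist_triangle _ _ _).trans_lt (by linarith)
    obtain ⟨z, hz, rfl⟩ := hsub h1
    refine ⟨z, ?_, rfl⟩
    have h2 : dist y y0 < r / 2 := hy.1
    have h3 : dist z y0 < r / 2 := hz
    exact (dist_triangle_right _ _ y0).trans_lt (by linarith)
  choose U hU δ hδ hsub using loc
  obtain ⟨t, -, ht⟩ := isCompact_univ.elim_nhds_subcover U fun y _ => hU y
  rcases t.eq_empty_or_nonempty with rfl | hne
  · refine ⟨1, one_pos, fun y => ?_⟩
    simpa using ht (Set.mem_univ y)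
  · obtain ⟨y1, hy1, hmin⟩ := t.exists_min_image δ hne
    refine ⟨δ y1, hδ y1, fun y => ?_⟩
    obtain ⟨y2, hy2, hy2'⟩ := Set.mem_iUnion₂.1 (ht (Set.mem_univ y))
    exact (Metric.ball_subset_ball (hmin y2 hy2)).trans (hsub y2 y hy2')

/-- The local Lipschitz bounds for the inverse branches hold at a uniform scale. -/
theorem exists_uniform_inverse_bound {f : M → M} {Λ : M → ℝ} {A : Set M} {σ L : ℝ}
    (hbr : ∀ x, ∃ U ∈ nhds x, Set.InjOn f U ∧
      ∀ u ∈ U, ∀ v ∈ U, dist u v ≤ Λ x * dist (f u) (f v))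
    (hA : IsOpen A) (hσ : 1 < σ) (hL : 1 ≤ L) (hon : ∀ x ∈ A, Λ x ≤ L)
    (hoff : ∀ x ∉ A, Λ x < σ⁻¹) :
    ∃ r > 0, ∀ y y', dist y y' < r → dist y y' ≤ L * dist (f y) (f y') ∧
      (y ∉ A → dist y y' ≤ σ⁻¹ * dist (f y) (f y')) := by
  classical
  choose U hU hinj hlip using hbr
  -- Neighbourhoods centred in `A` are shrunk into the open set `A`. A point outside `A` is then
  -- covered only by neighbourhoods centred outside `A`, where the bound `σ⁻¹` holds.
  set V : M → Set M := fun x => if x ∈ A then U x ∩ A else U x with hV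
  have hVn : ∀ x, V x ∈ nhds x := fun x => by
    simp only [hV]
    split_ifs with hx
    · exact Filter.inter_mem (hU x) (hA.mem_nhds hx)
    · exact hU x
  obtain ⟨r, hr, hleb⟩ := lebesgue_number_lemma_of_metric (s := Set.univ) (c := fun x => interior (V x))
    isCompact_univ (fun x => isOpen_interior)
    (fun x _ => Set.mem_iUnion.2 ⟨x, mem_interior_iff_mem_nhds.2 (hVn x)⟩)
  refine ⟨r, hr, fun y y' hyy => ?_⟩
  obtain ⟨x, hx⟩ := hleb y (Set.mem_univ y)
  have hy : y ∈ V x := interior_subset (hx (Metric.mem_ball_self hr))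
  have hy' : y' ∈ V x := interior_subset (hx (by rwa [Metric.mem_ball, dist_comm]))
  have hVU : V x ⊆ U x := by
    simp only [hV]
    split_ifs
    · exact Set.inter_subset_left
    · exact le_rfl
  have hl := hlip x y (hVU hy) y' (hVU hy')
  have hd : 0 ≤ dist (f y) (f y') := dist_nonneg
  have hσ1 : σ⁻¹ ≤ 1 := inv_le_one_of_one_le₀ hσ.le
  constructor
  · refine hl.trans (mul_le_mul_of_nonneg_right ?_ hd)
    by_cases hxA : x ∈ A
    · exact hon x hxA
    · linarith [hoff x hxA]
  · intro hyA
    have hxA : x ∉ A := fun hxA => hyA (by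
      simp only [hV, if_pos hxA] at hy
      exact hy.2)
    exact hl.trans (mul_le_mul_of_nonneg_right (hoff x hxA).le hd)

/-- The fibre of `f` over `x`, as a finite set (empty if the fibre is infinite). -/
def fiberFinset (f : M → M) (x : M) : Finset M := by
  classical
  exact if h : (f ⁻¹' {x}).Finite then h.toFinset else ∅

/-- The fibre is compact, and each ball of radius `r / 2` contains at most one of its points. -/
theorem finite_fiber {f : M → M} (hc : Continuous f) {r : ℝ} (hr : 0 < r)
    (hinj : ∀ y y', dist y y' < r → f y = f y' → y = y') (x : M) : (f ⁻¹' {x}).Finite := by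
  have hcl : IsCompact (f ⁻¹' {x}) := (isClosed_singleton.preimage hc).isCompact
  obtain ⟨t, -, htf, ht⟩ := hcl.finite_cover_balls (half_pos hr)
  refine Set.Finite.subset (htf.biUnion (t := fun z => f ⁻¹' {x} ∩ Metric.ball z (r / 2))
    fun z _ => Set.Subsingleton.finite ?_) fun y hy => ?_
  · rintro a ⟨ha, ha'⟩ b ⟨hb, hb'⟩
    refine hinj a b ?_ (ha.trans hb.symm)
    have h1 : dist a z < r / 2 := ha'
    have h2 : dist b z < r / 2 := hb'
    exact (dist_triangle_right _ _ z).trans_lt (by linarith)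
  · obtain ⟨z, hz, hz'⟩ := Set.mem_iUnion₂.1 (ht hy)
    exact Set.mem_iUnion₂.2 ⟨z, hz, hy, hz'⟩

theorem mem_fiberFinset {f : M → M} (hfin : ∀ x, (f ⁻¹' {x}).Finite) (x y : M) :
    y ∈ fiberFinset f x ↔ f y = x := by
  simp [fiberFinset, hfin x]

/-- Uniform openness lifts `x'` to within `r / 2` of each preimage of `x`. Two preimages with the
same lift would be less than `r` apart, where the inverse bound forces them to coincide; the same
bound then improves the distance estimate from `r / 2` to the stated ones. -/
theorem exists_fiber_injection {f : M → M} (hfin : ∀ x, (f ⁻¹' {x}).Finite) {r δ L : ℝ}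
    {τ : ℝ} {A : Set M}
    (hr : ∀ y y', dist y y' < r → dist y y' ≤ L * dist (f y) (f y') ∧
      (y ∉ A → dist y y' ≤ τ * dist (f y) (f y')))
    (hδ : ∀ y, Metric.ball (f y) δ ⊆ f '' Metric.ball y (r / 2)) {x x' : M} (hx : dist x x' < δ) :
    ∃ e : M → M, Set.MapsTo e (fiberFinset f x) (fiberFinset f x') ∧
      Set.InjOn e (fiberFinset f x) ∧ ∀ y ∈ fiberFinset f x, dist y (e y) ≤ L * dist x x' ∧
        (y ∉ A → dist y (e y) ≤ τ * dist x x') := by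
  have : ∀ y, ∃ y', f y = x → f y' = x' ∧ dist y' y < r / 2 := by
    intro y
    by_cases hy : f y = x
    · obtain ⟨y', h1, h2⟩ := hδ y (show x' ∈ Metric.ball (f y) δ by
        rwa [hy, Metric.mem_ball, dist_comm])
      exact ⟨y', fun _ => ⟨h2, h1⟩⟩
    · exact ⟨y, fun h => absurd h hy⟩
  choose e he using this
  refine ⟨e, fun y hy => ?_, fun y hy z hz hyz => ?_, fun y hy => ?_⟩
  · exact (mem_fiberFinset hfin _ _).2 (he y ((mem_fiberFinset hfin _ _).1 hy)).1
  · have hy' := (mem_fiberFinset hfin _ _).1 hy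
    have hz' := (mem_fiberFinset hfin _ _).1 hz
    have h1 := (he y hy').2
    have h2 := (he z hz').2
    rw [← hyz] at h2
    have h3 : dist y z < r := by
      refine (dist_triangle_left y z (e y)).trans_lt (by linarith)
    have h4 := (hr y z h3).1
    rw [hy', hz', dist_self, mul_zero] at h4
    exact dist_le_zero.1 h4
  · have hy' := (mem_fiberFinset hfin _ _).1 hy
    obtain ⟨h1, h2⟩ := he y hy'
    have h3 : dist y (e y) < r := by
      rw [dist_comm]
      have : 0 ≤ dist (e y) y := dist_nonneg
      linarith
    have h4 := hr y (e y) h3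
    rwa [hy', h1] at h4

/-- The branches of a local homeomorphism of a compact connected space. -/
theorem exists_branches [ConnectedSpace M] {f : M → M} {Λ : M → ℝ} {A : Set M} {σ L : ℝ} {q : ℕ}
    (hc : Continuous f) (ho : IsOpenMap f)
    (hbr : ∀ x, ∃ U ∈ nhds x, Set.InjOn f U ∧
      ∀ u ∈ U, ∀ v ∈ U, dist u v ≤ Λ x * dist (f u) (f v))
    (hA : IsOpen A) (hσ : 1 < σ) (hL : 1 ≤ L) (hL2 : L ≤ 2) (hon : ∀ x ∈ A, Λ x ≤ L)
    (hoff : ∀ x ∉ A, Λ x < σ⁻¹) (𝒱 : Finset (Set M)) (h𝒱 : ∀ V ∈ 𝒱, Set.InjOn f V)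
    (hcard : 𝒱.card = q) (hcov : A ⊆ ⋃ V ∈ 𝒱, V) (hq : q < mapDegree f) :
    (∀ x, (f ⁻¹' {x}).Finite) ∧
      ∃ δ, Branches f (fiberFinset f) A (mapDegree f) q L σ⁻¹ δ := by
  obtain ⟨r, hr, hbound⟩ := exists_uniform_inverse_bound hbr hA hσ hL hon hoff
  have hfin : ∀ x, (f ⁻¹' {x}).Finite := finite_fiber hc hr fun y y' hd he => by
    have := (hbound y y' hd).1
    rw [he, dist_self, mul_zero] at this
    exact dist_le_zero.1 this
  obtain ⟨δ, hδ, hopen⟩ := exists_uniform_open hc ho (half_pos hr)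
  have hle : ∀ x x', dist x x' < δ → (fiberFinset f x).card ≤ (fiberFinset f x').card := by
    intro x x' hx
    obtain ⟨e, hmaps, hinj, -⟩ := exists_fiber_injection hfin hbound hopen hx
    exact Finset.card_le_card_of_injOn e hmaps hinj
  have heq : ∀ x x', dist x x' < δ → (fiberFinset f x).card = (fiberFinset f x').card :=
    fun x x' hx => le_antisymm (hle x x' hx) (hle x' x (by rwa [dist_comm]))
  -- Injections in both directions make the number of preimages locally constant, and `M` is
  -- connected.
  have hconst : ∀ x x', (fiberFinset f x).card = (fiberFinset f x').card := by
    have hlc : IsLocallyConstant fun x => (fiberFinset f x).card := by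
      refine (IsLocallyConstant.iff_exists_open _).2 fun x =>
        ⟨Metric.ball x δ, Metric.isOpen_ball, Metric.mem_ball_self hδ, fun x' hx' => heq _ _ hx'⟩
    exact fun x x' => hlc.apply_eq_of_preconnectedSpace x x'
  have hdeg : ∀ x, (fiberFinset f x).card = mapDegree f := by
    intro x
    have hn : ∀ x', (f ⁻¹' {x'}).ncard = (fiberFinset f x).card := fun x' => by
      rw [hconst x x', Set.ncard_eq_toFinset_card _ (hfin x')]
      simp [fiberFinset, hfin x']
    have : Nonempty M := ⟨x⟩
    simp only [mapDegree, hn, ciSup_const]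
  refine ⟨hfin, δ, ?_⟩
  refine
    { mem_fib := mem_fiberFinset hfin
      card_fib := hdeg
      card_region := fun x t ht htA => ?_
      q_le := hq.le
      D_pos := by omega
      one_le_L := hL
      L_le_two := hL2
      tau_pos := inv_pos.2 (by linarith)
      tau_le_one := inv_le_one_of_one_le₀ hσ.le
      delta_pos := hδ
      pairing := fun x x' hx => ?_ }
  -- Each preimage in `A` lies in one of the `q` domains of injectivity, and no such domain holds
  -- two points of a fibre.
  · have hch : ∀ y, ∃ V, y ∈ t → V ∈ 𝒱 ∧ y ∈ V := fun y => by
      by_cases hy : y ∈ t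
      · obtain ⟨V, hV, hyV⟩ := Set.mem_iUnion₂.1 (hcov (htA y hy))
        exact ⟨V, fun _ => ⟨hV, hyV⟩⟩
      · exact ⟨∅, fun h => absurd h hy⟩
    choose v hv using hch
    rw [← hcard]
    refine Finset.card_le_card_of_injOn v (fun y hy => (hv y hy).1) fun y hy z hz hyz => ?_
    have h1 := (hv y hy).2
    have h2 := (hv z hz).2
    rw [← hyz] at h2
    refine h𝒱 _ (hv y hy).1 h1 h2 ?_
    rw [(mem_fiberFinset hfin _ _).1 (ht hy), (mem_fiberFinset hfin _ _).1 (ht hz)]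
  · obtain ⟨e, hmaps, hinj, hd⟩ := exists_fiber_injection hfin hbound hopen hx
    exact ⟨e, ⟨hmaps, hinj, Finset.surjOn_of_injOn_of_card_le e hmaps hinj
      (heq x x' hx).ge⟩, hd⟩

/-- The sum of a weight over the fibres. -/
def fiberSum (fib : M → Finset M) (ρ : M → ℝ) (x : M) : ℝ := ∑ y ∈ fib x, ρ y

/-- A positive Hölder weight with small distortion, normalized along the fibres. -/
theorem branchWeight_normalized {f : M → M} {fib : M → Finset M} {A : Set M} {D q : ℕ}
    {L τ δ ζ : ℝ} (hb : Branches f fib A D q L τ δ) (hζ : 0 ≤ ζ) {ρ : M → ℝ} {a E H : ℝ}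
    (ha : 0 < a) (hE : 0 < E) (hH0 : 0 ≤ H) (hge : ∀ y, a ≤ ρ y) (hdist : ∀ y y', ρ y ≤ E * ρ y')
    (hρ : ∀ y y', |ρ y - ρ y'| ≤ H * dist y y' ^ ζ) :
    ∃ β B, BranchWeight fib L δ ζ (fun y => ρ y / fiberSum fib ρ (f y)) (E / D) β B := by
  have hpos : ∀ y, 0 < ρ y := fun y => ha.trans_le (hge y)
  have hD : (0 : ℝ) < D := by exact_mod_cast hb.D_pos
  have hw : ∀ x, D * a ≤ fiberSum fib ρ x := fun x => by
    have := Finset.card_nsmul_le_sum (fib x) ρ a fun y _ => hge y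
    rwa [hb.card_fib, nsmul_eq_mul] at this
  have hw0 : ∀ x, 0 < fiberSum fib ρ x := fun x => (by positivity : 0 < D * a).trans_le (hw x)
  have hne : ∀ x, (fib x).Nonempty := fun x => by
    rw [← Finset.card_pos, hb.card_fib]; exact hb.D_pos
  have hup : ∀ x y, fiberSum fib ρ x ≤ D * (E * ρ y) := fun x y => by
    have := Finset.sum_le_card_nsmul (fib x) ρ (E * ρ y) fun z _ => hdist z y
    rwa [hb.card_fib, nsmul_eq_mul] at this
  have hlow : ∀ x y, D * ρ y ≤ E * fiberSum fib ρ x := fun x y => by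
    rw [fiberSum, Finset.mul_sum]
    have := Finset.card_nsmul_le_sum (fib x) (fun z => E * ρ z) (ρ y) fun z _ => hdist y z
    rwa [hb.card_fib, nsmul_eq_mul] at this
  set B1 := H * L ^ ζ with hB1
  have hL0 : 0 ≤ L := by linarith [hb.one_le_L]
  have hB10 : 0 ≤ B1 := mul_nonneg hH0 (Real.rpow_nonneg hL0 _)
  have hvar : ∀ x x' y y' : M, dist y y' ≤ L * dist x x' → |ρ y - ρ y'| ≤ B1 * dist x x' ^ ζ := by
    intro x x' y y' h
    refine (hρ y y').trans ?_
    rw [hB1, mul_assoc, ← Real.mul_rpow hL0 dist_nonneg]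
    exact mul_le_mul_of_nonneg_left (Real.rpow_le_rpow dist_nonneg h hζ) hH0
  -- Every fibre sum lies between `D / E` and `D * E` times any single value of `ρ`, hence the
  -- bounds `1 / (D E)` and `E / D`. The last constant adds the variations of numerator and
  -- denominator, over the lower bound `D * a` for the fibre sum.
  refine ⟨1 / (D * E), (B1 + E / D * (D * B1)) / (D * a), ?_⟩
  refine
    { beta_pos := by positivity
      beta_le := fun y => ?_
      le_c := fun y => ?_
      sum_one := fun x => ?_
      B_nonneg := by positivity
      variation := fun x x' hx y hy y' hy' hyy => ?_ }
  · rw [div_le_div_iff₀ (by positivity) (hw0 _)]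
    linarith [hup (f y) y]
  · rw [div_le_div_iff₀ (hw0 _) hD]
    linarith [hlow (f y) y]
  · have : ∀ y ∈ fib x, ρ y / fiberSum fib ρ (f y) = ρ y / fiberSum fib ρ x := fun y hy => by
      rw [(hb.mem_fib _ _).1 hy]
    rw [Finset.sum_congr rfl this, ← Finset.sum_div]
    exact div_self (hw0 x).ne'
  · simp only [(hb.mem_fib _ _).1 hy, (hb.mem_fib _ _).1 hy']
    set t := dist x x' ^ ζ with ht
    have ht0 : 0 ≤ t := Real.rpow_nonneg dist_nonneg _
    set w := fiberSum fib ρ x with hwdef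
    set w' := fiberSum fib ρ x' with hw'def
    have hww : |w' - w| ≤ D * B1 * t := by
      obtain ⟨e, he, hd⟩ := hb.pairing x x' hx
      have : w' = ∑ y ∈ fib x, ρ (e y) :=
        (Finset.sum_nbij e (fun y hy => he.mapsTo hy) he.injOn he.surjOn fun y _ => rfl).symm
      rw [this, hwdef, fiberSum, ← Finset.sum_sub_distrib]
      refine (Finset.abs_sum_le_sum_abs _ _).trans ?_
      have := Finset.sum_le_card_nsmul (fib x) (fun y => |ρ (e y) - ρ y|) (B1 * t) fun z hz => by
        rw [abs_sub_comm]
        exact hvar x x' z (e z) (hd z hz).1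
      rw [hb.card_fib, nsmul_eq_mul] at this
      linarith
    have hwp : 0 < w := hw0 x
    have hwp' : 0 < w' := hw0 x'
    have e1 : ρ y / w - ρ y' / w' = ((ρ y - ρ y') + ρ y' / w' * (w' - w)) / w := by
      field_simp
      ring
    have e2 : ρ y' / w' ≤ E / D := by
      rw [div_le_div_iff₀ hwp' hD]
      linarith [hlow x' y']
    have e3 : |(ρ y - ρ y') + ρ y' / w' * (w' - w)| ≤ (B1 + E / D * (D * B1)) * t := by
      refine (abs_add_le _ _).trans ?_
      rw [abs_mul, abs_of_nonneg (div_nonneg (hpos y').le hwp'.le)]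
      have := mul_le_mul e2 hww (abs_nonneg _) (by positivity)
      have := hvar x x' y y' hyy
      linarith
    rw [e1, abs_div, abs_of_pos hwp, div_le_iff₀ hwp]
    refine e3.trans ?_
    have e4 : D * a ≤ w := hw x
    have e5 : (B1 + E / D * (D * B1)) / (D * a) * t * (D * a)
        ≤ (B1 + E / D * (D * B1)) / (D * a) * t * w :=
      mul_le_mul_of_nonneg_left e4 (by positivity)
    refine le_trans (le_of_eq ?_) e5
    field_simp

end Geometry

end SkewGap

end

noncomputable section

namespace SkewGap

/-! ### Jacobian, change of variables, and duality with composition. -/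

section Duality

variable {M : Type*} [MetricSpace M] [CompactSpace M] [MeasurableSpace M] [BorelSpace M]
  {m₁ : Measure M} [IsProbabilityMeasure m₁] {f : M → M} {fib : M → Finset M} {J : M → ℝ}

theorem integrable_of_bounded {X : Type*} [MeasurableSpace X] {μ : Measure X} [IsFiniteMeasure μ]
    {u : X → ℝ} (hu : Measurable u) {R : ℝ} (hR : ∀ x, |u x| ≤ R) : Integrable u μ :=
  Integrable.of_bound hu.aestronglyMeasurable R (Filter.Eventually.of_forall hR)

theorem IsJacobian.measurable_weight (hJ : IsJacobian m₁ f J) : Measurable (weight J) := by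
  unfold weight
  exact measurable_const.div hJ.measurable

/-- On a set where `f` is injective, the Jacobian gives the change of variables formula. -/
theorem IsJacobian.transfer_indicator (hc : Continuous f) (hJ : IsJacobian m₁ f J)
    (hfib : ∀ x y, y ∈ fib x ↔ f y = x) {R : ℝ} (hR : ∀ y, |weight J y| ≤ R) {u : M → ℝ}
    (hu : Measurable u) {S : ℝ} (hS : ∀ y, |u y| ≤ S) {E : Set M} (hE : MeasurableSet E)
    (hinj : Set.InjOn f E) :
    Integrable (transfer fib (weight J) (E.indicator u)) m₁ ∧
      Measurable (transfer fib (weight J) (E.indicator u)) ∧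
      ∫ x, transfer fib (weight J) (E.indicator u) x ∂m₁ = ∫ x in E, u x ∂m₁ := by
  classical
  set v := transfer fib (weight J) (E.indicator u) with hv
  -- By injectivity on `E`, only one term of the sum over the fibre survives.
  have hvE : ∀ y ∈ E, v (f y) = weight J y * u y := by
    intro y hy
    simp only [hv, transfer]
    rw [Finset.sum_eq_single y]
    · rw [Set.indicator_of_mem hy]
    · intro z hz hzy
      rw [Set.indicator_of_notMem, mul_zero]
      exact fun hzE => hzy (hinj hzE hy ((hfib _ _).1 hz))
    · exact fun h => absurd ((hfib _ _).2 rfl) h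
  have hv0 : ∀ x, x ∉ f '' E → v x = 0 := by
    intro x hx
    refine Finset.sum_eq_zero fun y hy => ?_
    rw [Set.indicator_of_notMem, mul_zero]
    exact fun hyE => hx ⟨y, hyE, (hfib _ _).1 hy⟩
  -- Measurability of `v` is not visible from a sum over varying fibres; it comes from writing `v`
  -- as an extension by zero along this embedding.
  have hemb : MeasurableEmbedding (fun y : E => f y) := hc.continuousOn.measurableEmbedding hE hinj
  have hvm : Measurable v := by
    have : v = Function.extend (fun y : E => f y) (fun y : E => weight J y * u y) 0 := by
      funext x
      by_cases hx : x ∈ f '' E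
      · obtain ⟨y, hy, rfl⟩ := hx
        rw [hvE y hy]
        exact (hemb.injective.extend_apply (fun y : E => weight J y * u y) 0 ⟨y, hy⟩).symm
      · rw [hv0 x hx, Function.extend_apply' _ _ _ (fun ⟨y, hy⟩ => hx ⟨y.1, y.2, hy⟩)]
        rfl
    rw [this]
    exact hemb.measurable_extend
      ((hJ.measurable_weight.mul hu).comp measurable_subtype_coe) measurable_const
  have hbound : ∀ x, |v x| ≤ R * S := by
    intro x
    by_cases hx : x ∈ f '' E
    · obtain ⟨y, hy, rfl⟩ := hx
      rw [hvE y hy, abs_mul]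
      exact mul_le_mul (hR y) (hS y) (abs_nonneg _) ((abs_nonneg _).trans (hR y))
    · rw [hv0 x hx, abs_zero]
      exact mul_nonneg ((abs_nonneg _).trans (hR x)) ((abs_nonneg _).trans (hS x))
  refine ⟨integrable_of_bounded hvm hbound, hvm, ?_⟩
  have himg : MeasurableSet (f '' E) := hE.image_of_continuousOn_injOn hc.continuousOn hinj
  have hJm : Measurable fun x => ENNReal.ofReal (J x) := hJ.measurable.ennreal_ofReal
  -- The Jacobian identity applied to all measurable subsets of `E` says that `f` carries `J m₁` on
  -- `E` to `m₁` on `f '' E`.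
  have hmap : ((m₁.restrict E).withDensity fun x => ENNReal.ofReal (J x)).map f
      = m₁.restrict (f '' E) := by
    ext B hB
    rw [Measure.map_apply hc.measurable hB, withDensity_apply _ (hc.measurable hB),
      Measure.restrict_restrict (hc.measurable hB), Measure.restrict_apply hB,
      ← hJ.measure_image _ ((hc.measurable hB).inter hE)
        (hinj.mono Set.inter_subset_right), Set.inter_comm, Set.image_inter_preimage,
      Set.inter_comm]
  calc ∫ x, v x ∂m₁ = ∫ x in f '' E, v x ∂m₁ := by
        refine (setIntegral_eq_integral_of_forall_compl_eq_zero hv0).symm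
    _ = ∫ y, v (f y) ∂((m₁.restrict E).withDensity fun x => ENNReal.ofReal (J x)) := by
        rw [← hmap, integral_map hc.measurable.aemeasurable hvm.aestronglyMeasurable]
    _ = ∫ y in E, J y * v (f y) ∂m₁ := by
        rw [integral_withDensity_eq_integral_toReal_smul hJm
          (Filter.Eventually.of_forall fun _ => ENNReal.ofReal_lt_top)]
        simp only [smul_eq_mul, ENNReal.toReal_ofReal (hJ.pos _).le]
    _ = ∫ y in E, u y ∂m₁ := by
        refine setIntegral_congr_fun hE fun y hy => ?_
        have := (hJ.pos y).ne'
        simp only [hvE y hy, weight]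
        field_simp

/-- The transfer operator with weight `1 / J` preserves integrals. -/
theorem IsJacobian.integral_transfer (hc : Continuous f) (hJ : IsJacobian m₁ f J)
    (hfib : ∀ x y, y ∈ fib x ↔ f y = x) {R : ℝ} (hR : ∀ y, |weight J y| ≤ R)
    {𝒰 : Finset (Set M)} (h𝒰 : ∀ U ∈ 𝒰, IsOpen U ∧ Set.InjOn f U)
    (hcov : (⋃ U ∈ 𝒰, U) = Set.univ) {u : M → ℝ}
    (hu : Measurable u) {S : ℝ} (hS : ∀ y, |u y| ≤ S) :
    Integrable (transfer fib (weight J) u) m₁ ∧ Measurable (transfer fib (weight J) u) ∧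
      ∫ x, transfer fib (weight J) u x ∂m₁ = ∫ x, u x ∂m₁ := by
  classical
  -- Induction on the cover: split off the part of `E` in one domain of injectivity; the rest is
  -- covered by the other domains.
  have key : ∀ 𝒲 : Finset (Set M), (∀ U ∈ 𝒲, IsOpen U ∧ Set.InjOn f U) →
      ∀ E, MeasurableSet E → E ⊆ (⋃ U ∈ 𝒲, U) →
      Integrable (transfer fib (weight J) (E.indicator u)) m₁ ∧
      Measurable (transfer fib (weight J) (E.indicator u)) ∧
      ∫ x, transfer fib (weight J) (E.indicator u) x ∂m₁ = ∫ x in E, u x ∂m₁ := by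
    intro 𝒲
    induction 𝒲 using Finset.induction_on with
    | empty =>
      intro _ E _ hE
      have : E = ∅ := by simpa using hE
      have h0 : transfer fib (weight J) ((∅ : Set M).indicator u) = fun _ => 0 := by
        funext x
        simp [transfer]
      subst this
      rw [h0]
      exact ⟨integrable_zero _ _ _, measurable_const, by simp⟩
    | insert U 𝒲 _ ih =>
      intro h E hE hEsub
      have hU := h U (Finset.mem_insert_self _ _)
      have e1 := hJ.transfer_indicator hc hfib hR hu hS (hE.inter hU.1.measurableSet)
        (hU.2.mono Set.inter_subset_right)
      have e2 := ih (fun V hV => h V (Finset.mem_insert_of_mem hV)) (E \ U)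
        (hE.diff hU.1.measurableSet) (by
          rintro y ⟨hy, hyU⟩
          obtain ⟨V, hV, hyV⟩ := Set.mem_iUnion₂.1 (hEsub hy)
          rcases Finset.mem_insert.1 hV with rfl | hV
          · exact absurd hyV hyU
          · exact Set.mem_iUnion₂.2 ⟨V, hV, hyV⟩)
      have hsum : transfer fib (weight J) (E.indicator u)
          = fun x => transfer fib (weight J) ((E ∩ U).indicator u) x
            + transfer fib (weight J) ((E \ U).indicator u) x := by
        funext x
        simp only [transfer, ← Finset.sum_add_distrib, ← mul_add]
        refine Finset.sum_congr rfl fun y _ => ?_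
        congr 1
        by_cases hyE : y ∈ E <;> by_cases hyU : y ∈ U <;> simp [hyE, hyU]
      rw [hsum]
      refine ⟨e1.1.add e2.1, e1.2.1.add e2.2.1, ?_⟩
      rw [integral_add e1.1 e2.1, e1.2.2, e2.2.2]
      exact integral_inter_add_sdiff hU.1.measurableSet (integrable_of_bounded hu hS).integrableOn
  have := key 𝒰 h𝒰 Set.univ MeasurableSet.univ hcov.ge
  simpa using this

/-- For an invariant measure the weights `1 / J` add up to one along almost every fibre. -/
theorem IsJacobian.fiberSum_ae_eq_one (hc : Continuous f) (hJ : IsJacobian m₁ f J)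
    (hinv : MeasurePreserving f m₁ m₁)
    (hfib : ∀ x y, y ∈ fib x ↔ f y = x) {R : ℝ} (hR : ∀ y, |weight J y| ≤ R)
    {𝒰 : Finset (Set M)} (h𝒰 : ∀ U ∈ 𝒰, IsOpen U ∧ Set.InjOn f U)
    (hcov : (⋃ U ∈ 𝒰, U) = Set.univ) : ∀ᵐ x ∂m₁, fiberSum fib (weight J) x = 1 := by
  have hI : Integrable (fiberSum fib (weight J)) m₁ := by
    have := (hJ.integral_transfer hc hfib hR h𝒰 hcov (u := fun _ => 1) measurable_const
      (S := 1) (by simp)).1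
    refine this.congr (Filter.Eventually.of_forall fun x => ?_)
    simp [transfer, fiberSum]
  refine hI.ae_eq_of_forall_setIntegral_eq _ _ (integrable_const 1) fun B hB _ => ?_
  -- The transfer of the indicator of `f ⁻¹' B` is the fibre sum restricted to `B`. Invariance of
  -- `m₁` makes its integral equal to `m₁ B`.
  have h1 := (hJ.integral_transfer hc hfib hR h𝒰 hcov
    (u := (f ⁻¹' B).indicator fun _ => 1) (measurable_const.indicator (hc.measurable hB))
      (S := 1) (fun y => by
        by_cases hy : y ∈ f ⁻¹' B <;> simp [hy])).2.2
  have h2 : transfer fib (weight J) ((f ⁻¹' B).indicator fun _ => 1)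
      = B.indicator (fiberSum fib (weight J)) := by
    funext x
    by_cases hx : x ∈ B
    · rw [Set.indicator_of_mem hx]
      refine Finset.sum_congr rfl fun y hy => ?_
      have : y ∈ f ⁻¹' B := by rw [Set.mem_preimage, (hfib _ _).1 hy]; exact hx
      rw [Set.indicator_of_mem this, mul_one]
    · rw [Set.indicator_of_notMem hx]
      refine Finset.sum_eq_zero fun y hy => ?_
      have : y ∉ f ⁻¹' B := by rw [Set.mem_preimage, (hfib _ _).1 hy]; exact hx
      rw [Set.indicator_of_notMem this, mul_zero]
  rw [h2, integral_indicator hB, integral_indicator (hc.measurable hB)] at h1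
  rw [h1, setIntegral_const, setIntegral_const, measureReal_def, measureReal_def,
    hinv.measure_preimage hB.nullMeasurableSet]

/-- The normalized transfer operator is dual to the composition with `f`. -/
theorem IsJacobian.integral_comp_mul (hc : Continuous f) (hJ : IsJacobian m₁ f J)
    (hinv : MeasurePreserving f m₁ m₁)
    (hfib : ∀ x y, y ∈ fib x ↔ f y = x) {R : ℝ} (hR : ∀ y, |weight J y| ≤ R)
    {𝒰 : Finset (Set M)} (h𝒰 : ∀ U ∈ 𝒰, IsOpen U ∧ Set.InjOn f U)
    (hcov : (⋃ U ∈ 𝒰, U) = Set.univ) {ψ h : M → ℝ} (hψ : Measurable ψ) {R₁ : ℝ}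
    (hψ' : ∀ x, |ψ x| ≤ R₁) (hh : Measurable h) {R₂ : ℝ} (hh' : ∀ x, |h x| ≤ R₂) :
    ∫ x, ψ (f x) * h x ∂m₁
      = ∫ x, ψ x * transfer fib (fun y => weight J y / fiberSum fib (weight J) (f y)) h x ∂m₁ := by
  rw [← (hJ.integral_transfer hc hfib hR h𝒰 hcov (u := fun x => ψ (f x) * h x)
    ((hψ.comp hc.measurable).mul hh) (S := R₁ * R₂) fun y => by
      rw [abs_mul]
      exact mul_le_mul (hψ' _) (hh' _) (abs_nonneg _) ((abs_nonneg _).trans (hψ' y))).2.2]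
  refine integral_congr_ae ?_
  -- Normalization makes the weights sum to one everywhere, but `m₁` does not notice it.
  filter_upwards [hJ.fiberSum_ae_eq_one hc hinv hfib hR h𝒰 hcov] with x hx
  simp only [transfer, Finset.mul_sum]
  refine Finset.sum_congr rfl fun y hy => ?_
  rw [(hfib _ _).1 hy, hx]
  ring

end Duality

end SkewGap

end

noncomputable section

namespace SkewGap

/-! ### Integration against signed measures. -/

section SignedIntegral

variable {X Y : Type*} [MeasurableSpace X] [MeasurableSpace Y]

/-- The integral of a function against a signed measure. -/
def sint (μ : SignedMeasure X) (Φ : X → ℝ) : ℝ :=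
  ∫ x, Φ x ∂μ.toJordanDecomposition.posPart - ∫ x, Φ x ∂μ.toJordanDecomposition.negPart

/-- A measurable function that is bounded. -/
def BddMeas (Φ : X → ℝ) : Prop := Measurable Φ ∧ ∃ R, ∀ x, |Φ x| ≤ R

theorem BddMeas.integrable {Φ : X → ℝ} (hΦ : BddMeas Φ) (μ : Measure X) [IsFiniteMeasure μ] :
    Integrable Φ μ :=
  integrable_of_bounded hΦ.1 hΦ.2.choose_spec

theorem BddMeas.comp {Φ : Y → ℝ} (hΦ : BddMeas Φ) {F : X → Y} (hF : Measurable F) :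
    BddMeas (Φ ∘ F) :=
  ⟨hΦ.1.comp hF, hΦ.2.choose, fun x => hΦ.2.choose_spec (F x)⟩

theorem BddMeas.const_mul {Φ : X → ℝ} (hΦ : BddMeas Φ) (c : ℝ) : BddMeas (fun x => c * Φ x) := by
  obtain ⟨h1, R1, h1'⟩ := hΦ
  exact ⟨h1.const_mul c, |c| * R1, fun x => by
    rw [abs_mul]; exact mul_le_mul_of_nonneg_left (h1' x) (abs_nonneg _)⟩

theorem bddMeas_const (c : ℝ) : BddMeas (fun _ : X => c) := ⟨measurable_const, |c|, fun _ => le_rfl⟩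

theorem BddMeas.indicator {Φ : X → ℝ} (hΦ : BddMeas Φ) {E : Set X} (hE : MeasurableSet E) :
    BddMeas (E.indicator Φ) := by
  obtain ⟨h1, R, hR⟩ := hΦ
  refine ⟨h1.indicator hE, R, fun x => ?_⟩
  by_cases hx : x ∈ E
  · rw [Set.indicator_of_mem hx]; exact hR x
  · rw [Set.indicator_of_notMem hx, abs_zero]; exact (abs_nonneg _).trans (hR x)

/-- Moving the negative parts across gives an identity of positive measures, so any representation
as a difference may replace the Jordan decomposition. Thus the decomposition of a sum or a
push-forward never has to be computed. -/
theorem sint_eq_of_eq_sub {μ : SignedMeasure X} {a b : Measure X} [IsFiniteMeasure a]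
    [IsFiniteMeasure b] (h : ∀ E, MeasurableSet E → μ E = a.real E - b.real E) {Φ : X → ℝ}
    (hΦ : BddMeas Φ) : sint μ Φ = ∫ x, Φ x ∂a - ∫ x, Φ x ∂b := by
  have e : μ.toJordanDecomposition.posPart + b = a + μ.toJordanDecomposition.negPart := by
    ext E hE
    have h1 := SignedMeasure.apply_eq_posPart_real_sub_negPart_real μ hE
    rw [h E hE] at h1
    rw [← ENNReal.toReal_eq_toReal_iff' (measure_ne_top _ _) (measure_ne_top _ _)]
    change Measure.real _ E = Measure.real _ E
    rw [measureReal_add_apply, measureReal_add_apply]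
    linarith
  have e2 := congrArg (fun m : Measure X => ∫ x, Φ x ∂m) e
  rw [integral_add_measure (hΦ.integrable _) (hΦ.integrable _),
    integral_add_measure (hΦ.integrable _) (hΦ.integrable _)] at e2
  rw [sint]
  linarith

theorem sint_toSignedMeasure (μ : Measure X) [IsFiniteMeasure μ] {Φ : X → ℝ} (hΦ : BddMeas Φ) :
    sint μ.toSignedMeasure Φ = ∫ x, Φ x ∂μ := by
  rw [sint_eq_of_eq_sub (a := μ) (b := 0) (fun E hE => ?_) hΦ]
  · simp
  · rw [Measure.toSignedMeasure_apply_measurable hE]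
    simp

theorem sint_add (μ ν : SignedMeasure X) {Φ : X → ℝ} (hΦ : BddMeas Φ) :
    sint (μ + ν) Φ = sint μ Φ + sint ν Φ := by
  rw [sint_eq_of_eq_sub (a := μ.toJordanDecomposition.posPart + ν.toJordanDecomposition.posPart)
    (b := μ.toJordanDecomposition.negPart + ν.toJordanDecomposition.negPart) (fun E hE => ?_) hΦ]
  · rw [integral_add_measure (hΦ.integrable _) (hΦ.integrable _),
      integral_add_measure (hΦ.integrable _) (hΦ.integrable _), sint, sint]
    ring
  · rw [add_apply, SignedMeasure.apply_eq_posPart_real_sub_negPart_real μ hE,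
      SignedMeasure.apply_eq_posPart_real_sub_negPart_real ν hE, measureReal_add_apply,
      measureReal_add_apply]
    ring

theorem sint_neg (μ : SignedMeasure X) (Φ : X → ℝ) : sint (-μ) Φ = -sint μ Φ := by
  simp [sint, SignedMeasure.toJordanDecomposition_neg]

theorem sint_nnsmul (c : ℝ≥0) (μ : SignedMeasure X) (Φ : X → ℝ) :
    sint (c • μ) Φ = c * sint μ Φ := by
  simp only [sint, SignedMeasure.toJordanDecomposition_smul, JordanDecomposition.smul_posPart,
    JordanDecomposition.smul_negPart, integral_smul_nnreal_measure]
  rw [NNReal.smul_def, NNReal.smul_def, smul_eq_mul, smul_eq_mul]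
  ring

theorem sint_smul (c : ℝ) (μ : SignedMeasure X) (Φ : X → ℝ) :
    sint (c • μ) Φ = c * sint μ Φ := by
  rcases le_total 0 c with hc | hc
  · lift c to ℝ≥0 using hc
    exact sint_nnsmul c μ Φ
  · have e : c • μ = -((-c).toNNReal • μ) := by
      have h1 : ((-c).toNNReal • μ : SignedMeasure X) = (((-c).toNNReal : ℝ≥0) : ℝ) • μ := rfl
      rw [h1, Real.coe_toNNReal _ (by linarith)]
      ext E _
      simp
    rw [e, sint_neg, sint_nnsmul, Real.coe_toNNReal _ (by linarith)]
    ring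

theorem sint_sub (μ ν : SignedMeasure X) {Φ : X → ℝ} (hΦ : BddMeas Φ) :
    sint (μ - ν) Φ = sint μ Φ - sint ν Φ := by
  rw [sub_eq_add_neg, sint_add _ _ hΦ, sint_neg]
  ring

theorem sint_map (μ : SignedMeasure X) {F : X → Y} (hF : Measurable F) {Φ : Y → ℝ}
    (hΦ : BddMeas Φ) : sint (μ.map F) Φ = sint μ (Φ ∘ F) := by
  rw [sint_eq_of_eq_sub (a := μ.toJordanDecomposition.posPart.map F)
    (b := μ.toJordanDecomposition.negPart.map F) (fun E hE => ?_) hΦ]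
  · rw [integral_map hF.aemeasurable hΦ.1.aestronglyMeasurable,
      integral_map hF.aemeasurable hΦ.1.aestronglyMeasurable]
    rfl
  · rw [VectorMeasure.map_apply _ hF hE,
      SignedMeasure.apply_eq_posPart_real_sub_negPart_real μ (hF hE), measureReal_def,
      measureReal_def, measureReal_def, measureReal_def, Measure.map_apply hF hE,
      Measure.map_apply hF hE]

theorem sint_fun_add (μ : SignedMeasure X) {Φ Ψ : X → ℝ} (hΦ : BddMeas Φ) (hΨ : BddMeas Ψ) :
    sint μ (Φ + Ψ) = sint μ Φ + sint μ Ψ := by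
  simp only [sint, Pi.add_apply]
  rw [integral_add (hΦ.integrable _) (hΨ.integrable _),
    integral_add (hΦ.integrable _) (hΨ.integrable _)]
  ring

theorem sint_fun_const_mul (μ : SignedMeasure X) (c : ℝ) (Φ : X → ℝ) :
    sint μ (fun x => c * Φ x) = c * sint μ Φ := by
  simp only [sint, integral_const_mul]
  ring

theorem sint_indicator_one (μ : SignedMeasure X) {E : Set X} (hE : MeasurableSet E) :
    sint μ (E.indicator fun _ => 1) = μ E := by
  rw [sint, integral_indicator hE, integral_indicator hE, setIntegral_const, setIntegral_const,
    SignedMeasure.apply_eq_posPart_real_sub_negPart_real μ hE]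
  simp

theorem sint_one (μ : SignedMeasure X) : sint μ (fun _ => 1) = μ Set.univ := by
  rw [← sint_indicator_one μ MeasurableSet.univ, Set.indicator_univ]

theorem sint_withDensity (μ : Measure X) [IsFiniteMeasure μ] {h : X → ℝ} (hh : Integrable h μ)
    {Φ : X → ℝ} (hΦ : BddMeas Φ) :
    sint (μ.withDensityᵥ h) Φ = ∫ x, Φ x * h x ∂μ := by
  have hp : Integrable (fun x => max (h x) 0) μ := hh.pos_part
  have hn : Integrable (fun x => max (-h x) 0) μ := hh.neg_part
  have key : ∀ k : X → ℝ, Integrable k μ → ∫ x, Φ x ∂(μ.withDensity fun x => ENNReal.ofReal (k x))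
      = ∫ x, Φ x * max (k x) 0 ∂μ := by
    intro k hk
    rw [integral_withDensity_eq_integral_toReal_smul₀ hk.1.aemeasurable.ennreal_ofReal
      (Filter.Eventually.of_forall fun _ => ENNReal.ofReal_lt_top)]
    refine integral_congr_ae (Filter.Eventually.of_forall fun x => ?_)
    simp only [smul_eq_mul, ENNReal.toReal_ofReal']
    ring
  have f1 : IsFiniteMeasure (μ.withDensity fun x => ENNReal.ofReal (h x)) :=
    isFiniteMeasure_withDensity_ofReal hh.2
  have f2 : IsFiniteMeasure (μ.withDensity fun x => ENNReal.ofReal (-h x)) :=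
    isFiniteMeasure_withDensity_ofReal hh.neg.2
  rw [sint_eq_of_eq_sub (a := μ.withDensity fun x => ENNReal.ofReal (h x))
    (b := μ.withDensity fun x => ENNReal.ofReal (-h x)) (fun E hE => ?_) hΦ]
  · have i1 : ∀ k : X → ℝ, Integrable k μ → Integrable (fun x => Φ x * k x) μ := fun k hk =>
      hk.bdd_mul hΦ.1.aestronglyMeasurable (Filter.Eventually.of_forall hΦ.2.choose_spec)
    rw [key h hh, key (fun x => -h x) hh.neg, ← integral_sub (i1 _ hp) (i1 _ hn)]
    refine integral_congr_ae (Filter.Eventually.of_forall fun x => ?_)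
    simp only
    rw [← mul_sub]
    congr 1
    rcases le_total 0 (h x) with h0 | h0
    · rw [max_eq_left h0, max_eq_right (by linarith)]; ring
    · rw [max_eq_right h0, max_eq_left (by linarith)]; ring
  · rw [withDensityᵥ_eq_withDensity_pos_part_sub_withDensity_neg_part hh, sub_apply,
      Measure.toSignedMeasure_apply_measurable hE, Measure.toSignedMeasure_apply_measurable hE]

end SignedIntegral

end SkewGap

end

noncomputable section

namespace SkewGap

/-! ### Disintegration and the dual description of the weak norm. -/

section Fibers

variable {M K : Type*} [MeasurableSpace M] [MetricSpace K] [CompactSpace K] [Nonempty K]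
  [MeasurableSpace K] [BorelSpace K] {m₁ : Measure M} [IsProbabilityMeasure m₁] {ζ : ℝ≥0}

/-- The density hidden in the fibre restriction converts integration over the marginal of `μ` into
integration over `m₁`. -/
theorem integral_fiberRestriction {μ : Measure (M × K)} [IsFiniteMeasure μ] (hμ : μ.fst ≪ m₁)
    {Φ : M × K → ℝ} (hΦ : BddMeas Φ) :
    Integrable (fun γ => ∫ z, Φ (γ, z) ∂fiberRestriction m₁ μ γ) m₁ ∧
      ∫ γ, ∫ z, Φ (γ, z) ∂fiberRestriction m₁ μ γ ∂m₁ = ∫ p, Φ p ∂μ := by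
  have hI : Integrable Φ (μ.fst.compProd μ.condKernel) := hΦ.integrable _
  have e : (fun γ => ∫ z, Φ (γ, z) ∂fiberRestriction m₁ μ γ)
      = fun γ => (μ.fst.rnDeriv m₁ γ).toReal • ∫ z, Φ (γ, z) ∂μ.condKernel γ := by
    funext γ
    rw [fiberRestriction, integral_smul_measure]
  constructor
  · rw [e, integrable_rnDeriv_smul_iff hμ]
    exact hI.integral_compProd
  · rw [e, integral_rnDeriv_smul hμ, ← Measure.integral_compProd hI, μ.disintegrate μ.condKernel]

/-- The integral of `Φ` over the fibre above `γ` against the signed measure `μ|_γ`. -/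
def fiberInt (m₁ : Measure M) (μ : SignedMeasure (M × K)) (Φ : M × K → ℝ) (γ : M) : ℝ :=
  ∫ z, Φ (γ, z) ∂fiberRestriction m₁ μ.toJordanDecomposition.posPart γ
    - ∫ z, Φ (γ, z) ∂fiberRestriction m₁ μ.toJordanDecomposition.negPart γ

theorem integrable_fiberInt {μ : SignedMeasure (M × K)} (hμ : MarginalsAC m₁ μ)
    {Φ : M × K → ℝ} (hΦ : BddMeas Φ) : Integrable (fiberInt m₁ μ Φ) m₁ :=
  (integral_fiberRestriction hμ.1 hΦ).1.sub (integral_fiberRestriction hμ.2 hΦ).1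

theorem integral_fiberInt {μ : SignedMeasure (M × K)} (hμ : MarginalsAC m₁ μ)
    {Φ : M × K → ℝ} (hΦ : BddMeas Φ) : ∫ γ, fiberInt m₁ μ Φ γ ∂m₁ = sint μ Φ := by
  have h1 := integral_fiberRestriction hμ.1 hΦ
  have h2 := integral_fiberRestriction hμ.2 hΦ
  simp only [fiberInt]
  rw [integral_sub h1.1 h2.1, h1.2, h2.2, sint]

theorem fiberInt_comp_fst (μ : SignedMeasure (M × K)) (ψ : M → ℝ) (γ : M) :
    fiberInt m₁ μ (fun p => ψ p.1) γ = ψ γ * marginalDensity m₁ μ γ := by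
  simp only [fiberInt, integral_const, marginalDensity, fiberRestriction, measureReal_def,
    Measure.smul_apply, measure_univ, smul_eq_mul, mul_one]
  ring

/-- The marginal density represents the marginal of a signed measure. -/
theorem sint_comp_fst {μ : SignedMeasure (M × K)} (hμ : MarginalsAC m₁ μ) {ψ : M → ℝ}
    (hψ : BddMeas ψ) :
    sint μ (fun p => ψ p.1) = ∫ γ, ψ γ * marginalDensity m₁ μ γ ∂m₁ := by
  have h := integral_fiberInt hμ (hψ.comp (measurable_fst (α := M) (β := K)))
  refine h.symm.trans (integral_congr_ae
    (Filter.Eventually.of_forall fun γ => fiberInt_comp_fst μ ψ γ))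

theorem integrable_marginalDensity {μ : SignedMeasure (M × K)} (hμ : MarginalsAC m₁ μ) :
    Integrable (marginalDensity m₁ μ) m₁ := by
  have := integrable_fiberInt hμ ((bddMeas_const (1 : ℝ)).comp (measurable_fst (α := M) (β := K)))
  refine this.congr (Filter.Eventually.of_forall fun γ => ?_)
  have h := fiberInt_comp_fst (m₁ := m₁) μ (fun _ => 1) γ
  rw [one_mul] at h
  exact h

/-- An integrable function is determined by its integrals over measurable sets, so the density can
be recognized without knowing the Jordan decomposition. -/
theorem marginalDensity_ae_eq {μ : SignedMeasure (M × K)} (hμ : MarginalsAC m₁ μ) {h : M → ℝ}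
    (hh : Integrable h m₁) (H : ∀ B, MeasurableSet B →
      sint μ (fun p => B.indicator (fun _ => 1) p.1) = ∫ x in B, h x ∂m₁) :
    marginalDensity m₁ μ =ᵐ[m₁] h := by
  refine (integrable_marginalDensity hμ).ae_eq_of_forall_setIntegral_eq _ _ hh fun B hB _ => ?_
  rw [← H B hB, sint_comp_fst hμ ((bddMeas_const 1).indicator hB), ← integral_indicator hB]
  refine integral_congr_ae (Filter.Eventually.of_forall fun γ => ?_)
  by_cases hγ : γ ∈ B <;> simp [hγ]

theorem sint_congr_of_null {μ : SignedMeasure (M × K)} (hμ : MarginalsAC m₁ μ)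
    {Φ Ψ : M × K → ℝ} {p : M → Prop} (hp : ∀ᵐ x ∂m₁, p x)
    (h : ∀ x z, p x → Φ (x, z) = Ψ (x, z)) : sint μ Φ = sint μ Ψ := by
  have key : ∀ ν : Measure (M × K), ν.fst ≪ m₁ → Φ =ᵐ[ν] Ψ := by
    intro ν hν
    have h1 : ∀ᵐ q ∂ν, p q.1 := ae_of_ae_map measurable_fst.aemeasurable (hν.ae_le hp)
    filter_upwards [h1] with q hq
    exact h q.1 q.2 hq
  rw [sint, sint, integral_congr_ae (key _ hμ.1), integral_congr_ae (key _ hμ.2)]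

/-- Test functions on `M × K` supported over `B`, which are `ζ`-Hölder with constant `1` along the
fibres and bounded by `R`. -/
structure FiberTest (ζ : ℝ≥0) (R : ℝ) (B : Set M) (Φ : M × K → ℝ) : Prop where
  measurable : Measurable Φ
  holder : ∀ x, HolderWith 1 ζ fun z => Φ (x, z)
  bound : ∀ x z, |Φ (x, z)| ≤ R
  support : ∀ x, x ∉ B → ∀ z, Φ (x, z) = 0

theorem FiberTest.bddMeas {R : ℝ} {B : Set M} {Φ : M × K → ℝ} (h : FiberTest ζ R B Φ) :
    BddMeas Φ := ⟨h.measurable, R, fun p => h.bound p.1 p.2⟩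

/-- A bound for the weak norm, by duality with fibrewise Hölder test functions. -/
def WeakBound (m₁ : Measure M) (ζ : ℝ≥0) (R C : ℝ) (μ : SignedMeasure (M × K)) : Prop :=
  ∀ (B : Set M) (Φ : M × K → ℝ), MeasurableSet B → FiberTest ζ R B Φ → |sint μ Φ| ≤ C * m₁.real B

theorem abs_integral_sub_le_wassDist {a b : Measure K} {g : K → ℝ} (hg : HolderWith 1 ζ g)
    (hb : ∀ y, |g y| ≤ 1) {C : ℝ} (hC : 0 ≤ C) (h : wassDist ζ a b ≤ ENNReal.ofReal C) :
    |∫ y, g y ∂a - ∫ y, g y ∂b| ≤ C := by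
  have h1 : ‖∫ y, g y ∂a - ∫ y, g y ∂b‖ₑ ≤ ENNReal.ofReal C :=
    by
    refine le_trans ?_ h
    exact le_iSup_of_le g (le_iSup_of_le hg (le_iSup_of_le hb le_rfl))
  rw [Real.enorm_eq_ofReal_abs] at h1
  exact (ENNReal.ofReal_le_ofReal_iff hC).1 h1

/-- On almost every fibre over `B` the test function is admissible in the definition of `W_1^ζ`;
integrate over `B`. -/
theorem weakBound_of_linftyNorm_le {μ : SignedMeasure (M × K)} (hμ : MarginalsAC m₁ μ) {C : ℝ}
    (hC : 0 ≤ C) (h : linftyNorm m₁ ζ μ ≤ ENNReal.ofReal C) : WeakBound m₁ ζ 1 C μ := by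
  intro B Φ hB hΦ
  rw [← integral_fiberInt hμ hΦ.bddMeas]
  have hae : ∀ᵐ γ ∂m₁, ‖fiberInt m₁ μ Φ γ‖ ≤ B.indicator (fun _ => C) γ := by
    filter_upwards [ENNReal.ae_le_essSup (μ := m₁) (fun γ => wassDist ζ
      (fiberRestriction m₁ μ.toJordanDecomposition.posPart γ)
      (fiberRestriction m₁ μ.toJordanDecomposition.negPart γ))] with γ hγ
    by_cases hγB : γ ∈ B
    · rw [Set.indicator_of_mem hγB, Real.norm_eq_abs]
      exact abs_integral_sub_le_wassDist (hΦ.holder γ) (hΦ.bound γ) hC (hγ.trans h)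
    · rw [Set.indicator_of_notMem hγB]
      simp [fiberInt, hΦ.support γ hγB]
  refine (norm_integral_le_of_norm_le ((integrable_const C).indicator hB) hae).trans_eq ?_
  rw [integral_indicator hB, setIntegral_const, smul_eq_mul, mul_comm]

/-- The supremum in `W_1^ζ` runs over an uncountable family, while exceptional null sets can be
united only countably often. Separability of `C(K, ℝ)` reconciles the two. -/
theorem exists_countable_dense_tests (hζ : 0 < ζ) : ∃ S : Set C(K, ℝ), S.Countable ∧
    (∀ g ∈ S, HolderWith 1 ζ g ∧ ∀ y, |g y| ≤ 1) ∧
    ∀ g : K → ℝ, HolderWith 1 ζ g → (∀ y, |g y| ≤ 1) → ∀ ε > 0,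
      ∃ g' ∈ S, ∀ y, |g y - g' y| ≤ ε := by
  set T : Set C(K, ℝ) := {g | HolderWith 1 ζ g ∧ ∀ y, |g y| ≤ 1} with hT
  obtain ⟨S, hST, hSc, hd⟩ :=
    (TopologicalSpace.IsSeparable.of_separableSpace T).exists_countable_dense_subset
  refine ⟨S, hSc, fun g hg => hST hg, fun g hg hb ε hε => ?_⟩
  have hmem : (⟨g, hg.continuous hζ⟩ : C(K, ℝ)) ∈ T := ⟨hg, hb⟩
  obtain ⟨g', hg', hd'⟩ := Metric.mem_closure_iff.1 (hd hmem) ε hε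
  exact ⟨g', hg', fun y => by
    have := (ContinuousMap.dist_apply_le_dist y).trans hd'.le
    rwa [Real.dist_eq] at this⟩

/-- A single `g`, localized over every set `B`, gives a bound on almost every fibre. A countable
dense family of such `g` then gives it for all `g` at once. -/
theorem linftyNorm_le_of_weakBound (hζ : 0 < ζ) {μ : SignedMeasure (M × K)}
    (hμ : MarginalsAC m₁ μ) {C : ℝ} (h : WeakBound m₁ ζ 1 C μ) :
    linftyNorm m₁ ζ μ ≤ ENNReal.ofReal C := by
  obtain ⟨S, hSc, hS, hd⟩ := exists_countable_dense_tests (K := K) hζ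
  have each : ∀ g : K → ℝ, HolderWith 1 ζ g → (∀ y, |g y| ≤ 1) →
      ∀ᵐ γ ∂m₁, fiberInt m₁ μ (fun p => g p.2) γ ≤ C := by
    intro g hg hb
    have hgm : Measurable g := (hg.continuous hζ).measurable
    have hΦ : BddMeas fun p : M × K => g p.2 := ⟨hgm.comp measurable_snd, 1, fun p => hb p.2⟩
    refine ae_le_of_forall_setIntegral_le (integrable_fiberInt hμ hΦ) (integrable_const C)
      fun B hB _ => ?_
    have hT : FiberTest ζ 1 B fun p : M × K => B.indicator (fun _ => g p.2) p.1 :=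
      { measurable := by
          have : (fun p : M × K => B.indicator (fun _ => g p.2) p.1)
              = (Prod.fst ⁻¹' B).indicator fun p : M × K => g p.2 := by
            funext p
            by_cases hp : p.1 ∈ B <;> simp [hp]
          rw [this]
          exact hΦ.1.indicator (measurable_fst hB)
        holder := fun x => by
          by_cases hx : x ∈ B
          · simpa [hx] using hg
          · simp only [Set.indicator_of_notMem hx]
            exact fun _ _ => by simp
        bound := fun x z => by
          by_cases hx : x ∈ B
          · simpa [hx] using hb z
          · simp [hx]
        support := fun x hx z => by simp [hx] }
    have h1 := h B _ hB hT
    rw [← integral_fiberInt hμ hT.bddMeas] at h1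
    rw [setIntegral_const, smul_eq_mul, mul_comm, ← integral_indicator hB]
    refine le_trans (le_of_eq ?_) ((le_abs_self _).trans h1)
    refine integral_congr_ae (Filter.Eventually.of_forall fun γ => ?_)
    by_cases hγ : γ ∈ B <;> simp [fiberInt, hγ]
  have hneg : ∀ (g : K → ℝ) (γ : M),
      fiberInt m₁ μ (fun p => -g p.2) γ = -fiberInt m₁ μ (fun p => g p.2) γ := fun g γ => by
    simp only [fiberInt, integral_neg]
    ring
  have hall : ∀ᵐ γ ∂m₁, ∀ g ∈ S, |fiberInt m₁ μ (fun p => g p.2) γ| ≤ C := by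
    refine (ae_ball_iff hSc).2 fun g hg => ?_
    filter_upwards [each g (hS g hg).1 (hS g hg).2, each (fun y => -g y)
      (fun x y => by rw [edist_neg_neg]; exact (hS g hg).1 x y)
      (fun y => by rw [abs_neg]; exact (hS g hg).2 y)] with γ h1 h2
    rw [hneg] at h2
    exact abs_le.2 ⟨by linarith, h1⟩
  refine essSup_le_of_ae_le _ ?_
  filter_upwards [hall,
    ae_isFiniteMeasure_fiberRestriction m₁ μ.toJordanDecomposition.posPart,
    ae_isFiniteMeasure_fiberRestriction m₁ μ.toJordanDecomposition.negPart] with γ hγ f1 f2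
  refine iSup_le fun g => iSup_le fun hg => iSup_le fun hb => ?_
  rw [Real.enorm_eq_ofReal_abs]
  refine ENNReal.ofReal_le_ofReal ?_
  set a := fiberRestriction m₁ μ.toJordanDecomposition.posPart γ
  set b := fiberRestriction m₁ μ.toJordanDecomposition.negPart γ
  refine le_of_forall_pos_le_add fun η hη => ?_
  -- Replacing `g` by a nearby member of the family costs its uniform error times the total mass
  -- `N`, whence the tolerance `η / (N + 1)`.
  set N : ℝ := a.real Set.univ + b.real Set.univ with hN
  have hN0 : 0 ≤ N := by positivity
  obtain ⟨g', hg', hgg⟩ := hd g hg hb (η / (N + 1)) (by positivity)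
  have hγ' : |∫ y, g' y ∂a - ∫ y, g' y ∂b| ≤ C := hγ g' hg'
  have diff : ∀ (m : Measure K) [IsFiniteMeasure m],
      |∫ y, g y ∂m - ∫ y, g' y ∂m| ≤ η / (N + 1) * m.real Set.univ := by
    intro m _
    rw [← integral_sub (integrable_of_holder hζ hg m) (integrable_of_holder hζ (hS g' hg').1 m)]
    rw [← Real.norm_eq_abs]
    exact norm_integral_le_of_norm_le_const (Filter.Eventually.of_forall hgg)
  have d1 := abs_le.1 (diff a)
  have d2 := abs_le.1 (diff b)
  have d3 := abs_le.1 hγ'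
  have d4 : η / (N + 1) * a.real Set.univ + η / (N + 1) * b.real Set.univ ≤ η := by
    rw [← mul_add, ← hN, div_mul_eq_mul_div, div_le_iff₀ (by positivity)]
    nlinarith
  rw [abs_le]
  constructor <;> linarith [d1.1, d1.2, d2.1, d2.2, d3.1, d3.2]

end Fibers

end SkewGap

end

noncomputable section

namespace SkewGap

/-! ### Push-forward by the skew product. -/

section Push

theorem holderWith_iff_abs {X : Type*} [MetricSpace X] {C ζ : ℝ≥0} {g : X → ℝ} :
    HolderWith C ζ g ↔ ∀ x y, |g x - g y| ≤ C * dist x y ^ (ζ : ℝ) := by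
  refine forall₂_congr fun x y => ?_
  rw [edist_dist, edist_dist, Real.dist_eq,
    ENNReal.ofReal_rpow_of_nonneg (dist_nonneg (x := x) (y := y)) ζ.coe_nonneg, ← ENNReal.ofReal_coe_nnreal, ← ENNReal.ofReal_mul C.coe_nonneg]
  exact ENNReal.ofReal_le_ofReal_iff (mul_nonneg C.coe_nonneg (Real.rpow_nonneg dist_nonneg _))

variable {M K : Type*} [MeasurableSpace M] [MetricSpace K] [CompactSpace K] [Nonempty K]
  [MeasurableSpace K] [BorelSpace K] {m₁ : Measure M} [IsProbabilityMeasure m₁] {ζ : ℝ≥0}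
  {f : M → M} {G : M × K → K}

theorem measurable_skewProduct (hf : Measurable f) (hG : Measurable G) :
    Measurable (skewProduct f G) :=
  (hf.comp measurable_fst).prodMk hG

theorem MarginalsAC.map (hf : MeasurePreserving f m₁ m₁) (hG : Measurable G)
    {μ : SignedMeasure (M × K)} (hμ : MarginalsAC m₁ μ) :
    MarginalsAC m₁ (μ.map (skewProduct f G)) := by
  have hF := measurable_skewProduct hf.measurable hG
  rw [marginalsAC_iff] at *
  intro B hB hB0 E hE hEB
  rw [VectorMeasure.map_apply _ hF hE]
  refine hμ (f ⁻¹' B) (hf.measurable hB) ?_ _ (hF hE) fun p hp => hEB hp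
  rw [hf.measure_preimage hB.nullMeasurableSet, hB0]

theorem FiberTest.mono {R R' : ℝ} (h : R ≤ R') {B : Set M} {Φ : M × K → ℝ}
    (hΦ : FiberTest ζ R B Φ) : FiberTest ζ R' B Φ :=
  ⟨hΦ.measurable, hΦ.holder, fun x z => (hΦ.bound x z).trans h, hΦ.support⟩

theorem FiberTest.const_mul {R c : ℝ} (hc : |c| ≤ 1) {B : Set M} {Φ : M × K → ℝ}
    (hΦ : FiberTest ζ R B Φ) : FiberTest ζ (|c| * R) B fun p => c * Φ p where
  measurable := hΦ.measurable.const_mul c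
  holder x := by
    rw [holderWith_iff_abs]
    intro z z'
    have h := holderWith_iff_abs.1 (hΦ.holder x) z z'
    rw [← mul_sub, abs_mul]
    exact (mul_le_of_le_one_left (abs_nonneg _) hc).trans h
  bound x z := by
    rw [abs_mul]
    exact mul_le_mul_of_nonneg_left (hΦ.bound x z) (abs_nonneg _)
  support x hx z := by rw [hΦ.support x hx z, mul_zero]

theorem WeakBound.mono {R R' C C' : ℝ} {μ : SignedMeasure (M × K)} (h : WeakBound m₁ ζ R C μ)
    (hR : R' ≤ R) (hC : C ≤ C') : WeakBound m₁ ζ R' C' μ := fun B Φ hB hΦ =>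
  (h B Φ hB (hΦ.mono hR)).trans (mul_le_mul_of_nonneg_right hC measureReal_nonneg)

/-- Test functions recentred on a fibre are bounded by the `ζ`-th power of the diameter of `K` and
not by one; this pays for the change of bound. -/
theorem WeakBound.scale {R C : ℝ} (hR : 1 ≤ R) {μ : SignedMeasure (M × K)}
    (h : WeakBound m₁ ζ 1 C μ) : WeakBound m₁ ζ R (R * C) μ := by
  intro B Φ hB hΦ
  have hR0 : 0 < R := by linarith
  have hc : |R⁻¹| ≤ 1 := by rw [abs_of_pos (inv_pos.2 hR0)]; exact inv_le_one_of_one_le₀ hR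
  have h1 := h B _ hB ((hΦ.const_mul hc).mono (by
    rw [abs_of_pos (inv_pos.2 hR0), inv_mul_cancel₀ hR0.ne']))
  rw [sint_fun_const_mul, abs_mul, abs_of_pos (inv_pos.2 hR0), inv_mul_le_iff₀ hR0] at h1
  rwa [mul_assoc]

theorem WeakBound.add {R C C' : ℝ} {μ ν : SignedMeasure (M × K)} (h : WeakBound m₁ ζ R C μ)
    (h' : WeakBound m₁ ζ R C' ν) : WeakBound m₁ ζ R (C + C') (μ + ν) := by
  intro B Φ hB hΦ
  rw [sint_add _ _ hΦ.bddMeas, add_mul]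
  exact (abs_add_le _ _).trans (add_le_add (h B Φ hB hΦ) (h' B Φ hB hΦ))

theorem WeakBound.smul {R C : ℝ} {μ : SignedMeasure (M × K)} (h : WeakBound m₁ ζ R C μ) (c : ℝ) :
    WeakBound m₁ ζ R (|c| * C) (c • μ) := by
  intro B Φ hB hΦ
  rw [sint_smul, abs_mul, mul_assoc]
  exact mul_le_mul_of_nonneg_left (h B Φ hB hΦ) (abs_nonneg _)

/-- `G` contracts the fibres over a measurable set of full measure. -/
theorem exists_contracting_set {α : ℝ} (hG1 : ContractsFibers m₁ G α) :
    ∃ X : Set M, MeasurableSet X ∧ (∀ᵐ x ∂m₁, x ∈ X) ∧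
      ∀ x ∈ X, ∀ z₁ z₂ : K, dist (G (x, z₁)) (G (x, z₂)) ≤ α * dist z₁ z₂ := by
  set p : M → Prop := fun x => ∀ z₁ z₂ : K, dist (G (x, z₁)) (G (x, z₂)) ≤ α * dist z₁ z₂
  have hp : m₁ {x | ¬ p x} = 0 := ae_iff.1 hG1
  refine ⟨(toMeasurable m₁ {x | ¬ p x})ᶜ, (measurableSet_toMeasurable _ _).compl, ?_, ?_⟩
  · rw [ae_iff]
    simp only [Set.mem_compl_iff, not_not]
    exact (measure_toMeasurable _).trans hp
  · intro x hx
    by_contra hcon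
    exact hx (subset_toMeasurable _ _ hcon)

/-- The push-forward by the skew product contracts the weak norm, up to the marginal density. -/
theorem WeakBound.map (hf : MeasurePreserving f m₁ m₁) (hG : Measurable G) {α : ℝ} (hα0 : 0 < α)
    (hG1 : ContractsFibers m₁ G α) {R : ℝ}
    (hdiam : ∀ z z' : K, dist z z' ^ (ζ : ℝ) ≤ R) {μ : SignedMeasure (M × K)}
    (hμ : MarginalsAC m₁ μ) {C : ℝ} (h : WeakBound m₁ ζ R C μ) {k : M → ℝ}
    (hk : marginalDensity m₁ μ =ᵐ[m₁] k) {s : ℝ} (hs : ∀ x, |k x| ≤ s) :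
    WeakBound m₁ ζ R (α ^ (ζ : ℝ) * C + R * s) (μ.map (skewProduct f G)) := by
  intro B Φ hB hΦ
  obtain ⟨X, hXm, hX, hXG⟩ := exists_contracting_set hG1
  have z₀ : K := Classical.arbitrary K
  have hF := measurable_skewProduct hf.measurable hG
  have hfB : MeasurableSet (f ⁻¹' B) := hf.measurable hB
  set a := α ^ (ζ : ℝ) with ha
  have ha0 : 0 < a := Real.rpow_pos_of_pos hα0 _
  set c₀ : M → ℝ := fun x => Φ (f x, G (x, z₀)) with hc₀
  have hc₀m : Measurable c₀ :=
    hΦ.measurable.comp (hf.measurable.prodMk (hG.comp (measurable_id.prodMk measurable_const)))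
  set c : M → ℝ := X.indicator c₀ with hc
  have hcm : Measurable c := hc₀m.indicator hXm
  -- Contraction of the fibre gives `Φ ∘ F` Hölder constant `a` there, so this quotient has constant
  -- one. As it vanishes at `z₀`, it is bounded by `R`. The cut-off to `X` discards the null set of
  -- fibres that need not contract.
  set Ψ₀ : M × K → ℝ := fun p => a⁻¹ * (Φ (f p.1, G p) - c₀ p.1) with hΨ₀
  set Ψ : M × K → ℝ := (Prod.fst ⁻¹' X).indicator Ψ₀ with hΨ
  have hΨin : ∀ x ∈ X, ∀ z, Ψ (x, z) = a⁻¹ * (Φ (f x, G (x, z)) - Φ (f x, G (x, z₀))) :=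
    fun x hx z => Set.indicator_of_mem (s := Prod.fst ⁻¹' X) (a := (x, z)) hx Ψ₀
  have hΨout : ∀ x, x ∉ X → ∀ z, Ψ (x, z) = 0 :=
    fun x hx z => Set.indicator_of_notMem (s := Prod.fst ⁻¹' X) (a := (x, z)) hx Ψ₀
  have hvar : ∀ x ∈ X, ∀ z z', |a⁻¹ * (Φ (f x, G (x, z)) - Φ (f x, G (x, z')))|
      ≤ dist z z' ^ (ζ : ℝ) := by
    intro x hx z z'
    have h1 := holderWith_iff_abs.1 (hΦ.holder (f x)) (G (x, z)) (G (x, z'))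
    rw [NNReal.coe_one, one_mul] at h1
    have h2 : dist (G (x, z)) (G (x, z')) ^ (ζ : ℝ) ≤ a * dist z z' ^ (ζ : ℝ) := by
      rw [ha, ← Real.mul_rpow hα0.le dist_nonneg]
      exact Real.rpow_le_rpow dist_nonneg (hXG x hx z z') ζ.coe_nonneg
    rw [abs_mul, abs_of_pos (inv_pos.2 ha0), inv_mul_le_iff₀ ha0]
    exact h1.trans h2
  have hT : FiberTest ζ R (f ⁻¹' B) Ψ :=
    { measurable :=
        (((hΦ.measurable.comp hF).sub (hc₀m.comp measurable_fst)).const_mul _).indicator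
          (measurable_fst hXm)
      holder := fun x => by
        rw [holderWith_iff_abs]
        intro z z'
        rw [NNReal.coe_one, one_mul]
        by_cases hx : x ∈ X
        · rw [hΨin x hx, hΨin x hx, ← mul_sub]
          have := hvar x hx z z'
          rwa [show Φ (f x, G (x, z)) - Φ (f x, G (x, z₀))
              - (Φ (f x, G (x, z')) - Φ (f x, G (x, z₀)))
            = Φ (f x, G (x, z)) - Φ (f x, G (x, z')) by ring]
        · rw [hΨout x hx, hΨout x hx, sub_self, abs_zero]
          exact Real.rpow_nonneg dist_nonneg _
      bound := fun x z => by
        by_cases hx : x ∈ X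
        · rw [hΨin x hx]
          exact (hvar x hx z z₀).trans (hdiam z z₀)
        · rw [hΨout x hx, abs_zero]
          exact (Real.rpow_nonneg dist_nonneg _).trans (hdiam z z₀)
      support := fun x hx z => by
        by_cases hxX : x ∈ X
        · rw [hΨin x hxX, hΦ.support _ hx, hΦ.support _ hx, sub_self, mul_zero]
        · exact hΨout x hxX z }
  have hcb : ∀ x, |c x| ≤ (f ⁻¹' B).indicator (fun _ => R) x := by
    intro x
    by_cases hx : x ∈ f ⁻¹' B
    · rw [Set.indicator_of_mem hx]
      by_cases hxX : x ∈ X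
      · rw [hc, Set.indicator_of_mem hxX]
        exact hΦ.bound _ _
      · rw [hc, Set.indicator_of_notMem hxX, abs_zero]
        exact (Real.rpow_nonneg dist_nonneg _).trans (hdiam z₀ z₀)
    · rw [Set.indicator_of_notMem hx]
      by_cases hxX : x ∈ X
      · rw [hc, Set.indicator_of_mem hxX, hc₀]
        simp only
        rw [hΦ.support _ hx, abs_zero]
      · rw [hc, Set.indicator_of_notMem hxX, abs_zero]
  have hR0 : 0 ≤ R := (Real.rpow_nonneg dist_nonneg _).trans (hdiam z₀ z₀)
  have hcB : BddMeas c := ⟨hcm, R, fun x => (hcb x).trans (by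
    by_cases hx : x ∈ f ⁻¹' B
    · rw [Set.indicator_of_mem hx]
    · rw [Set.indicator_of_notMem hx]; exact hR0)⟩
  have hcF : BddMeas fun p : M × K => c p.1 := hcB.comp measurable_fst
  -- The first term gains the factor `a`; the second involves `μ` only through its marginal density.
  have split : sint (μ.map (skewProduct f G)) Φ
      = a * sint μ Ψ + ∫ γ, c γ * k γ ∂m₁ := by
    rw [sint_map μ hF hΦ.bddMeas]
    have e1 : sint μ (Φ ∘ skewProduct f G)
        = sint μ ((fun p => a * Ψ p) + fun p : M × K => c p.1) := by
      refine sint_congr_of_null hμ hX fun x z hx => ?_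
      rw [Pi.add_apply, hΨin x hx]
      simp only [hc, Set.indicator_of_mem hx, hc₀]
      rw [mul_inv_cancel_left₀ ha0.ne', sub_add_cancel]
      rfl
    rw [e1, sint_fun_add μ (hT.bddMeas.const_mul a) hcF, sint_fun_const_mul,
      sint_comp_fst hμ hcB]
    congr 1
    refine integral_congr_ae ?_
    filter_upwards [hk] with γ hγ
    rw [hγ]
  have hmB : m₁.real (f ⁻¹' B) = m₁.real B := by
    rw [measureReal_def, measureReal_def, hf.measure_preimage hB.nullMeasurableSet]
  have b1 := h (f ⁻¹' B) Ψ hfB hT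
  have b2 : |∫ γ, c γ * k γ ∂m₁| ≤ R * s * m₁.real B := by
    rw [← Real.norm_eq_abs]
    refine (norm_integral_le_of_norm_le
      ((integrable_const (R * s)).indicator hfB)
      (Filter.Eventually.of_forall fun x => ?_)).trans_eq ?_
    · rw [Real.norm_eq_abs, abs_mul]
      have h1 := mul_le_mul (hcb x) (hs x) (abs_nonneg _) ((abs_nonneg _).trans (hcb x))
      by_cases hx : x ∈ f ⁻¹' B
      · rwa [Set.indicator_of_mem hx] at h1 ⊢
      · rw [Set.indicator_of_notMem hx] at h1 ⊢
        rwa [zero_mul] at h1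
    · rw [integral_indicator hfB, setIntegral_const, smul_eq_mul, mul_comm, hmB]
  rw [split, add_mul, mul_assoc]
  refine (abs_add_le _ _).trans (add_le_add ?_ b2)
  rw [abs_mul, abs_of_pos ha0, ← hmB]
  exact mul_le_mul_of_nonneg_left b1 ha0.le

/-- The marginal density of the push-forward by the skew product is obtained with any operator dual
to the composition with `f`. -/
theorem marginalDensity_map (hf : MeasurePreserving f m₁ m₁) (hG : Measurable G)
    {μ : SignedMeasure (M × K)} (hμ : MarginalsAC m₁ μ) {k k' : M → ℝ}
    (hk : marginalDensity m₁ μ =ᵐ[m₁] k) (hk' : Integrable k' m₁)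
    (hdual : ∀ ψ : M → ℝ, BddMeas ψ → ∫ x, ψ (f x) * k x ∂m₁ = ∫ x, ψ x * k' x ∂m₁) :
    marginalDensity m₁ (μ.map (skewProduct f G)) =ᵐ[m₁] k' := by
  have hF := measurable_skewProduct hf.measurable hG
  refine marginalDensity_ae_eq (hμ.map hf hG) hk' fun B hB => ?_
  have hψ : BddMeas (B.indicator fun _ => (1 : ℝ)) := (bddMeas_const 1).indicator hB
  refine (sint_map μ hF (hψ.comp (measurable_fst (α := M) (β := K)))).trans ?_
  have e := sint_comp_fst hμ (hψ.comp hf.measurable)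
  refine e.trans ?_
  have e1 : ∫ γ, ((B.indicator fun _ => (1 : ℝ)) ∘ f) γ * marginalDensity m₁ μ γ ∂m₁
      = ∫ γ, (B.indicator fun _ => (1 : ℝ)) (f γ) * k γ ∂m₁ := by
    refine integral_congr_ae ?_
    filter_upwards [hk] with γ hγ
    rw [hγ]
    rfl
  rw [e1, hdual _ hψ, ← integral_indicator hB]
  refine integral_congr_ae (Filter.Eventually.of_forall fun x => ?_)
  by_cases hx : x ∈ B <;> simp [hx]

end Push

end SkewGap

end

noncomputable section

namespace SkewGap

/-! ### Measures with vanishing weak norm. -/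

section Separation

variable {M K : Type*} [MeasurableSpace M] [MetricSpace K] [CompactSpace K] [Nonempty K]
  [MeasurableSpace K] [BorelSpace K] {m₁ : Measure M} [IsProbabilityMeasure m₁] {ζ : ℝ≥0}

theorem fiberTest_indicator {g : K → ℝ} (hgm : Measurable g) (hg : HolderWith 1 ζ g) {R : ℝ}
    (hb : ∀ y, |g y| ≤ R) {B : Set M} (hB : MeasurableSet B) :
    FiberTest ζ R B ((Prod.fst ⁻¹' B).indicator fun p : M × K => g p.2) where
  measurable := (hgm.comp measurable_snd).indicator (measurable_fst hB)
  holder x := by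
    by_cases hx : x ∈ B
    · have : (fun z => (Prod.fst ⁻¹' B).indicator (fun p : M × K => g p.2) (x, z)) = g := by
        funext z; simp [Set.indicator, hx]
      rwa [this]
    · have : (fun z => (Prod.fst ⁻¹' B).indicator (fun p : M × K => g p.2) (x, z))
          = fun _ => 0 := by
        funext z; simp [Set.indicator, hx]
      rw [this]
      exact fun _ _ => by simp
  bound x z := by
    have hR : 0 ≤ R := (abs_nonneg _).trans (hb z)
    by_cases hx : x ∈ B
    · simpa [Set.indicator, hx] using hb z
    · simpa [Set.indicator, hx] using hR
  support x hx z := by simp [Set.indicator, hx]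

/-- Lipschitz functions with values in `[0, 1]` are multiples of Hölder test functions. -/
theorem exists_holder_scale (hζ1 : ζ ≤ 1) {g : K → ℝ} {L : ℝ≥0} (hL : LipschitzWith L g)
    (h0 : ∀ y, 0 ≤ g y) (h1 : ∀ y, g y ≤ 1) :
    ∃ c : ℝ, 0 < c ∧ HolderWith 1 ζ (fun y => c * g y) ∧ ∀ y, |c * g y| ≤ 1 := by
  -- At distance at most one, the Lipschitz bound and `dist ≤ dist ^ ζ` suffice. At larger
  -- distances, the values in `[0, 1]` differ by at most one, which is at most `dist ^ ζ`.
  set c : ℝ := (1 + (L : ℝ))⁻¹ with hc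
  have hL0 : (0 : ℝ) ≤ L := L.2
  have hc0 : 0 < c := by positivity
  have hc1 : c ≤ 1 := inv_le_one_of_one_le₀ (by linarith)
  refine ⟨c, hc0, ?_, fun y => ?_⟩
  · rw [holderWith_iff_abs]
    intro x y
    rw [NNReal.coe_one, one_mul, ← mul_sub, abs_mul, abs_of_pos hc0, hc,
      inv_mul_le_iff₀ (by positivity)]
    have hd : (0 : ℝ) ≤ dist x y ^ (ζ : ℝ) := Real.rpow_nonneg dist_nonneg _
    rcases le_total (dist x y) 1 with h | h
    · have e1 := hL.dist_le_mul x y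
      rw [Real.dist_eq] at e1
      have e2 : dist x y ≤ dist x y ^ (ζ : ℝ) :=
        Real.self_le_rpow_of_le_one dist_nonneg h (by exact_mod_cast hζ1)
      nlinarith [mul_le_mul_of_nonneg_left e2 hL0]
    · have e1 : |g x - g y| ≤ 1 := abs_le.2 ⟨by linarith [h0 x, h1 y], by linarith [h0 y, h1 x]⟩
      have e2 : 1 ≤ dist x y ^ (ζ : ℝ) := Real.one_le_rpow h ζ.2
      nlinarith
  · rw [abs_of_nonneg (mul_nonneg hc0.le (h0 y))]
    exact mul_le_one₀ hc1 (h0 y) (h1 y)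

/-- A signed measure whose weak norm vanishes is zero. -/
theorem eq_zero_of_weakBound_zero (hζ1 : ζ ≤ 1) {μ : SignedMeasure (M × K)}
    (h : WeakBound m₁ ζ 1 0 μ) : μ = 0 := by
  set a := μ.toJordanDecomposition.posPart with ha
  set b := μ.toJordanDecomposition.negPart with hb
  have lip : ∀ (B : Set M), MeasurableSet B → ∀ (g : K → ℝ) (L : ℝ≥0), LipschitzWith L g →
      (∀ y, 0 ≤ g y) → (∀ y, g y ≤ 1) →
      ∫ p in Prod.fst ⁻¹' B, g p.2 ∂a = ∫ p in Prod.fst ⁻¹' B, g p.2 ∂b := by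
    intro B hB g L hL h0 h1
    obtain ⟨c, hc, hH, hb1⟩ := exists_holder_scale hζ1 hL h0 h1
    have hT := fiberTest_indicator (hL.continuous.measurable.const_mul c) hH hb1 hB
    have := h B _ hB hT
    rw [zero_mul, abs_nonpos_iff, sint, integral_indicator (measurable_fst hB),
      integral_indicator (measurable_fst hB), integral_const_mul, integral_const_mul,
      ← mul_sub] at this
    exact sub_eq_zero.1 ((mul_eq_zero.1 this).resolve_left hc.ne')
  have fibre : ∀ B : Set M, MeasurableSet B →
      (a.restrict (Prod.fst ⁻¹' B)).map Prod.snd = (b.restrict (Prod.fst ⁻¹' B)).map Prod.snd := by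
    intro B hB
    -- Thickened indicators are Lipschitz and converge to the indicator of a closed set, so the
    -- equality of integrals passes to closed sets. These form a generating π-system.
    have closed : ∀ A : Set K, IsClosed A →
        ((a.restrict (Prod.fst ⁻¹' B)).map Prod.snd).real A
          = ((b.restrict (Prod.fst ⁻¹' B)).map Prod.snd).real A := by
      intro A hA
      have t1 := tendsto_integral_thickenedIndicator_of_isClosed
        ((a.restrict (Prod.fst ⁻¹' B)).map Prod.snd) hA (δs := fun n : ℕ => (1 : ℝ) / (n + 1))
        (fun _ => by positivity) tendsto_one_div_add_atTop_nhds_zero_nat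
      have t2 := tendsto_integral_thickenedIndicator_of_isClosed
        ((b.restrict (Prod.fst ⁻¹' B)).map Prod.snd) hA (δs := fun n : ℕ => (1 : ℝ) / (n + 1))
        (fun _ => by positivity) tendsto_one_div_add_atTop_nhds_zero_nat
      refine tendsto_nhds_unique t1 (t2.congr fun n => ?_)
      have hl := lipschitzWith_thickenedIndicator (δ := (1 : ℝ) / (n + 1)) (by positivity) A
      have hl' : LipschitzWith ((1 : ℝ) / (n + 1)).toNNReal⁻¹
          (fun y => (thickenedIndicator (δ := (1 : ℝ) / (n + 1)) (by positivity) A y : ℝ)) :=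
        fun x y => hl x y
      have hm : ∀ m : Measure K, AEStronglyMeasurable
          (fun y => (thickenedIndicator (δ := (1 : ℝ) / (n + 1)) (by positivity) A y : ℝ)) m :=
        fun m => hl'.continuous.aestronglyMeasurable
      rw [integral_map measurable_snd.aemeasurable (hm _),
        integral_map measurable_snd.aemeasurable (hm _)]
      exact (lip B hB _ _ hl' (fun y => NNReal.coe_nonneg _)
        (fun y => by exact_mod_cast thickenedIndicator_le_one _ _ _)).symm
    have closed' : ∀ A : Set K, IsClosed A →
        ((a.restrict (Prod.fst ⁻¹' B)).map Prod.snd) A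
          = ((b.restrict (Prod.fst ⁻¹' B)).map Prod.snd) A := fun A hA =>
      (ENNReal.toReal_eq_toReal_iff' (measure_ne_top _ _) (measure_ne_top _ _)).1 (closed A hA)
    refine ext_of_generate_finite _ ?_ isPiSystem_isClosed (fun A hA => closed' A hA)
      (closed' _ isClosed_univ)
    rw [BorelSpace.measurable_eq (α := K), borel_eq_generateFrom_isClosed]
  have hab : a = b := by
    refine Measure.ext_prod fun {s t} hs ht => ?_
    have := congrArg (fun m : Measure K => m t) (fibre s hs)
    simp only [Measure.map_apply measurable_snd ht,
      Measure.restrict_apply (measurable_snd ht)] at this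
    rwa [Set.inter_comm] at this
  ext E hE
  rw [SignedMeasure.apply_eq_posPart_real_sub_negPart_real μ hE, ← ha, ← hb, hab]
  simp

end Separation

/-! ### Limits against functions measurable in the base variable, and existence of an invariant
probability. -/

section StableConvergence

open Filter Topology

variable {M K : Type*} [MetricSpace M] [CompactSpace M] [MeasurableSpace M] [BorelSpace M]
  [MetricSpace K] [CompactSpace K] [Nonempty K]
  [MeasurableSpace K] [BorelSpace K] {m₁ : Measure M} [IsProbabilityMeasure m₁]

/-- A function on `M × K` that is measurable in the first and continuous in the second variable
is a strongly measurable function with values in `C(K, ℝ)`. -/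
theorem stronglyMeasurable_sections {Φ : M × K → ℝ} (hΦ : Measurable Φ)
    (hc : ∀ x, Continuous fun z => Φ (x, z)) :
    StronglyMeasurable fun x => (⟨fun z => Φ (x, z), hc x⟩ : C(K, ℝ)) := by
  borelize C(K, ℝ)
  set Ψ : M → C(K, ℝ) := fun x => ⟨fun z => Φ (x, z), hc x⟩ with hΨ
  suffices Measurable Ψ from this.stronglyMeasurable
  have hdist : ∀ g : C(K, ℝ), Measurable fun x => dist (Ψ x) g := by
    intro g
    refine measurable_of_Iic fun r => ?_
    rcases lt_or_ge r 0 with hr | hr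
    · have : (fun x => dist (Ψ x) g) ⁻¹' Set.Iic r = ∅ := by
        ext x
        simp only [Set.mem_preimage, Set.mem_Iic, Set.mem_empty_iff_false, iff_false, not_le]
        exact hr.trans_le dist_nonneg
      rw [this]
      exact MeasurableSet.empty
    -- By continuity in `z`, the uniform distance is a supremum over a dense sequence, hence
    -- measurable in `x`.
    · have : (fun x => dist (Ψ x) g) ⁻¹' Set.Iic r
          = ⋂ n : ℕ, {x | |Φ (x, TopologicalSpace.denseSeq K n)
              - g (TopologicalSpace.denseSeq K n)| ≤ r} := by
        ext x
        simp only [Set.mem_preimage, Set.mem_Iic, Set.mem_iInter, Set.mem_ofPred_eq]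
        rw [ContinuousMap.dist_le hr]
        constructor
        · intro h n
          exact h _
        · intro h z
          have hcl : IsClosed {z | |Φ (x, z) - g z| ≤ r} :=
            isClosed_le ((hc x).sub g.continuous).abs continuous_const
          have hsub : Set.range (TopologicalSpace.denseSeq K) ⊆ {z | |Φ (x, z) - g z| ≤ r} := by
            rintro _ ⟨n, rfl⟩
            exact h n
          exact hcl.closure_subset_iff.2 hsub (TopologicalSpace.denseRange_denseSeq K z)
      rw [this]
      refine MeasurableSet.iInter fun n => measurableSet_le ?_ measurable_const
      exact ((hΦ.comp (measurable_id.prodMk measurable_const)).sub measurable_const).abs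
  have hbasis : TopologicalSpace.IsTopologicalBasis
      {U : Set C(K, ℝ) | ∃ g r, U = Metric.ball g r} := by
    refine TopologicalSpace.isTopologicalBasis_of_isOpen_of_nhds ?_ ?_
    · rintro _ ⟨g, r, rfl⟩
      exact Metric.isOpen_ball
    · intro g U hg hU
      obtain ⟨r, hr, hsub⟩ := Metric.isOpen_iff.1 hU g hg
      exact ⟨_, ⟨g, r, rfl⟩, Metric.mem_ball_self hr, hsub⟩
  have hgen : borel C(K, ℝ) = MeasurableSpace.generateFrom
      {U : Set C(K, ℝ) | ∃ g r, U = Metric.ball g r} := hbasis.borel_eq_generateFrom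
  have hm : @Measurable _ _ _ (MeasurableSpace.generateFrom
      {U : Set C(K, ℝ) | ∃ g r, U = Metric.ball g r}) Ψ := by
    refine measurable_generateFrom ?_
    rintro _ ⟨g, r, rfl⟩
    exact measurableSet_lt (hdist g) measurable_const
  rwa [← hgen] at hm

/-- Weak convergence of probability measures with the same marginal on `M` implies the convergence
of the integrals of functions that are only measurable in the first variable. -/
theorem tendsto_integral_of_fst_eq {ι : Type*} {l : Filter ι} {ν : ι → ProbabilityMeasure (M × K)}
    {μ : ProbabilityMeasure (M × K)} (h : Tendsto ν l (𝓝 μ))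
    (hν : ∀ i, (ν i : Measure (M × K)).fst = m₁) (hμ : (μ : Measure (M × K)).fst = m₁)
    {Φ : M × K → ℝ} (hΦ : BddMeas Φ) (hc : ∀ x, Continuous fun z => Φ (x, z)) :
    Tendsto (fun i => ∫ p, Φ p ∂(ν i : Measure (M × K))) l
      (𝓝 (∫ p, Φ p ∂(μ : Measure (M × K)))) := by
  set Ψ : M → C(K, ℝ) := fun x => ⟨fun z => Φ (x, z), hc x⟩ with hΨ
  obtain ⟨R, hR⟩ := hΦ.2
  have hI : Integrable Ψ m₁ := by
    refine Integrable.of_bound (stronglyMeasurable_sections hΦ.1 hc).aestronglyMeasurable R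
      (Eventually.of_forall fun x => ?_)
    exact (ContinuousMap.norm_le _ ((abs_nonneg _).trans (hR (x, Classical.arbitrary K)))).2
      fun z => hR (x, z)
  rw [Metric.tendsto_nhds]
  intro ε hε
  obtain ⟨u, hu, huI⟩ := hI.exists_boundedContinuous_integral_sub_le (ε := ε / 4) (by linarith)
  have hvc : Continuous fun p : M × K => u p.1 p.2 :=
    ContinuousEval.continuous_eval.comp ((u.continuous.comp continuous_fst).prodMk continuous_snd)
  set v : BoundedContinuousFunction (M × K) ℝ :=
    BoundedContinuousFunction.mkOfCompact ⟨fun p : M × K => u p.1 p.2, hvc⟩ with hv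
  have close : ∀ m : ProbabilityMeasure (M × K), (m : Measure (M × K)).fst = m₁ →
      |∫ p, Φ p ∂(m : Measure (M × K)) - ∫ p, v p ∂(m : Measure (M × K))| ≤ ε / 4 := by
    intro m hm
    have hm' : (m : Measure (M × K)).map Prod.fst = m₁ := hm
    have hD : Integrable (fun x => ‖Ψ x - u x‖) ((m : Measure (M × K)).map Prod.fst) := by
      rw [hm']
      exact (hI.sub huI).norm
    have hD' : Integrable (fun p : M × K => ‖Ψ p.1 - u p.1‖) (m : Measure (M × K)) :=
      hD.comp_measurable measurable_fst
    have hle : ∀ p : M × K, ‖Φ p - v p‖ ≤ ‖Ψ p.1 - u p.1‖ := fun p =>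
      ContinuousMap.norm_coe_le_norm (Ψ p.1 - u p.1) p.2
    rw [← integral_sub (hΦ.integrable _) (v.integrable _), ← Real.norm_eq_abs]
    refine (norm_integral_le_of_norm_le hD' (Eventually.of_forall hle)).trans ?_
    rw [← hm'] at hu
    rwa [integral_map measurable_fst.aemeasurable hD.1] at hu
  have hconv := (ProbabilityMeasure.tendsto_iff_forall_integral_tendsto.1 h) v
  filter_upwards [Metric.tendsto_nhds.1 hconv (ε / 4) (by linarith)] with i hi
  rw [Real.dist_eq] at hi ⊢
  have h1 := abs_le.1 (close (ν i) (hν i))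
  have h2 := abs_le.1 (close μ hμ)
  have h3 := abs_lt.1 hi
  rw [abs_lt]
  constructor <;> linarith [h1.1, h1.2, h2.1, h2.2, h3.1, h3.2]

variable {ζ : ℝ≥0} {f : M → M} {G : M × K → K}

/-- An invariant probability with marginal `m₁` exists as soon as the successive push-forwards of
some probability with marginal `m₁` are asymptotically equal against fibrewise Hölder functions. -/
theorem exists_invariant (hζ : 0 < ζ) (hζ1 : ζ ≤ 1)
    (hfc : Continuous f) (hG : Measurable G) {α : ℝ}
    (hG1 : ContractsFibers m₁ G α) {ν : ℕ → ProbabilityMeasure (M × K)}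
    (hν : ∀ n, (ν n : Measure (M × K)).fst = m₁)
    (hstep : ∀ n, (ν (n + 1) : Measure (M × K)) = (ν n : Measure (M × K)).map (skewProduct f G))
    (hlim : ∀ Φ : M × K → ℝ, FiberTest ζ 1 Set.univ Φ → Tendsto (fun n =>
      ∫ p, Φ p ∂(ν (n + 1) : Measure (M × K)) - ∫ p, Φ p ∂(ν n : Measure (M × K))) atTop (𝓝 0)) :
    ∃ μ₀ : ProbabilityMeasure (M × K), (μ₀ : Measure (M × K)).map (skewProduct f G) = μ₀ ∧
      (μ₀ : Measure (M × K)).fst = m₁ := by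
  have hF := measurable_skewProduct hfc.measurable hG
  set l : Ultrafilter ℕ := hyperfilter ℕ with hl
  have hl' : (l : Filter ℕ) ≤ atTop := Nat.hyperfilter_le_atTop
  -- Probabilities on the compact space `M × K` form a compact set; an ultrafilter avoids extracting
  -- a subsequence.
  obtain ⟨μ₀, -, hμ₀⟩ := isCompact_univ.ultrafilter_le_nhds (l.map ν) (by simp)
  have hconv : Tendsto ν l (𝓝 μ₀) := hμ₀
  have hfst : (μ₀ : Measure (M × K)).fst = m₁ := by
    refine ext_of_forall_integral_eq_of_IsFiniteMeasure fun g => ?_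
    have h1 := (ProbabilityMeasure.tendsto_iff_forall_integral_tendsto.1 hconv)
      (g.compContinuous ⟨Prod.fst, continuous_fst⟩)
    have e : ∀ m : ProbabilityMeasure (M × K),
        ∫ p, (g.compContinuous ⟨Prod.fst, continuous_fst⟩) p ∂(m : Measure (M × K))
          = ∫ x, g x ∂(m : Measure (M × K)).fst := fun m => by
      rw [Measure.fst, integral_map measurable_fst.aemeasurable
        g.continuous.aestronglyMeasurable]
      rfl
    simp only [e, hν] at h1
    exact tendsto_nhds_unique h1 tendsto_const_nhds
  refine ⟨μ₀, ?_, hfst⟩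
  obtain ⟨X, hXm, hX, hXG⟩ := exists_contracting_set hG1
  have hmap : IsProbabilityMeasure ((μ₀ : Measure (M × K)).map (skewProduct f G)) :=
    Measure.isProbabilityMeasure_map hF.aemeasurable
  have test : ∀ Φ : M × K → ℝ, FiberTest ζ 1 Set.univ Φ →
      ∫ p, Φ p ∂(μ₀ : Measure (M × K)).map (skewProduct f G)
        = ∫ p, Φ p ∂(μ₀ : Measure (M × K)) := by
    intro Φ hΦ
    have cont : ∀ x, Continuous fun z => Φ (x, z) := fun x => (hΦ.holder x).continuous hζ
    -- In the base variable `Φ ∘ F` is only measurable, but it is continuous along each contracted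
    -- fibre. The cut-off to `X` makes this true of every fibre.
    set Φ' : M × K → ℝ := (Prod.fst ⁻¹' X).indicator (Φ ∘ skewProduct f G) with hΦ'
    have hb' : BddMeas Φ' := (hΦ.bddMeas.comp hF).indicator (measurable_fst hXm)
    have cont' : ∀ x, Continuous fun z => Φ' (x, z) := by
      intro x
      by_cases hx : x ∈ X
      · have e : (fun z => Φ' (x, z)) = fun z => Φ (f x, G (x, z)) := by
          funext z
          exact Set.indicator_of_mem (s := Prod.fst ⁻¹' X) (a := (x, z)) hx _
        rw [e]
        refine (cont (f x)).comp ?_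
        exact (LipschitzWith.of_dist_le' (hXG x hx)).continuous
      · have e : (fun z => Φ' (x, z)) = fun z => 0 := by
          funext z
          exact Set.indicator_of_notMem (s := Prod.fst ⁻¹' X) (a := (x, z)) hx _
        rw [e]
        exact continuous_const
    have heq : ∀ m : Measure (M × K), m.fst = m₁ →
        ∫ p, Φ' p ∂m = ∫ p, Φ (skewProduct f G p) ∂m := by
      intro m hm
      have h1 : ∀ᵐ q ∂m, q.1 ∈ X := by
        rw [← hm] at hX
        exact ae_of_ae_map measurable_fst.aemeasurable hX
      refine integral_congr_ae ?_
      filter_upwards [h1] with q hq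
      exact Set.indicator_of_mem (s := Prod.fst ⁻¹' X) (a := q) hq _
    have t1 := tendsto_integral_of_fst_eq hconv hν hfst hb' cont'
    have t2 := tendsto_integral_of_fst_eq hconv hν hfst hΦ.bddMeas cont
    have t3 := (hlim Φ hΦ).mono_left hl'
    rw [integral_map hF.aemeasurable hΦ.measurable.aestronglyMeasurable, ← heq _ hfst]
    -- The integrals of `Φ'` against `ν n` are those of `Φ` against `ν (n + 1)`, which have the same
    -- limit as those against `ν n`.
    have t4 := t2.add t3
    rw [add_zero] at t4
    refine tendsto_nhds_unique t1 (t4.congr fun n => ?_)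
    rw [heq _ (hν n), hstep, integral_map hF.aemeasurable hΦ.measurable.aestronglyMeasurable]
    ring
  have hz : ((μ₀ : Measure (M × K)).map (skewProduct f G)).toSignedMeasure
      - (μ₀ : Measure (M × K)).toSignedMeasure = 0 := by
    refine eq_zero_of_weakBound_zero (m₁ := m₁) hζ1 fun B Φ _ hΦ => ?_
    have hΦ' : FiberTest ζ 1 Set.univ Φ :=
      ⟨hΦ.measurable, hΦ.holder, hΦ.bound, fun x hx => absurd (Set.mem_univ x) hx⟩
    rw [sint_sub _ _ hΦ.bddMeas, sint_toSignedMeasure _ hΦ.bddMeas,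
      sint_toSignedMeasure _ hΦ.bddMeas, test Φ hΦ', sub_self, abs_zero, zero_mul]
  exact Measure.toSignedMeasure_eq_toSignedMeasure_iff.1 (sub_eq_zero.1 hz)

end StableConvergence

end SkewGap

end

noncomputable section

namespace SkewGap

/-! ### Quantitative bounds in `S^∞` and decay for mass zero. -/

section Strong

variable {M K : Type*} [MetricSpace M] [CompactSpace M] [MeasurableSpace M] [BorelSpace M]
  [MetricSpace K] [CompactSpace K] [Nonempty K]
  [MeasurableSpace K] [BorelSpace K] {m₁ : Measure M} [IsProbabilityMeasure m₁] {ζ : ℝ≥0}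
  {f : M → M} {G : M × K → K}

theorem bddMeas_of_holder (hζ : 0 < ζ) {C : ℝ} {h : M → ℝ}
    (hh : ∀ x y, |h x - h y| ≤ C * dist x y ^ (ζ : ℝ)) : BddMeas h := by
  have hH : HolderWith C.toNNReal ζ h := by
    rw [holderWith_iff_abs]
    intro x y
    exact (hh x y).trans (mul_le_mul_of_nonneg_right (Real.le_coe_toNNReal C)
      (Real.rpow_nonneg dist_nonneg _))
  have hc : Continuous h := hH.continuous hζ
  refine ⟨hc.measurable, ?_⟩
  obtain ⟨R, hR⟩ := isCompact_univ.exists_bound_of_continuousOn hc.continuousOn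
  exact ⟨R, fun x => hR x (Set.mem_univ x)⟩

/-- A quantitative form of membership in `S^∞`, with test functions in place of disintegrations. -/
structure SBound (m₁ : Measure M) (ζ : ℝ≥0) (C : ℝ) (μ : SignedMeasure (M × K)) : Prop where
  ac : MarginalsAC m₁ μ
  weak : WeakBound m₁ ζ 1 C μ
  rep : ∃ h : M → ℝ, marginalDensity m₁ μ =ᵐ[m₁] h ∧ (∀ x, |h x| ≤ C) ∧
    ∀ x y, |h x - h y| ≤ C * dist x y ^ (ζ : ℝ)

theorem SBound.nonneg {C : ℝ} {μ : SignedMeasure (M × K)} (h : SBound m₁ ζ C μ) : 0 ≤ C := by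
  obtain ⟨x⟩ := nonempty_of_isProbabilityMeasure m₁
  obtain ⟨k, -, hk, -⟩ := h.rep
  exact (abs_nonneg _).trans (hk x)

theorem SBound.add {C C' : ℝ} {μ ν : SignedMeasure (M × K)} (h : SBound m₁ ζ C μ)
    (h' : SBound m₁ ζ C' ν) : SBound m₁ ζ (C + C') (μ + ν) := by
  obtain ⟨k, hk, hb, hd⟩ := h.rep
  obtain ⟨k', hk', hb', hd'⟩ := h'.rep
  refine ⟨marginalsAC_add m₁ h.ac h'.ac, h.weak.add h'.weak, k + k',
    (marginalDensity_add m₁ h.ac h'.ac).trans (hk.add hk'),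
    fun x => (abs_add_le _ _).trans (add_le_add (hb x) (hb' x)), fun x y => ?_⟩
  rw [Pi.add_apply, Pi.add_apply, add_sub_add_comm, add_mul]
  exact (abs_add_le _ _).trans (add_le_add (hd x y) (hd' x y))

theorem marginalDensity_smul {μ : SignedMeasure (M × K)} (hμ : MarginalsAC m₁ μ) (c : ℝ) :
    marginalDensity m₁ (c • μ) =ᵐ[m₁] c • marginalDensity m₁ μ := by
  refine marginalDensity_ae_eq (marginalsAC_smul m₁ c hμ)
    ((integrable_marginalDensity hμ).smul c) fun B hB => ?_
  rw [sint_smul, sint_comp_fst hμ ((bddMeas_const 1).indicator hB), ← integral_indicator hB,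
    ← integral_const_mul]
  refine integral_congr_ae (Filter.Eventually.of_forall fun γ => ?_)
  by_cases hγ : γ ∈ B <;> simp [hγ]

theorem SBound.smul {C : ℝ} {μ : SignedMeasure (M × K)} (h : SBound m₁ ζ C μ) (c : ℝ) :
    SBound m₁ ζ (|c| * C) (c • μ) := by
  obtain ⟨k, hk, hb, hd⟩ := h.rep
  refine ⟨marginalsAC_smul m₁ c h.ac, h.weak.smul c, c • k,
    (marginalDensity_smul h.ac c).trans (hk.const_smul c), fun x => ?_, fun x y => ?_⟩
  · rw [Pi.smul_apply, smul_eq_mul, abs_mul]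
    exact mul_le_mul_of_nonneg_left (hb x) (abs_nonneg _)
  · rw [Pi.smul_apply, Pi.smul_apply, smul_eq_mul, smul_eq_mul, ← mul_sub, abs_mul, mul_assoc]
    exact mul_le_mul_of_nonneg_left (hd x y) (abs_nonneg _)

theorem SBound.mono {C C' : ℝ} {μ : SignedMeasure (M × K)} (h : SBound m₁ ζ C μ)
    (hC : C ≤ C') : SBound m₁ ζ C' μ := by
  obtain ⟨k, hk, hb, hd⟩ := h.rep
  exact ⟨h.ac, h.weak.mono le_rfl hC, k, hk, fun x => (hb x).trans hC, fun x y =>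
    (hd x y).trans (mul_le_mul_of_nonneg_right hC (Real.rpow_nonneg dist_nonneg _))⟩

theorem SBound.sub {C C' : ℝ} {μ ν : SignedMeasure (M × K)} (h : SBound m₁ ζ C μ)
    (h' : SBound m₁ ζ C' ν) : SBound m₁ ζ (C + C') (μ - ν) := by
  have e : μ - ν = μ + (-1 : ℝ) • ν := by
    ext E _
    simp [sub_eq_add_neg]
  have := h.add (h'.smul (-1))
  rwa [abs_neg, abs_one, one_mul, ← e] at this

theorem mass_eq {μ : SignedMeasure (M × K)} (hμ : MarginalsAC m₁ μ) {k : M → ℝ}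
    (hk : marginalDensity m₁ μ =ᵐ[m₁] k) : μ Set.univ = ∫ x, k x ∂m₁ := by
  rw [← sint_one]
  refine (sint_comp_fst hμ (bddMeas_const (1 : ℝ))).trans (integral_congr_ae ?_)
  filter_upwards [hk] with x hx
  rw [one_mul, hx]

theorem SBound.abs_univ_le {C : ℝ} {μ : SignedMeasure (M × K)} (h : SBound m₁ ζ C μ) :
    |μ Set.univ| ≤ C := by
  obtain ⟨k, hk, hb, -⟩ := h.rep
  rw [mass_eq h.ac hk, ← Real.norm_eq_abs]
  refine (norm_integral_le_of_norm_le_const (Filter.Eventually.of_forall hb)).trans_eq ?_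
  simp

/-- The strong norm is the sum of a Hölder constant, a supremum and the weak norm, each at most `C`.
-/
theorem SBound.sinftyENorm_le (hζ : 0 < ζ) {C : ℝ} {μ : SignedMeasure (M × K)}
    (h : SBound m₁ ζ C μ) : sinftyENorm m₁ ζ μ ≤ ENNReal.ofReal (3 * C) := by
  have hC := h.nonneg
  obtain ⟨k, hk, hb, hd⟩ := h.rep
  have h1 : eHolderNorm ζ k ≤ ENNReal.ofReal C := by
    have : HolderWith C.toNNReal ζ k := by
      rw [holderWith_iff_abs, Real.coe_toNNReal _ hC]
      exact hd
    exact this.eHolderNorm_le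
  have h2 : (⨆ x, ‖k x‖ₑ) ≤ ENNReal.ofReal C := iSup_le fun x => by
    rw [Real.enorm_eq_ofReal_abs]
    exact ENNReal.ofReal_le_ofReal (hb x)
  have h3 := linftyNorm_le_of_weakBound hζ h.ac h.weak
  have h4 : aeHolderNorm m₁ ζ (marginalDensity m₁ μ) ≤ fullHolderNorm ζ k := iInf₂_le k hk
  rw [show 3 * C = C + C + C by ring, ENNReal.ofReal_add (by positivity) hC,
    ENNReal.ofReal_add hC hC]
  exact add_le_add (h4.trans (add_le_add h1 h2)) h3

theorem SBound.sinftyNorm_le (hζ : 0 < ζ) {C : ℝ} {μ : SignedMeasure (M × K)}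
    (h : SBound m₁ ζ C μ) : sinftyNorm m₁ ζ μ ≤ 3 * C :=
  ENNReal.toReal_le_of_le_ofReal (by have := h.nonneg; positivity) (h.sinftyENorm_le hζ)

theorem SBound.mem (hζ : 0 < ζ) {C : ℝ} {μ : SignedMeasure (M × K)} (h : SBound m₁ ζ C μ) :
    μ ∈ SInfty m₁ ζ hζ :=
  ⟨h.ac, (h.sinftyENorm_le hζ).trans_lt ENNReal.ofReal_lt_top⟩

/-- Strictness is essential: the Hölder norm of a class is an infimum, and a representative
realizing it is not at hand. -/
theorem sBound_of_lt {μ : SignedMeasure (M × K)} (hμ : MarginalsAC m₁ μ) {C : ℝ}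
    (h : sinftyENorm m₁ ζ μ < ENNReal.ofReal C) : SBound m₁ ζ C μ := by
  have hC : 0 < C := ENNReal.ofReal_pos.1 (zero_le.trans_lt h)
  refine ⟨hμ, weakBound_of_linftyNorm_le hμ hC.le (le_add_self.trans h.le), ?_⟩
  have h1 : aeHolderNorm m₁ ζ (marginalDensity m₁ μ) < ENNReal.ofReal C := le_self_add.trans_lt h
  simp only [aeHolderNorm, iInf_lt_iff] at h1
  obtain ⟨k, hk, hlt⟩ := h1
  refine ⟨k, hk, fun x => ?_, ?_⟩
  · have h2 : ‖k x‖ₑ ≤ ENNReal.ofReal C :=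
      (le_iSup (fun x => ‖k x‖ₑ) x).trans (le_add_self.trans hlt.le)
    rw [Real.enorm_eq_ofReal_abs] at h2
    exact (ENNReal.ofReal_le_ofReal_iff hC.le).1 h2
  · have h2 : eHolderNorm ζ k ≤ (C.toNNReal : ℝ≥0∞) := le_self_add.trans hlt.le
    have h3 : HolderWith C.toNNReal ζ k := by
      have hm : MemHolder ζ k := eHolderNorm_lt_top.1 (h2.trans_lt ENNReal.coe_lt_top)
      exact hm.holderWith.mono (by
        rw [← ENNReal.coe_le_coe, hm.coe_nnHolderNorm_eq_eHolderNorm]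
        exact h2)
    rw [holderWith_iff_abs, Real.coe_toNNReal _ hC.le] at h3
    exact h3

theorem sBound_of_mem {hζ : 0 < ζ} {μ : SignedMeasure (M × K)} (h : μ ∈ SInfty m₁ ζ hζ)
    {C : ℝ} (hC : sinftyNorm m₁ ζ μ < C) : SBound m₁ ζ C μ := by
  refine sBound_of_lt h.1 ?_
  rwa [ENNReal.lt_ofReal_iff_toReal_lt h.2.ne]

/-- A positive measure whose marginal is `m₁` belongs to `S^∞`. -/
theorem sBound_of_fst_eq {μ : Measure (M × K)} [IsFiniteMeasure μ] (h : μ.fst = m₁) :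
    SBound m₁ ζ 1 μ.toSignedMeasure := by
  have hac : MarginalsAC m₁ μ.toSignedMeasure := by
    rw [marginalsAC_iff]
    intro B hB hB0 E hE hEB
    rw [Measure.toSignedMeasure_apply_measurable hE, measureReal_def, measure_mono_null hEB]
    · rfl
    · rw [← Measure.fst_apply hB, h, hB0]
  have hreal : ∀ B, MeasurableSet B → μ.real (Prod.fst ⁻¹' B) = m₁.real B := fun B hB => by
    rw [measureReal_def, measureReal_def, ← Measure.fst_apply hB, h]
  refine ⟨hac, fun B Φ hB hΦ => ?_, fun _ => 1, ?_, by simp, fun x y => ?_⟩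
  · rw [sint_toSignedMeasure _ hΦ.bddMeas, one_mul, ← hreal B hB, ← Real.norm_eq_abs]
    refine (norm_integral_le_of_norm_le
      ((integrable_const (1 : ℝ)).indicator (measurable_fst hB))
      (Filter.Eventually.of_forall fun p => ?_)).trans_eq ?_
    · by_cases hp : p ∈ Prod.fst ⁻¹' B
      · rw [Set.indicator_of_mem hp]
        exact hΦ.bound p.1 p.2
      · rw [Set.indicator_of_notMem hp, hΦ.support p.1 hp p.2, norm_zero]
    · rw [integral_indicator (measurable_fst hB), setIntegral_const, smul_eq_mul, mul_one]
  · refine marginalDensity_ae_eq hac (integrable_const 1) fun B hB => ?_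
    have e : (fun p : M × K => B.indicator (fun _ => (1 : ℝ)) p.1)
        = (Prod.fst ⁻¹' B).indicator fun _ => 1 := rfl
    rw [e, sint_indicator_one _ (measurable_fst hB),
      Measure.toSignedMeasure_apply_measurable (measurable_fst hB), hreal B hB,
      setIntegral_const, smul_eq_mul, mul_one]
  · rw [sub_self, abs_zero, one_mul]
    exact Real.rpow_nonneg dist_nonneg _

/-- `T` is dual to the composition with `f`, and it flattens Hölder functions exponentially fast. -/
structure FlatteningDual (m₁ : Measure M) (f : M → M) (ζ : ℝ) (T : (M → ℝ) → M → ℝ)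
    (κ V : ℝ) : Prop where
  kappa_pos : 0 < κ
  kappa_lt_one : κ < 1
  V_pos : 0 < V
  dual : ∀ ψ h : M → ℝ, BddMeas ψ → BddMeas h →
    ∫ x, ψ (f x) * h x ∂m₁ = ∫ x, ψ x * T h x ∂m₁
  decay : ∀ (C : ℝ) (h : M → ℝ), 0 ≤ C → (∀ x y, |h x - h y| ≤ C * dist x y ^ ζ) → OscLE C h →
    ∀ n : ℕ, (∀ x y, |T^[n] h x - T^[n] h y| ≤ V * κ ^ n * C * dist x y ^ ζ) ∧
      OscLE (V * κ ^ n * C) (T^[n] h)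

theorem exists_rpow_dist_le (K : Type*) [MetricSpace K] [CompactSpace K] (ζ : ℝ≥0) :
    ∃ R : ℝ, 1 ≤ R ∧ ∀ z z' : K, dist z z' ^ (ζ : ℝ) ≤ R := by
  refine ⟨max 1 (Metric.diam (Set.univ : Set K) ^ (ζ : ℝ)), le_max_left _ _, fun z z' => ?_⟩
  refine le_max_of_le_right (Real.rpow_le_rpow dist_nonneg ?_ ζ.coe_nonneg)
  exact Metric.dist_le_diam_of_mem isCompact_univ.isBounded (Set.mem_univ z) (Set.mem_univ z')

theorem map_univ_iterate (hF : Measurable (skewProduct f G)) (μ : SignedMeasure (M × K)) (n : ℕ) :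
    ((fun ν => VectorMeasure.map ν (skewProduct f G))^[n] μ) Set.univ = μ Set.univ := by
  induction n with
  | zero => rfl
  | succ n ih =>
    rw [Function.iterate_succ_apply', VectorMeasure.map_apply _ hF MeasurableSet.univ,
      Set.preimage_univ, ih]

/-- The push-forward contracts the measures of zero mass in `S^∞` exponentially fast. -/
theorem FlatteningDual.exists_decay (hζ : 0 < ζ) (hf : MeasurePreserving f m₁ m₁)
    (hG : Measurable G) {α : ℝ} (hα0 : 0 < α) (hα1 : α < 1) (hG1 : ContractsFibers m₁ G α)
    {T : (M → ℝ) → M → ℝ} {κ V : ℝ} (hT : FlatteningDual m₁ f ζ T κ V) :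
    ∃ ξ Q : ℝ, 0 < ξ ∧ ξ < 1 ∧ 0 < Q ∧ ∀ (C : ℝ) (μ : SignedMeasure (M × K)),
      SBound m₁ ζ C μ → μ Set.univ = 0 → ∀ n : ℕ,
        SBound m₁ ζ (Q * ξ ^ n * C)
          ((fun ν => VectorMeasure.map ν (skewProduct f G))^[n] μ) := by
  obtain ⟨R, hR1, hR⟩ := exists_rpow_dist_le K ζ
  have hF := measurable_skewProduct hf.measurable hG
  set a := α ^ (ζ : ℝ) with ha
  have ha1 : a < 1 := Real.rpow_lt_one hα0.le hα1 (by exact_mod_cast hζ)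
  have hκ0 := hT.kappa_pos
  have hκ1 := hT.kappa_lt_one
  have hV := hT.V_pos
  obtain ⟨ξ, hξ, hξ1⟩ := exists_between (max_lt ha1 hκ1)
  have haξ : a < ξ := (le_max_left _ _).trans_lt hξ
  have hκξ : κ < ξ := (le_max_right _ _).trans_lt hξ
  have hξ0 : 0 < ξ := hκ0.trans hκξ
  have hgap : 0 < ξ - a := by linarith
  -- Chosen so that `a K₀ + 2 R V ≤ ξ K₀`, which closes the induction for the weak norm, while `K₀ ≥
  -- R` starts it.
  set K₀ := R + 2 * R * V / (ξ - a) with hK₀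
  have hR0 : 0 < R := by linarith
  have hK₀R : R ≤ K₀ := le_add_of_nonneg_right (by positivity)
  have hK₀g : 2 * R * V ≤ K₀ * (ξ - a) := by
    rw [hK₀, add_mul, div_mul_cancel₀ _ hgap.ne']
    exact le_add_of_nonneg_left (by positivity)
  refine ⟨ξ, K₀ + 2 * V, hξ0, hξ1, by linarith, fun C μ hμ h0 => ?_⟩
  have hC := hμ.nonneg
  obtain ⟨h, hh, hb, hd⟩ := hμ.rep
  set ν : ℕ → SignedMeasure (M × K) :=
    fun n => (fun ν => VectorMeasure.map ν (skewProduct f G))^[n] μ with hν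
  have hνs : ∀ n, ν (n + 1) = (ν n).map (skewProduct f G) := fun n =>
    Function.iterate_succ_apply' _ n μ
  -- A supremum at most `C` gives an oscillation at most `2 * C`.
  have hdec := hT.decay (2 * C) h (by linarith)
    (fun x y => (hd x y).trans (mul_le_mul_of_nonneg_right (by linarith)
      (Real.rpow_nonneg dist_nonneg _)))
    (fun x y => by
      have h1 := abs_le.1 (hb x)
      have h2 := abs_le.1 (hb y)
      linarith [h1.2, h2.1])
  have hkb : ∀ n, BddMeas (T^[n] h) := fun n => bddMeas_of_holder hζ (hdec n).1
  have hden : ∀ n, MarginalsAC m₁ (ν n) ∧ marginalDensity m₁ (ν n) =ᵐ[m₁] T^[n] h := by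
    intro n
    induction n with
    | zero => exact ⟨hμ.ac, hh⟩
    | succ n ih =>
      rw [hνs, Function.iterate_succ_apply']
      refine ⟨ih.1.map hf hG, marginalDensity_map hf hG ih.1 ih.2 ?_ fun ψ hψ =>
        hT.dual ψ _ hψ (hkb n)⟩
      rw [← Function.iterate_succ_apply' T]
      exact (hkb (n + 1)).integrable _
  -- Mass zero is preserved, so every density has mean zero and its values are bounded by its
  -- oscillation.
  have hsup : ∀ n x, |T^[n] h x| ≤ V * κ ^ n * (2 * C) := by
    intro n x
    have hz : ∫ y, T^[n] h y ∂m₁ = 0 := by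
      rw [← mass_eq (hden n).1 (hden n).2]
      exact (map_univ_iterate hF μ n).trans h0
    have e : T^[n] h x = ∫ y, (T^[n] h x - T^[n] h y) ∂m₁ := by
      rw [integral_sub (integrable_const _) ((hkb n).integrable _), hz]
      simp
    rw [e, ← Real.norm_eq_abs]
    refine (norm_integral_le_of_norm_le_const (Filter.Eventually.of_forall fun y =>
      (hdec n).2.abs_le x y)).trans_eq ?_
    simp
  have hpow : ∀ n : ℕ, κ ^ n ≤ ξ ^ n := fun n => pow_le_pow_left₀ hκ0.le hκξ.le n
  have hweak : ∀ n, WeakBound m₁ ζ R (K₀ * ξ ^ n * C) (ν n) := by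
    intro n
    induction n with
    | zero =>
      refine (hμ.weak.scale hR1).mono le_rfl ?_
      rw [pow_zero, mul_one]
      exact mul_le_mul_of_nonneg_right hK₀R hC
    | succ n ih =>
      rw [hνs]
      refine (ih.map hf hG hα0 hG1 hR (hden n).1 (hden n).2 (hsup n)).mono le_rfl ?_
      have h1 : R * (V * κ ^ n * (2 * C)) ≤ K₀ * (ξ - a) * (ξ ^ n * C) := by
        calc R * (V * κ ^ n * (2 * C)) = 2 * R * V * (κ ^ n * C) := by ring
          _ ≤ 2 * R * V * (ξ ^ n * C) := by
            have := hpow n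
            gcongr
          _ ≤ _ := mul_le_mul_of_nonneg_right hK₀g (by positivity)
      calc a * (K₀ * ξ ^ n * C) + R * (V * κ ^ n * (2 * C))
          ≤ a * (K₀ * ξ ^ n * C) + K₀ * (ξ - a) * (ξ ^ n * C) := by linarith
        _ = K₀ * ξ ^ (n + 1) * C := by ring
  intro n
  have hle : V * κ ^ n * (2 * C) ≤ (K₀ + 2 * V) * ξ ^ n * C := by
    calc V * κ ^ n * (2 * C) = 2 * V * (κ ^ n * C) := by ring
      _ ≤ 2 * V * (ξ ^ n * C) := by
        have := hpow n
        gcongr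
      _ ≤ (K₀ + 2 * V) * (ξ ^ n * C) :=
        mul_le_mul_of_nonneg_right (by linarith) (by positivity)
      _ = _ := by ring
  refine ⟨(hden n).1, (hweak n).mono hR1 ?_, T^[n] h, (hden n).2,
    fun x => (hsup n x).trans hle, fun x y => ((hdec n).1 x y).trans
      (mul_le_mul_of_nonneg_right hle (Real.rpow_nonneg dist_nonneg _))⟩
  have : 0 ≤ ξ ^ n * C := by positivity
  nlinarith

end Strong

end SkewGap

end

noncomputable section

namespace SkewGap

/-! ### The hypotheses on the base map imply flattening. -/

section Base

variable {d : ℕ} {M : Type*} [MetricSpace M] [CompactSpace M] [ConnectedSpace M]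
  [ChartedSpace (EuclideanSpace ℝ (Fin d)) M] [MeasurableSpace M] [BorelSpace M]
  {m₁ : Measure M} [IsProbabilityMeasure m₁] {ζ : ℝ≥0} {f : M → M} {J Λ : M → ℝ} {A : Set M}
  {σ L ε : ℝ} {q : ℕ}

/-- The normalized transfer operator of the base map is dual to composition and flattening. -/
theorem BaseHypotheses.exists_flatteningDual (hM : HasIntermediatePoints M)
    (hdiam : ∀ x y : M, dist x y ≤ 1) (hζ : 0 < ζ) (hζ1 : ζ ≤ 1)
    (hf : BaseHypotheses (d := d) ζ f m₁ J Λ A σ L ε q) :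
    ∃ (T : (M → ℝ) → M → ℝ) (κ V : ℝ), FlatteningDual m₁ f ζ T κ V := by
  have hc : Continuous f := hf.localDiffeo.contMDiff.continuous
  have ho : IsOpenMap f := hf.localDiffeo.isOpenMap
  obtain ⟨𝒰, h𝒰, hcov, 𝒱, h𝒱, hcard, hA⟩ := hf.covering
  obtain ⟨hfin, δ, hb⟩ := exists_branches hc ho hf.inverse_branch hf.isOpen_region
    hf.one_lt_sigma hf.one_le_L hf.L_le_two hf.bound_on_region hf.bound_off_region 𝒱
    (fun V hV => (h𝒰 V (h𝒱 hV)).2) hcard hA hf.q_lt_degree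
  set ρ := weight J with hρ
  have hpos : ∀ x, 0 < ρ x := fun x => one_div_pos.2 (hf.jacobian.pos x)
  set a := ⨅ x, ρ x with ha
  -- The strict Hölder bound on the weight already forces its infimum to be positive.
  have ha0 : 0 < a := by
    have h1 : 0 < ε * a := ENNReal.ofReal_pos.1 (zero_le.trans_lt hf.holder_weight)
    exact pos_of_mul_pos_right h1 hf.eps_pos.le
  have hbelow : BddBelow (Set.range ρ) := ⟨0, by rintro _ ⟨x, rfl⟩; exact (hpos x).le⟩
  have hge : ∀ y, a ≤ ρ y := fun y => ciInf_le hbelow y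
  have hmem : MemHolder ζ ρ := eHolderNorm_lt_top.1 (hf.holder_weight.trans ENNReal.ofReal_lt_top)
  have hH := holderWith_iff_abs.1 hmem.holderWith
  have hρc : Continuous ρ := hmem.holderWith.continuous hζ
  have hlogc : Continuous fun x => Real.log (ρ x) := hρc.log fun x => (hpos x).ne'
  have hdist : ∀ y y', ρ y ≤ Real.exp ε * ρ y' := by
    intro y y'
    have h1 : Real.log (ρ y) ≤ ⨆ x, Real.log (ρ x) :=
      le_ciSup (isCompact_range hlogc).bddAbove y
    have h2 : (⨅ x, Real.log (ρ x)) ≤ Real.log (ρ y') :=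
      ciInf_le (isCompact_range hlogc).bddBelow y'
    have h3 := hf.osc_log_weight
    rw [← Real.exp_log (hpos y), ← Real.exp_log (hpos y'), ← Real.exp_add]
    exact Real.exp_le_exp.2 (by linarith)
  obtain ⟨β, B, hp⟩ := branchWeight_normalized hb ζ.coe_nonneg ha0 (Real.exp_pos ε)
    (nnHolderNorm ζ ρ).coe_nonneg hge hdist hH
  have hD : (0 : ℝ) < mapDegree f := by exact_mod_cast hb.D_pos
  have hθ1 : Real.exp ε / (mapDegree f : ℝ) * branchRate (mapDegree f) q L σ⁻¹ ζ < 1 := by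
    have h1 := hf.smallness
    have hσ : (0 : ℝ) ≤ σ := by linarith [hf.one_lt_sigma]
    rw [Real.rpow_neg hσ, ← Real.inv_rpow hσ, mul_assoc (q : ℝ)] at h1
    rwa [div_mul_eq_mul_div, mul_div_assoc]
  -- Uniform weights obey the same smallness condition, since `exp ε ≥ 1`.
  have hu : 1 / (mapDegree f : ℝ) * branchRate (mapDegree f) q L σ⁻¹ ζ < 1 := by
    refine lt_of_le_of_lt (mul_le_mul_of_nonneg_right ?_ (branchRate_nonneg hb)) hθ1
    exact div_le_div_of_nonneg_right (Real.one_le_exp hf.eps_pos.le) hD.le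
  obtain ⟨κ, V, hκ0, hκ1, hV, hdec⟩ := exists_transfer_decay hM hdiam hb hp
    (by exact_mod_cast hζ) (by exact_mod_cast hζ1) hu hθ1
  obtain ⟨R, hR⟩ := (bddMeas_of_holder hζ hH).2
  exact ⟨_, κ, V, hκ0, hκ1, hV, fun ψ h hψ hh =>
    hf.jacobian.integral_comp_mul hc hf.invariant (mem_fiberFinset hfin) hR h𝒰 hcov hψ.1
      hψ.2.choose_spec hh.1 hh.2.choose_spec, hdec⟩

end Base

/-! ### Invariant probabilities from the decay for mass zero. -/

section Gap

variable {M K : Type*} [MetricSpace M] [CompactSpace M] [MeasurableSpace M] [BorelSpace M]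
  [MetricSpace K] [CompactSpace K] [Nonempty K]
  [MeasurableSpace K] [BorelSpace K] {m₁ : Measure M} [IsProbabilityMeasure m₁] {ζ : ℝ≥0}
  {f : M → M} {G : M × K → K}

/-- The measures of zero mass in `S^∞` are contracted exponentially fast. -/
def MassZeroDecay (m₁ : Measure M) (ζ : ℝ≥0) (F : M × K → M × K) (ξ Q : ℝ) : Prop :=
  ∀ (C : ℝ) (μ : SignedMeasure (M × K)), SBound m₁ ζ C μ → μ Set.univ = 0 → ∀ n : ℕ,
    SBound m₁ ζ (Q * ξ ^ n * C) ((fun ν => VectorMeasure.map ν F)^[n] μ)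

/-- A fixed measure inherits the bounds of all its iterates, which tend to zero; the weak norm
separates. -/
theorem MassZeroDecay.eq_zero {F : M × K → M × K} {ξ Q : ℝ} (hξ0 : 0 < ξ) (hξ1 : ξ < 1)
    (hdec : MassZeroDecay m₁ ζ F ξ Q) (hζ1 : ζ ≤ 1) {C : ℝ} {μ : SignedMeasure (M × K)}
    (hμ : SBound m₁ ζ C μ) (h0 : μ Set.univ = 0) (hinv : μ.map F = μ) : μ = 0 := by
  refine eq_zero_of_weakBound_zero (m₁ := m₁) hζ1 fun B Φ hB hΦ => ?_
  have hfix : ∀ n : ℕ, (fun ν => VectorMeasure.map ν F)^[n] μ = μ := fun n =>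
    Function.iterate_fixed hinv n
  have hlim : Filter.Tendsto (fun n : ℕ => Q * ξ ^ n * C * m₁.real B) Filter.atTop
      (nhds (Q * 0 * C * m₁.real B)) :=
    (((tendsto_pow_atTop_nhds_zero_of_lt_one hξ0.le hξ1).const_mul Q).mul_const C).mul_const _
  rw [mul_zero, zero_mul] at hlim
  refine ge_of_tendsto' hlim fun n => ?_
  have := (hdec C μ hμ h0 n).weak B Φ hB hΦ
  rwa [hfix] at this

theorem toSignedMeasure_map {X Y : Type*} [MeasurableSpace X] [MeasurableSpace Y] (μ : Measure X)
    [IsFiniteMeasure μ] {F : X → Y} (hF : Measurable F) :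
    (μ.map F).toSignedMeasure = μ.toSignedMeasure.map F := by
  ext E hE
  rw [VectorMeasure.map_apply _ hF hE, Measure.toSignedMeasure_apply_measurable hE,
    Measure.toSignedMeasure_apply_measurable (hF hE), measureReal_def, measureReal_def,
    Measure.map_apply hF hE]

theorem toSignedMeasure_univ {X : Type*} [MeasurableSpace X] (μ : Measure X)
    [IsProbabilityMeasure μ] : μ.toSignedMeasure Set.univ = 1 := by
  rw [Measure.toSignedMeasure_apply_measurable MeasurableSet.univ]
  simp

/-- Existence of an invariant probability whose marginal is `m₁`. -/
theorem MassZeroDecay.exists_invariant {ξ Q : ℝ} (hξ0 : 0 < ξ) (hξ1 : ξ < 1)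
    (hdec : MassZeroDecay m₁ ζ (skewProduct f G) ξ Q) (hζ : 0 < ζ) (hζ1 : ζ ≤ 1)
    (hf : MeasurePreserving f m₁ m₁) (hfc : Continuous f) (hG : Measurable G) {α : ℝ}
    (hG1 : ContractsFibers m₁ G α) :
    ∃ μ₀ : ProbabilityMeasure (M × K), (μ₀ : Measure (M × K)).map (skewProduct f G) = μ₀ ∧
      (μ₀ : Measure (M × K)).fst = m₁ := by
  have hF := measurable_skewProduct hf.measurable hG
  set F := skewProduct f G with hFdef
  set ν₀ : ProbabilityMeasure (M × K) :=
    ⟨m₁.prod (Measure.dirac (Classical.arbitrary K)), inferInstance⟩ with hν₀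
  set ν : ℕ → ProbabilityMeasure (M × K) := fun n => (fun μ => μ.map hF.aemeasurable)^[n] ν₀
    with hν
  have hstep : ∀ n, (ν (n + 1) : Measure (M × K)) = (ν n : Measure (M × K)).map F := by
    intro n
    rw [hν]
    simp only [Function.iterate_succ_apply']
    rfl
  have hfst : ∀ n, (ν n : Measure (M × K)).fst = m₁ := by
    intro n
    induction n with
    | zero => exact Measure.fst_prod
    | succ n ih =>
      rw [hstep, Measure.fst, Measure.map_map measurable_fst hF]
      have e : Prod.fst ∘ F = f ∘ Prod.fst := rfl
      rw [e, ← Measure.map_map hf.measurable measurable_fst]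
      change Measure.map f (ν n : Measure (M × K)).fst = m₁
      rw [ih, hf.map_eq]
  -- The first difference has mass zero and lies in `S^∞`, since both probabilities have marginal
  -- `m₁`. The later ones are its iterates, so they decay.
  set δ : ℕ → SignedMeasure (M × K) := fun n =>
    (ν (n + 1) : Measure (M × K)).toSignedMeasure - (ν n : Measure (M × K)).toSignedMeasure with hδ
  have hδs : ∀ n, δ n = (fun μ => VectorMeasure.map μ F)^[n] (δ 0) := by
    intro n
    induction n with
    | zero => rfl
    | succ n ih =>
      rw [Function.iterate_succ_apply', ← ih]
      simp only [hδ]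
      have h1 : ∀ k, (ν (k + 1) : Measure (M × K)).toSignedMeasure
          = (ν k : Measure (M × K)).toSignedMeasure.map F := fun k => by
        rw [← toSignedMeasure_map _ hF]
        exact Measure.toSignedMeasure_congr (hstep k)
      rw [h1 (n + 1), h1 n]
      ext E hE
      simp [VectorMeasure.map_apply _ hF hE]
  have hb : SBound m₁ ζ (1 + 1) (δ 0) := (sBound_of_fst_eq (hfst 1)).sub (sBound_of_fst_eq (hfst 0))
  have h0 : δ 0 Set.univ = 0 := by
    simp only [hδ, sub_apply, toSignedMeasure_univ, sub_self]
  refine SkewGap.exists_invariant hζ hζ1 hfc hG hG1 hfst hstep fun Φ hΦ => ?_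
  have hlim : Filter.Tendsto (fun n : ℕ => Q * ξ ^ n * (1 + 1)) Filter.atTop
      (nhds (Q * 0 * (1 + 1))) :=
    ((tendsto_pow_atTop_nhds_zero_of_lt_one hξ0.le hξ1).const_mul Q).mul_const _
  rw [mul_zero, zero_mul] at hlim
  refine squeeze_zero_norm (fun n => ?_) hlim
  have h1 := (hdec _ _ hb h0 n).weak Set.univ Φ MeasurableSet.univ hΦ
  rw [← hδs, probReal_univ, mul_one, sint_sub _ _ hΦ.bddMeas, sint_toSignedMeasure _ hΦ.bddMeas,
    sint_toSignedMeasure _ hΦ.bddMeas] at h1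
  exact h1

end Gap

end SkewGap

end

noncomputable section

namespace SkewGap

/-! ### Spectral decomposition and decay of correlations. -/

section Spectral

variable {M K : Type*} [MetricSpace M] [CompactSpace M] [MeasurableSpace M] [BorelSpace M]
  [MetricSpace K] [CompactSpace K] [Nonempty K]
  [MeasurableSpace K] [BorelSpace K] {m₁ : Measure M} [IsProbabilityMeasure m₁] {ζ : ℝ≥0}
  {F : M × K → M × K}

/-- Negation here is multiplication by `-1`, so a difference unfolds to the sum with a multiple by
`-1`. -/
instance SInfty.addCommGroup (hζ : 0 < ζ) : AddCommGroup (SInfty (K := K) m₁ ζ hζ) :=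
  Module.addCommMonoidToAddCommGroup ℝ

/-- The rank one projection `μ ↦ μ(Σ) μ₀`. -/
def massProjection {hζ : 0 < ζ} (v : SInfty (K := K) m₁ ζ hζ) :
    Module.End ℝ (SInfty (K := K) m₁ ζ hζ) where
  toFun μ := (μ : SignedMeasure (M × K)) Set.univ • v
  map_add' μ ν := by
    rw [← add_smul]
    rfl
  map_smul' c μ := by
    rw [RingHom.id_apply, smul_smul]
    rfl

/-- `SBound` is available for every `C` strictly above the norm; let `C` decrease to it. -/
theorem sinftyNorm_le_of_forall {hζ : 0 < ζ} {μ ν : SignedMeasure (M × K)}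
    (hμ : μ ∈ SInfty m₁ ζ hζ) {s : ℝ} (hs : 0 < s)
    (h : ∀ C, SBound m₁ ζ C μ → SBound m₁ ζ (s * C) ν) :
    sinftyNorm m₁ ζ ν ≤ 3 * s * sinftyNorm m₁ ζ μ := by
  rw [← div_le_iff₀' (by positivity)]
  refine le_of_forall_gt_imp_ge_of_dense fun C hC => ?_
  rw [div_le_iff₀' (by positivity), mul_assoc]
  exact (h C (sBound_of_mem hμ hC)).sinftyNorm_le hζ

/-- The spectral gap, from the decay on measures of zero mass and an invariant probability. -/
theorem MassZeroDecay.exists_isSpectralGap {ξ Q : ℝ} (hξ0 : 0 < ξ) (hξ1 : ξ < 1) (hQ : 0 < Q)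
    (hdec : MassZeroDecay m₁ ζ F ξ Q) (hζ : 0 < ζ) (hF : Measurable F)
    {μ₀ : Measure (M × K)} [IsProbabilityMeasure μ₀] (hinv : μ₀.map F = μ₀)
    (hfst : μ₀.fst = m₁) :
    ∃ P N : Module.End ℝ (SInfty (K := K) m₁ ζ hζ),
      IsSpectralGap F m₁ ζ hζ P N ξ (6 * Q) := by
  have hS₀ : SBound m₁ ζ 1 μ₀.toSignedMeasure := sBound_of_fst_eq hfst
  have hmap₀ : μ₀.toSignedMeasure.map F = μ₀.toSignedMeasure := by
    rw [← toSignedMeasure_map _ hF]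
    exact Measure.toSignedMeasure_congr hinv
  -- Subtracting its mass times `μ₀` makes a measure massless and at most doubles the bound, because
  -- the mass is at most `C`.
  have hcut : ∀ (μ : SignedMeasure (M × K)) C, SBound m₁ ζ C μ →
      SBound m₁ ζ (2 * C) (μ - μ Set.univ • μ₀.toSignedMeasure) := fun μ C h =>
    (h.sub (hS₀.smul _)).mono (by linarith [h.abs_univ_le])
  have hcut0 : ∀ μ : SignedMeasure (M × K),
      (μ - μ Set.univ • μ₀.toSignedMeasure) Set.univ = 0 := fun μ => by
    rw [sub_apply, smul_apply, toSignedMeasure_univ, smul_eq_mul, mul_one, sub_self]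
  have hdecomp : ∀ μ : SignedMeasure (M × K), μ.map F
      = μ Set.univ • μ₀.toSignedMeasure
        + (μ - μ Set.univ • μ₀.toSignedMeasure).map F := fun μ => by
    have e := map_sub (VectorMeasure.mapₗ (R := ℝ) (M := ℝ) F) μ (μ Set.univ • μ₀.toSignedMeasure)
    rw [map_smul] at e
    simp only [VectorMeasure.mapₗ_apply] at e
    rw [e, hmap₀, add_sub_cancel]
  -- Stability of `S^∞` comes from a single step of the decay, applied to the massless part.
  have hmem : ∀ μ ∈ SInfty (K := K) m₁ ζ hζ, μ.map F ∈ SInfty (K := K) m₁ ζ hζ := by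
    intro μ hμ
    rw [hdecomp]
    refine Submodule.add_mem _ (Submodule.smul_mem _ _ (hS₀.mem hζ)) ?_
    have h1 := sBound_of_mem hμ (lt_add_one _)
    exact (hdec _ _ (hcut μ _ h1) (hcut0 μ) 1).mem hζ
  set S : Module.End ℝ (SInfty (K := K) m₁ ζ hζ) :=
    (VectorMeasure.mapₗ (R := ℝ) (M := ℝ) F).restrict hmem with hS
  set v : SInfty (K := K) m₁ ζ hζ := ⟨μ₀.toSignedMeasure, hS₀.mem hζ⟩ with hv
  set P := massProjection v with hP
  have hPv : ∀ μ : SInfty (K := K) m₁ ζ hζ,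
      P μ = (μ : SignedMeasure (M × K)) Set.univ • v := fun _ => rfl
  have hv1 : (v : SignedMeasure (M × K)) Set.univ = 1 := toSignedMeasure_univ μ₀
  have hv0 : v ≠ 0 := fun h => by
    rw [h] at hv1
    exact zero_ne_one hv1
  have hPP : P * P = P := by
    ext1 μ
    rw [Module.End.mul_apply, hPv μ, map_smul, hPv v, hv1, one_smul]
  have hSP : S * P = P := by
    ext1 μ
    rw [Module.End.mul_apply, hPv μ, map_smul]
    congr 1
    exact Subtype.ext hmap₀
  have hPS : P * S = P := by
    ext1 μ
    rw [Module.End.mul_apply, hPv, hPv μ]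
    congr 1
    change ((μ : SignedMeasure (M × K)).map F) Set.univ = _
    rw [VectorMeasure.map_apply _ hF MeasurableSet.univ, Set.preimage_univ]
  -- Exponent zero must be excluded: the left side would be `1` and the right side `1 - P`.
  have hpow : ∀ n : ℕ, (S - P) ^ (n + 1) = S ^ (n + 1) * (1 - P) := by
    intro n
    induction n with
    | zero => rw [zero_add, pow_one, pow_one, mul_sub, mul_one, hSP]
    | succ n ih =>
      have h1 : ∀ k : ℕ, P * S ^ k = P := fun k => by
        induction k with
        | zero => rw [pow_zero, mul_one]
        | succ k ih => rw [pow_succ, ← mul_assoc, ih, hPS]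
      rw [pow_succ', ih, sub_mul, ← mul_assoc, ← pow_succ', ← mul_assoc, h1, mul_sub P, mul_one,
        hPP, sub_self, sub_zero]
  have hiter : ∀ (n : ℕ) (μ : SInfty (K := K) m₁ ζ hζ), (((S ^ n) μ : SInfty m₁ ζ hζ) :
      SignedMeasure (M × K)) = (fun ν => VectorMeasure.map ν F)^[n] μ := by
    intro n
    induction n with
    | zero => exact fun μ => rfl
    | succ n ih =>
      intro μ
      rw [Function.iterate_succ_apply', ← ih, pow_succ', Module.End.mul_apply]
      rfl
  refine ⟨P, S - P,
    { decomposition := fun μ => ?_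
      projection := hPP
      rank_one := ?_
      xi_pos := hξ0
      xi_lt_one := hξ1
      const_pos := by positivity
      bound := fun n hn μ => ?_
      proj_mul := by rw [mul_sub, hPS, hPP, sub_self]
      mul_proj := by rw [sub_mul, hSP, hPP, sub_self] }⟩
  · rw [← Submodule.coe_add, LinearMap.sub_apply, add_sub_cancel]
    rfl
  · refine (finrank_eq_one_iff_of_nonzero' (⟨v, v, by rw [hPv, hv1, one_smul]⟩ :
      LinearMap.range P) (fun h => hv0 (congrArg Subtype.val h))).2 ?_
    rintro ⟨_, μ, rfl⟩
    exact ⟨_, Subtype.ext (hPv μ).symm⟩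
  · obtain ⟨k, rfl⟩ : ∃ k, n = k + 1 := ⟨n - 1, by omega⟩
    -- The constant `6 Q` is `3` from comparing `SBound` with the norm, `2` from removing the mass,
    -- and `Q` from the decay.
    refine (sinftyNorm_le_of_forall (s := 2 * (Q * ξ ^ (k + 1))) μ.2 (by positivity)
      fun C hC => ?_).trans_eq (by ring)
    have e : (((1 - P) μ : SInfty m₁ ζ hζ) : SignedMeasure (M × K))
        = μ - (μ : SignedMeasure (M × K)) Set.univ • μ₀.toSignedMeasure := by
      change (μ : SignedMeasure (M × K))
        + (-1 : ℝ) • ((μ : SignedMeasure (M × K)) Set.univ • μ₀.toSignedMeasure) = _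
      ext E hE
      simp [sub_eq_add_neg, hE]
    rw [hpow, Module.End.mul_apply, hiter, e]
    exact (hdec _ _ (hcut _ C hC) (hcut0 _) (k + 1)).mono (le_of_eq (by ring))

theorem SInfty.eq_zero_of_sinftyNorm_le_zero {hζ : 0 < ζ} (hζ1 : ζ ≤ 1)
    {μ : SignedMeasure (M × K)} (hμ : μ ∈ SInfty m₁ ζ hζ) (h : sinftyNorm m₁ ζ μ ≤ 0) : μ = 0 := by
  refine eq_zero_of_weakBound_zero (m₁ := m₁) hζ1 fun B Φ hB hΦ => ?_
  rw [zero_mul]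
  refine le_of_forall_gt_imp_ge_of_dense fun C hC => ?_
  refine ((sBound_of_mem hμ (h.trans_lt hC)).weak B Φ hB hΦ).trans ?_
  exact mul_le_of_le_one_right hC.le measureReal_le_one

theorem SInfty.abs_univ_le {hζ : 0 < ζ} {μ : SignedMeasure (M × K)} (hμ : μ ∈ SInfty m₁ ζ hζ) :
    |μ Set.univ| ≤ sinftyNorm m₁ ζ μ :=
  le_of_forall_gt_imp_ge_of_dense fun _ hC => (sBound_of_mem hμ hC).abs_univ_le

theorem sint_map_iterate (hF : Measurable F) (n : ℕ) (μ : SignedMeasure (M × K)) {Φ : M × K → ℝ}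
    (hΦ : BddMeas Φ) :
    sint ((fun ν => VectorMeasure.map ν F)^[n] μ) Φ = sint μ (Φ ∘ F^[n]) := by
  induction n generalizing μ with
  | zero => rfl
  | succ n ih =>
    rw [Function.iterate_succ_apply, ih, sint_map _ hF (hΦ.comp (hF.iterate n))]
    rfl

theorem continuous_of_memHolder_onSumMetric (hζ : 0 < ζ) {g : M × K → ℝ}
    (hg : MemHolder ζ (onSumMetric g)) : Continuous g :=
  (hg.holderWith.continuous hζ).comp (WithLp.prod_continuous_toLp 1 M K)

theorem bddMeas_of_continuous {X : Type*} [TopologicalSpace X] [CompactSpace X]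
    [MeasurableSpace X] [OpensMeasurableSpace X] {g : X → ℝ} (hg : Continuous g) : BddMeas g := by
  obtain ⟨R, hR⟩ := isCompact_univ.exists_bound_of_continuousOn hg.continuousOn
  exact ⟨hg.measurable, R, fun x => hR x (Set.mem_univ x)⟩

theorem dist_toLp_same_fst (x : M) (z z' : K) :
    dist (WithLp.toLp 1 (x, z)) (WithLp.toLp 1 (x, z')) = dist z z' := by
  rw [WithLp.prod_dist_eq_add (by simp)]
  simp

theorem fullHolderNorm_onSumMetric_ne_top (hζ : 0 < ζ) {g : M × K → ℝ}
    (hg : MemHolder ζ (onSumMetric g)) : fullHolderNorm ζ (onSumMetric g) ≠ ⊤ := by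
  obtain ⟨-, R, hR⟩ := bddMeas_of_continuous (continuous_of_memHolder_onSumMetric hζ hg)
  refine ENNReal.add_ne_top.2 ⟨eHolderNorm_ne_top.2 hg, ne_top_of_le_ne_top
    (ENNReal.ofReal_ne_top (r := R)) (iSup_le fun p => ?_)⟩
  rw [Real.enorm_eq_ofReal_abs]
  exact ENNReal.ofReal_le_ofReal (hR (WithLp.ofLp p))

/-- Duality between `S^∞` and the Hölder functions on the product. -/
theorem abs_sint_le {hζ : 0 < ζ} {μ : SignedMeasure (M × K)} (hμ : μ ∈ SInfty m₁ ζ hζ)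
    {g : M × K → ℝ} (hg : MemHolder ζ (onSumMetric g)) :
    |sint μ g| ≤ (fullHolderNorm ζ (onSumMetric g)).toReal * sinftyNorm m₁ ζ μ := by
  set s := (fullHolderNorm ζ (onSumMetric g)).toReal with hs
  set V := sinftyNorm m₁ ζ μ with hV
  have hs0 : 0 ≤ s := ENNReal.toReal_nonneg
  have htop := fullHolderNorm_onSumMetric_ne_top hζ hg
  have hH : ((nnHolderNorm ζ (onSumMetric g) : ℝ≥0) : ℝ) ≤ s :=
    ENNReal.toReal_mono htop (le_self_add (a := eHolderNorm ζ (onSumMetric g)))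
  have hsup : ∀ p, |g p| ≤ s := by
    intro p
    have h1 : ‖g p‖ₑ ≤ fullHolderNorm ζ (onSumMetric g) :=
      (le_iSup (fun p => ‖onSumMetric g p‖ₑ) (WithLp.toLp 1 p)).trans le_add_self
    have h2 := ENNReal.toReal_mono htop h1
    rwa [toReal_enorm, Real.norm_eq_abs] at h2
  have hd := holderWith_iff_abs.1 hg.holderWith
  -- The slack `t` allows division when `s = 0` and provides the strict inequality behind `SBound`;
  -- it tends to zero at the end.
  have key : ∀ t : ℝ, 0 < t → |sint μ g| ≤ (s + t) * (V + t) := by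
    intro t ht
    have hst : 0 < s + t := by linarith
    have hT : FiberTest ζ 1 Set.univ fun p => (s + t)⁻¹ * g p :=
      { measurable := ((continuous_of_memHolder_onSumMetric hζ hg).measurable).const_mul _
        holder := fun x => by
          rw [holderWith_iff_abs]
          intro z z'
          have h1 := hd (WithLp.toLp 1 (x, z)) (WithLp.toLp 1 (x, z'))
          rw [dist_toLp_same_fst] at h1
          have h2 : 0 ≤ dist z z' ^ (ζ : ℝ) := Real.rpow_nonneg dist_nonneg _
          rw [NNReal.coe_one, one_mul, ← mul_sub, abs_mul, abs_of_pos (inv_pos.2 hst),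
            inv_mul_le_iff₀ hst]
          exact h1.trans (mul_le_mul_of_nonneg_right (by linarith) h2)
        bound := fun x z => by
          rw [abs_mul, abs_of_pos (inv_pos.2 hst), inv_mul_le_iff₀ hst]
          linarith [hsup (x, z)]
        support := fun x hx => absurd (Set.mem_univ x) hx }
    have h1 := (sBound_of_mem hμ (lt_add_of_pos_right V ht)).weak _ _ MeasurableSet.univ hT
    rwa [sint_fun_const_mul, abs_mul, abs_of_pos (inv_pos.2 hst), inv_mul_le_iff₀ hst,
      probReal_univ, mul_one] at h1
  have hlim : Filter.Tendsto (fun t : ℝ => (s + t) * (V + t)) (nhdsWithin 0 (Set.Ioi 0))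
      (nhds (s * V)) :=
    (Continuous.tendsto' (by fun_prop) 0 _ (by simp)).mono_left nhdsWithin_le_nhds
  exact ge_of_tendsto hlim (by filter_upwards [self_mem_nhdsWithin] with t ht using key t ht)

variable {hζ : 0 < ζ} {P N : Module.End ℝ (SInfty (K := K) m₁ ζ hζ)} {ξ C : ℝ}

/-- The mixed products vanish and `P` is idempotent, so only the pure powers remain. -/
theorem IsSpectralGap.map_eq (h : IsSpectralGap F m₁ ζ hζ P N ξ C)
    (μ : SInfty (K := K) m₁ ζ hζ) {n : ℕ} (hn : 1 ≤ n) :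
    (fun ν => VectorMeasure.map ν F)^[n] (μ : SignedMeasure (M × K))
      = (P μ : SignedMeasure (M × K)) + (N ^ n) μ := by
  induction n, hn using Nat.le_induction with
  | base => exact h.decomposition μ
  | succ n hn ih =>
    obtain ⟨k, rfl⟩ : ∃ k, n = k + 1 := ⟨n - 1, by omega⟩
    rw [Function.iterate_succ_apply', ih, ← Submodule.coe_add, h.decomposition]
    have h1 : P (P μ) = P μ := LinearMap.congr_fun h.projection μ
    have h2 : N (P μ) = 0 := LinearMap.congr_fun h.mul_proj μ
    have h3 : P ((N ^ (k + 1)) μ) = 0 := by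
      rw [pow_succ', Module.End.mul_apply]
      exact LinearMap.congr_fun h.proj_mul _
    have h4 : N ((N ^ (k + 1)) μ) = (N ^ (k + 1 + 1)) μ := by
      rw [pow_succ' N (k + 1)]
      rfl
    rw [map_add, map_add, h1, h2, h3, h4, add_zero, zero_add]

theorem IsSpectralGap.tendsto_bound (h : IsSpectralGap F m₁ ζ hζ P N ξ C)
    (μ : SInfty (K := K) m₁ ζ hζ) : Filter.Tendsto
      (fun n : ℕ => sinftyNorm m₁ ζ (μ : SignedMeasure (M × K)) * ξ ^ (n + 1) * C) Filter.atTop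
      (nhds 0) := by
  have h1 := (tendsto_pow_atTop_nhds_zero_of_lt_one h.xi_pos.le h.xi_lt_one).comp
    (Filter.tendsto_add_atTop_nat 1)
  have h2 := (h1.const_mul (sinftyNorm m₁ ζ (μ : SignedMeasure (M × K)))).mul_const C
  rwa [mul_zero, zero_mul] at h2

/-- Push-forward preserves mass, and the mass carried by `N ^ n` tends to zero because it is bounded
by the norm. -/
theorem IsSpectralGap.proj_univ (h : IsSpectralGap F m₁ ζ hζ P N ξ C) (hF : Measurable F)
    (μ : SInfty (K := K) m₁ ζ hζ) :
    (P μ : SignedMeasure (M × K)) Set.univ = (μ : SignedMeasure (M × K)) Set.univ := by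
  have h1 : ∀ n : ℕ, |(μ : SignedMeasure (M × K)) Set.univ - (P μ : SignedMeasure (M × K)) Set.univ|
      ≤ sinftyNorm m₁ ζ (μ : SignedMeasure (M × K)) * ξ ^ (n + 1) * C := by
    intro n
    have e := sint_map_iterate hF (n + 1) (μ : SignedMeasure (M × K))
      (bddMeas_const (X := M × K) (1 : ℝ))
    rw [sint_one, h.map_eq μ (by omega : 1 ≤ n + 1)] at e
    have e' : sint (μ : SignedMeasure (M × K)) ((fun _ => (1 : ℝ)) ∘ F^[n + 1])
        = (μ : SignedMeasure (M × K)) Set.univ := sint_one _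
    rw [e', add_apply] at e
    rw [← e, add_sub_cancel_left]
    exact (SInfty.abs_univ_le ((N ^ (n + 1)) μ).2).trans (h.bound (n + 1) (by omega) μ)
  have h2 := ge_of_tendsto' (h.tendsto_bound μ) h1
  exact (sub_eq_zero.1 (abs_nonpos_iff.1 h2)).symm

/-- For a fixed vector, `v = P v + N ^ (n + 1) v` for every `n`; hence `N v = N ^ (n + 1) v`, which
tends to zero. -/
theorem IsSpectralGap.proj_eq_self (h : IsSpectralGap F m₁ ζ hζ P N ξ C) (hζ1 : ζ ≤ 1)
    {v : SInfty (K := K) m₁ ζ hζ} (hv : (v : SignedMeasure (M × K)).map F = v) : P v = v := by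
  have hfix : ∀ n : ℕ, (fun ν => VectorMeasure.map ν F)^[n] (v : SignedMeasure (M × K)) = v :=
    fun n => Function.iterate_fixed hv n
  have hN : ∀ n : ℕ, (v : SignedMeasure (M × K)) = (P v : SignedMeasure (M × K)) + (N ^ (n + 1)) v :=
    fun n => by rw [← h.map_eq v (by omega : 1 ≤ n + 1), hfix]
  have h1 : ∀ n : ℕ, sinftyNorm m₁ ζ (N v : SignedMeasure (M × K))
      ≤ sinftyNorm m₁ ζ (v : SignedMeasure (M × K)) * ξ ^ (n + 1) * C := by
    intro n
    have e : (N v : SignedMeasure (M × K)) = (N ^ (n + 1)) v :=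
      add_left_cancel ((hN 0).symm.trans (hN n))
    rw [e]
    exact h.bound (n + 1) (by omega) v
  have h2 := SInfty.eq_zero_of_sinftyNorm_le_zero hζ1 (N v).2
    (ge_of_tendsto' (h.tendsto_bound v) h1)
  have h3 := h.decomposition v
  rw [hv, h2, add_zero] at h3
  exact (Subtype.ext h3).symm

/-- The projection of a spectral gap is `μ ↦ μ(Σ) μ₀`. -/
theorem IsSpectralGap.proj_eq (h : IsSpectralGap F m₁ ζ hζ P N ξ C) (hζ1 : ζ ≤ 1)
    (hF : Measurable F) {v : SInfty (K := K) m₁ ζ hζ}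
    (hv : (v : SignedMeasure (M × K)).map F = v) (hv1 : (v : SignedMeasure (M × K)) Set.univ = 1)
    (μ : SInfty (K := K) m₁ ζ hζ) : P μ = (μ : SignedMeasure (M × K)) Set.univ • v := by
  have hPv := h.proj_eq_self hζ1 hv
  have hv0 : v ≠ 0 := fun h0 => by
    rw [h0] at hv1
    exact zero_ne_one hv1
  -- The range is a line containing `v`, so `P μ = c v`; comparing masses gives `c`.
  obtain ⟨c, hc⟩ := (finrank_eq_one_iff_of_nonzero' (⟨v, v, hPv⟩ : LinearMap.range P)
    (fun h0 => hv0 (congrArg Subtype.val h0))).1 h.rank_one ⟨P μ, μ, rfl⟩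
  have hc' : c • v = P μ := congrArg Subtype.val hc
  have e := h.proj_univ hF μ
  rw [← hc', Submodule.coe_smul, smul_apply, hv1, smul_eq_mul, mul_one] at e
  rw [← hc', e]

/-- Exponential decay of correlations. -/
theorem IsSpectralGap.correlation_le (h : IsSpectralGap F m₁ ζ hζ P N ξ C) (hζ1 : ζ ≤ 1)
    (hF : Measurable F) {μ₀ : Measure (M × K)} [IsProbabilityMeasure μ₀] (hinv : μ₀.map F = μ₀)
    (hmem : μ₀.toSignedMeasure ∈ SInfty m₁ ζ hζ) {g : M × K → ℝ}
    (hg : MemHolder ζ (onSumMetric g)) {k : M × K → ℝ} (hk : Integrable k μ₀)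
    (hkS : μ₀.withDensityᵥ k ∈ SInfty m₁ ζ hζ) {n : ℕ} (hn : 1 ≤ n) :
    |∫ p, g (F^[n] p) * k p ∂μ₀ - (∫ p, g p ∂μ₀) * ∫ p, k p ∂μ₀|
      ≤ sinftyNorm m₁ ζ (μ₀.withDensityᵥ k) * C * (fullHolderNorm ζ (onSumMetric g)).toReal
        * ξ ^ n := by
  have hgb : BddMeas g := bddMeas_of_continuous (continuous_of_memHolder_onSumMetric hζ hg)
  set v : SInfty (K := K) m₁ ζ hζ := ⟨μ₀.toSignedMeasure, hmem⟩ with hv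
  set w : SInfty (K := K) m₁ ζ hζ := ⟨μ₀.withDensityᵥ k, hkS⟩ with hw
  have hvF : (v : SignedMeasure (M × K)).map F = v := by
    change μ₀.toSignedMeasure.map F = μ₀.toSignedMeasure
    rw [← toSignedMeasure_map _ hF]
    exact Measure.toSignedMeasure_congr hinv
  have hPw := h.proj_eq hζ1 hF hvF (toSignedMeasure_univ μ₀) w
  have hmass : (w : SignedMeasure (M × K)) Set.univ = ∫ p, k p ∂μ₀ := by
    change μ₀.withDensityᵥ k Set.univ = _
    rw [withDensityᵥ_apply hk MeasurableSet.univ, setIntegral_univ]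
  have e1 : ∫ p, g (F^[n] p) * k p ∂μ₀ = sint (w : SignedMeasure (M × K)) (g ∘ F^[n]) :=
    (sint_withDensity μ₀ hk (hgb.comp (hF.iterate n))).symm
  -- The projected part is the product of the two integrals, so the correlation is exactly the
  -- integral of `g` against `N ^ n w`.
  have e2 : sint (w : SignedMeasure (M × K)) (g ∘ F^[n])
      = (∫ p, g p ∂μ₀) * (∫ p, k p ∂μ₀) + sint ((N ^ n) w : SInfty m₁ ζ hζ) g := by
    rw [← sint_map_iterate hF n _ hgb, h.map_eq w hn, sint_add _ _ hgb, hPw, Submodule.coe_smul,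
      sint_smul, hmass, mul_comm]
    congr 2
    exact sint_toSignedMeasure μ₀ hgb
  rw [e1, e2, add_sub_cancel_left]
  refine (abs_sint_le ((N ^ n) w).2 hg).trans ?_
  refine (mul_le_mul_of_nonneg_left (h.bound n hn w) ENNReal.toReal_nonneg).trans_eq ?_
  change _ * (sinftyNorm m₁ ζ (μ₀.withDensityᵥ k) * ξ ^ n * C) = _
  ring

end Spectral

end SkewGap

end

/-! ### Assembly of the theorem. -/

theorem theoremC {d : ℕ} {M K : Type*}
    [MetricSpace M] [CompactSpace M] [ConnectedSpace M]
    [ChartedSpace (EuclideanSpace ℝ (Fin d)) M] [IsManifold (𝓡 d) ∞ M]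
    [RiemannianBundle (fun x : M => TangentSpace (𝓡 d) x)]
    [IsContMDiffRiemannianBundle (𝓡 d) ∞ (EuclideanSpace ℝ (Fin d))
      (fun x : M => TangentSpace (𝓡 d) x)]
    [IsRiemannianManifold (𝓡 d) M] [MeasurableSpace M] [BorelSpace M]
    [MetricSpace K] [CompactSpace K] [Nonempty K] [MeasurableSpace K] [BorelSpace K]
    (hdiam : Metric.diam (Set.univ : Set M) = 1)
    (ζ : ℝ≥0) (hζ : 0 < ζ) (hζ1 : ζ ≤ 1)
    (f : M → M) (m₁ : Measure M) [IsProbabilityMeasure m₁]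
    (J Λ : M → ℝ) (A : Set M) (σ L ε : ℝ) (q : ℕ)
    (hf : BaseHypotheses (d := d) ζ f m₁ J Λ A σ L ε q)
    (G : M × K → K) (hG : Measurable G) (α : ℝ) (hα0 : 0 < α) (hα1 : α < 1)
    (hG1 : ContractsFibers m₁ G α) :
    (∃! μ₀ : ProbabilityMeasure (M × K),
      IsInvariantInSInfty (skewProduct f G) m₁ ζ hζ μ₀) ∧
    (∃ (P N : Module.End ℝ (SInfty (K := K) m₁ ζ hζ)) (ξ C : ℝ),
      IsSpectralGap (skewProduct f G) m₁ ζ hζ P N ξ C) ∧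
    ∀ μ₀ : ProbabilityMeasure (M × K), IsInvariantInSInfty (skewProduct f G) m₁ ζ hζ μ₀ →
    ∀ (P N : Module.End ℝ (SInfty (K := K) m₁ ζ hζ)) (ξ C : ℝ),
      IsSpectralGap (skewProduct f G) m₁ ζ hζ P N ξ C →
    ∀ g : M × K → ℝ, MemHolder ζ (onSumMetric g) →
    ∀ h : M × K → ℝ, Integrable h (μ₀ : Measure (M × K)) →
      (μ₀ : Measure (M × K)).withDensityᵥ h ∈ SInfty m₁ ζ hζ →
    ∀ n : ℕ, 1 ≤ n →
      |∫ p, g ((skewProduct f G)^[n] p) * h p ∂(μ₀ : Measure (M × K))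
          - (∫ p, g p ∂(μ₀ : Measure (M × K))) * ∫ p, h p ∂(μ₀ : Measure (M × K))|
        ≤ sinftyNorm m₁ ζ ((μ₀ : Measure (M × K)).withDensityᵥ h) * C
          * (fullHolderNorm ζ (onSumMetric g)).toReal * ξ ^ n := by
  have hdist : ∀ x y : M, dist x y ≤ 1 := fun x y => hdiam ▸
    Metric.dist_le_diam_of_mem isCompact_univ.isBounded (Set.mem_univ x) (Set.mem_univ y)
  obtain ⟨T, κ, V, hT⟩ := hf.exists_flatteningDual (hasIntermediatePoints_of_riemannian (d := d))
    hdist hζ hζ1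
  obtain ⟨ξ, Q, hξ0, hξ1, hQ, hdec⟩ := hT.exists_decay (K := K) hζ hf.invariant hG hα0 hα1 hG1
  have hdec : MassZeroDecay m₁ ζ (skewProduct f G) ξ Q := hdec
  have hF := measurable_skewProduct hf.invariant.measurable hG
  obtain ⟨μ₀, hinv, hfst⟩ := hdec.exists_invariant hξ0 hξ1 hζ hζ1 hf.invariant
    hf.localDiffeo.contMDiff.continuous hG hG1
  have hmem : (μ₀ : Measure (M × K)).toSignedMeasure ∈ SInfty m₁ ζ hζ :=
    (sBound_of_fst_eq hfst).mem hζ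
  refine ⟨⟨μ₀, ⟨hinv, hmem⟩, fun μ hμ => ?_⟩, ?_, ?_⟩
  · have hfix : ∀ ν : ProbabilityMeasure (M × K),
        (ν : Measure (M × K)).map (skewProduct f G) = ν →
        (ν : Measure (M × K)).toSignedMeasure.map (skewProduct f G)
          = (ν : Measure (M × K)).toSignedMeasure := fun ν hν => by
      rw [← toSignedMeasure_map _ hF]
      exact Measure.toSignedMeasure_congr hν
    -- The difference of two invariant probabilities is invariant and has mass zero; the marginal of
    -- `μ` need not be known.
    have hz : (μ : Measure (M × K)).toSignedMeasure - (μ₀ : Measure (M × K)).toSignedMeasure = 0 := by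
      refine hdec.eq_zero hξ0 hξ1 hζ1
        ((sBound_of_mem hμ.2 (lt_add_one _)).sub (sBound_of_mem hmem (lt_add_one _))) ?_ ?_
      · rw [sub_apply, toSignedMeasure_univ, toSignedMeasure_univ, sub_self]
      · refine (map_sub (VectorMeasure.mapₗ (R := ℝ) (M := ℝ) (skewProduct f G)) _ _).trans ?_
        exact congrArg₂ _ (hfix μ hμ.1) (hfix μ₀ hinv)
    have hm : (μ : Measure (M × K)) = μ₀ :=
      Measure.toSignedMeasure_eq_toSignedMeasure_iff.1 (sub_eq_zero.1 hz)
    exact Subtype.ext hm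
  · obtain ⟨P, N, h⟩ := hdec.exists_isSpectralGap hξ0 hξ1 hQ hζ hF hinv hfst
    exact ⟨P, N, ξ, 6 * Q, h⟩
  · intro μ hμ P N ξ' C h g hg k hk hkS n hn
    exact h.correlation_le hζ1 hF hμ.1 hμ.2 hg hk hkS hn
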